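/- **Theorem 3.1.** Let $M$ be a von Neumann algebra with a faithful normal tracial state $\tau$, acting in the GNS representation on $L^2(M,\tau)$. Let $M\bar\otimes M^{\mathrm{op}}$ be the von Neumann algebra tensor product of $M$ with its opposite algebra, acting on $L^2(M\bar\otimes M^{\mathrm{op}},\tau\otimes\tau^{\mathrm{op}})$. For a von Neumann algebra $N$ with a faithful normal tracial state $\rho$, acting on $L^2(N,\rho)$, write $\mathscr U(N)$ for the $*$-algebra of closed, densely defined operators affiliated with $N$ (with strong sum and strong product), equipped with the *measure topology*, i.e. the vector space topology with the basis of neighbourhoods of zero $$N(\varepsilon,\delta)=\{a\in\mathscr U(N) : \exists\, p\in \mathrm{Proj}(N),\ \|ap\|<\varepsilon,\ \rho(1-p)<\delta\},\qquad \varepsilon,\delta>0 .$$ Put $\mathscr M=\mathscr U(M)$ and $\mathscr U=\mathscr U(M\bar\otimes M^{\mathrm{op}})$. For a unital subalgebra $A\subset M$, a *derivation* $A\to\mathscr U$ is a linear map $\delta$ such that $$\delta(ab)=(a\otimes 1^{\mathrm{op}})\,\delta(b)+(1\otimes b^{\mathrm{op}})\,\delta(a)\qquad\text{for all } a,b\in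 A .$$ It is *norm–measure continuous* if it is continuous from the operator norm topology on $A$ to the measure topology on $\mathscr U$. 1. Let $A\subset M$ be a weakly dense unital $C^*$-subalgebra and let $\delta\colon A\to\mathscr U$ be a norm–measure continuous derivation. Then there is a unique norm–measure continuous derivation $M\to\mathscr U$ extending $\delta$. 2. Let $\delta\colon M\to\mathscr U$ be a norm–measure continuous derivation. Then $\delta$ is continuous from the strong operator topology on $M$ to the measure topology on $\mathscr U$. 3. Let $\delta\colon M\to\mathscr U$ be a norm–measure continuous derivation. Then $\delta$ is continuous from the measure topology on $M$ (the one induced by $M\subset\mathscr M$) to the measure topology on $\mathscr U$. In particular, there is a unique map $\mathscr M\to\mathscr U$ that extends $\delta$ and is continuous for the measure topologies. -/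

import Mathlib

open scoped Topology TensorProduct ComplexConjugate

noncomputable section

namespace AffDer

universe u

/-! ### The conjugate Hilbert space -/

/-- The conjugate Hilbert space of `H`: the same additive group and norm, with the scalar action
`c • ξ̄ = (conj c • ξ)̄ ` and the inner product `⟪ξ̄, η̄⟫ = ⟪η, ξ⟫`. -/
def Conj (H : Type u) : Type u := H

section Conj

variable {H : Type u} [NormedAddCommGroup H]

instance : NormedAddCommGroup (Conj H) := inferInstanceAs (NormedAddCommGroup H)

instance [CompleteSpace H] : CompleteSpace (Conj H) := inferInstanceAs (CompleteSpace H)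

/-- The identity map of the underlying groups, `ξ ↦ ξ̄`. -/
def toConj : H ≃+ Conj H := AddEquiv.refl H

variable [InnerProductSpace ℂ H]

instance : Module ℂ (Conj H) := Module.compHom H (starRingEnd ℂ)

theorem smul_toConj (c : ℂ) (ξ : H) : c • toConj ξ = toConj (conj c • ξ) := rfl

instance : InnerProductSpace ℂ (Conj H) where
  norm_smul_le c ξ := by
    change ‖(conj c • (toConj.symm ξ) : H)‖ ≤ ‖c‖ * ‖(toConj.symm ξ : H)‖
    rw [norm_smul, RCLike.norm_conj]
  inner ξ η := inner ℂ (toConj.symm η) (toConj.symm ξ)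
  norm_sq_eq_re_inner ξ := norm_sq_eq_re_inner (𝕜 := ℂ) (toConj.symm ξ : H)
  conj_inner_symm ξ η := inner_conj_symm (𝕜 := ℂ) (toConj.symm η : H) (toConj.symm ξ)
  add_left ξ η ζ := inner_add_right (𝕜 := ℂ) (toConj.symm ζ : H) (toConj.symm ξ) (toConj.symm η)
  smul_left ξ η c := inner_smul_right (𝕜 := ℂ) (toConj.symm η : H) (toConj.symm ξ) (conj c)

theorem inner_toConj (ξ η : H) : inner ℂ (toConj ξ) (toConj η) = inner ℂ η ξ := rfl

end Conj

variable {H : Type u} [NormedAddCommGroup H] [InnerProductSpace ℂ H] [CompleteSpace H]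

/-! ### The trace and the GNS representation -/

/-- The vector functional `τ(x) = ⟪Ω, x Ω⟫`. -/
def vtrace (Ω : H) (x : H →L[ℂ] H) : ℂ := inner ℂ Ω (x Ω)

/-- `M`, acting on `H`, is the GNS representation of the von Neumann algebra `M` with respect to
the faithful normal tracial state `τ = vtrace Ω`, and `Ω` is its canonical cyclic vector; thus `H`
is `L²(M, τ)` and `Ω` is the unit of `M` seen as a vector. (Normality of `τ` on `M` is automatic,
as `τ` is a vector functional.) -/
structure IsTracialGNS (M : VonNeumannAlgebra H) (Ω : H) : Prop where
  unital : vtrace Ω 1 = 1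
  tracial : ∀ x ∈ M, ∀ y ∈ M, vtrace Ω (x * y) = vtrace Ω (y * x)
  faithful : ∀ x ∈ M, vtrace Ω (star x * x) = 0 → x = 0
  cyclic : Dense {ξ : H | ∃ x ∈ M, x Ω = ξ}

/-! ### The von Neumann algebra generated by a set, and `M ⊗̄ Mᵒᵖ` -/

/-- The von Neumann algebra generated by a set `S` of operators: the double commutant of
`S ∪ S⋆`. -/
def generated (S : Set (H →L[ℂ] H)) : VonNeumannAlgebra H where
  toStarSubalgebra :=
    StarSubalgebra.centralizer ℂ (StarSubalgebra.centralizer ℂ S : Set (H →L[ℂ] H))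
  centralizer_centralizer' := by
    change Set.centralizer (Set.centralizer (Set.centralizer _)) = Set.centralizer _
    exact Set.centralizer_centralizer_centralizer _

theorem subset_generated (S : Set (H →L[ℂ] H)) : S ⊆ generated S := by
  intro x hx
  change x ∈ Set.centralizer _
  rw [Set.mem_centralizer_iff]
  rintro y (hy | hy)
  · exact ((Set.mem_centralizer_iff.1 hy) x (Or.inl hx)).symm
  · have h := (Set.mem_centralizer_iff.1 hy) (star x) (Or.inr (by simpa using hx))
    simpa using (congrArg star h)

/-- The operator `xᵒᵖ` of the opposite algebra `Mᵒᵖ` in its GNS representation. The GNS space of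
`(Mᵒᵖ, τ)` is the conjugate Hilbert space of `H`, with cyclic vector `Ω̄`, and `xᵒᵖ` acts on it
by `ξ̄ ↦ (x⋆ ξ)̄ `. This is linear and anti-multiplicative in `x`. -/
def opRep (x : H →L[ℂ] H) : Conj H →L[ℂ] Conj H where
  toFun ξ := toConj ((star x) (toConj.symm ξ))
  map_add' ξ η := by simp
  map_smul' c ξ := (star x).map_smul (conj c) (toConj.symm ξ : H)
  cont := (star x).continuous

theorem opRep_toConj (x : H →L[ℂ] H) (ξ : H) : opRep x (toConj ξ) = toConj ((star x) ξ) := rfl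

theorem opRep_mul (x y : H →L[ℂ] H) : opRep (x * y) = opRep y * opRep x := by
  ext ξ
  obtain ⟨ξ, rfl⟩ := toConj.surjective ξ
  simp [opRep_toConj]

theorem vtrace_opRep (Ω : H) (x : H →L[ℂ] H) :
    vtrace (toConj Ω) (opRep x) = vtrace Ω x := by
  rw [vtrace, opRep_toConj, inner_toConj, vtrace, ContinuousLinearMap.star_eq_adjoint,
    ContinuousLinearMap.adjoint_inner_left]

/-- The Hilbert space tensor product `H ⊗ H̄` (the completion of the algebraic tensor product);
for `H = L²(M, τ)` it is `L²(M ⊗̄ Mᵒᵖ)`. -/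
abbrev HTensor (H : Type u) [NormedAddCommGroup H] [InnerProductSpace ℂ H] : Type u :=
  UniformSpace.Completion (H ⊗[ℂ] Conj H)

/-- The bounded operator `x ⊗ yᵒᵖ` on `H ⊗ H̄`. -/
def tens (x y : H →L[ℂ] H) : HTensor H →L[ℂ] HTensor H :=
  (TensorProduct.mapL x (opRep y)).completion

/-- The cyclic vector `Ω ⊗ Ω̄`. -/
def tensVec (Ω : H) : HTensor H := ((Ω ⊗ₜ[ℂ] toConj Ω : H ⊗[ℂ] Conj H) : HTensor H)

/-- The vector functional of `Ω ⊗ Ω̄` is the tensor product of the traces. -/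
theorem vtrace_tens (Ω : H) (x y : H →L[ℂ] H) :
    vtrace (tensVec Ω) (tens x y) = vtrace Ω x * vtrace Ω y := by
  rw [← vtrace_opRep Ω y]
  simp [vtrace, tensVec, tens]

/-- The von Neumann algebra tensor product `M ⊗̄ Mᵒᵖ`, acting on `H ⊗ H̄`. -/
def sq (M : VonNeumannAlgebra H) : VonNeumannAlgebra (HTensor H) :=
  generated {T | ∃ x ∈ M, ∃ y ∈ M, T = tens x y}

/-! ### Affiliated operators -/

/-- The densely defined closed operators affiliated with `N`, i.e. commuting with every unitary
of the commutant of `N`. -/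
structure Affiliated (N : VonNeumannAlgebra H) where
  op : H →ₗ.[ℂ] H
  dense : Dense (op.domain : Set H)
  closed : op.IsClosed
  affiliated : ∀ u ∈ N.commutant, u ∈ unitary (H →L[ℂ] H) →
    ∀ ξ η : H, (ξ, η) ∈ op.graph → (u ξ, u η) ∈ op.graph

/-- The (strong) sum in the algebra of affiliated operators: the closure of `a + b`. -/
def ssum (a b : H →ₗ.[ℂ] H) : H →ₗ.[ℂ] H := (a + b).closure

/-- The (strong) difference in the algebra of affiliated operators: the closure of `a - b`. -/
def sdiff (a b : H →ₗ.[ℂ] H) : H →ₗ.[ℂ] H := (a - b).closure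

/-- Scalar multiplication in the algebra of affiliated operators: the closure of `c a`. -/
def ssmul (c : ℂ) (a : H →ₗ.[ℂ] H) : H →ₗ.[ℂ] H := (c • a).closure

/-- The (strong) product of a bounded operator and an affiliated operator: the closure of `T a`. -/
def smulL (T : H →L[ℂ] H) (a : H →ₗ.[ℂ] H) : H →ₗ.[ℂ] H :=
  ((T : H →ₗ[ℂ] H).compPMap a).closure

/-- An element of `N` as an affiliated operator. -/
def ofMem (N : VonNeumannAlgebra H) (x : H →L[ℂ] H) (hx : x ∈ N) : Affiliated N where
  op := (x : H →ₗ[ℂ] H).toPMap ⊤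
  dense := by simp
  closed := by
    have h : (((x : H →ₗ[ℂ] H).toPMap ⊤).graph : Set (H × H)) = {p | x p.1 = p.2} := by
      ext p
      simp
    rw [LinearPMap.IsClosed, h]
    exact isClosed_eq (by fun_prop) (by fun_prop)
  affiliated := by
    intro u hu _ ξ η h
    have h2 := VonNeumannAlgebra.mem_commutant_iff.1 hu x hx
    have h3 : x (u ξ) = u (x ξ) := congrArg (fun T : H →L[ℂ] H => T ξ) h2
    simp at h ⊢
    rw [h3, h]

/-! ### Topologies -/

/-- The set `N(ε, δ)` of operators `a` for which there is a projection `p ∈ N` such that `a p` is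
bounded and everywhere defined, `‖a p‖ < ε`, and `τ(1 - p) < δ`, where `τ = vtrace Ω`. -/
def measureNhd (N : VonNeumannAlgebra H) (Ω : H) (ε δ : ℝ) : Set (H →ₗ.[ℂ] H) :=
  {a | ∃ p ∈ N, IsStarProjection p ∧
    (∃ T : H →L[ℂ] H, ‖T‖ < ε ∧ ∀ ξ, (p ξ, T ξ) ∈ a.graph) ∧ (vtrace Ω (1 - p)).re < δ}

theorem measureNhd_mono (N : VonNeumannAlgebra H) (Ω : H) {ε ε' δ δ' : ℝ} (hε : ε ≤ ε')
    (hδ : δ ≤ δ') : measureNhd N Ω ε δ ⊆ measureNhd N Ω ε' δ' := by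
  rintro a ⟨p, hp, hp', ⟨T, hT, hT'⟩, h⟩
  exact ⟨p, hp, hp', ⟨T, hT.trans_le hε, hT'⟩, h.trans_le hδ⟩

/-- The measure topology on the operators affiliated with `N`: the sets `b + N(ε, δ)`,
`ε, δ > 0`, form a basis of neighbourhoods of `b`. -/
@[reducible] def measureTopology (N : VonNeumannAlgebra H) (Ω : H) : TopologicalSpace (Affiliated N) where
  IsOpen U := ∀ b ∈ U, ∃ ε > 0, ∃ δ > 0, ∀ a : Affiliated N,
    sdiff a.op b.op ∈ measureNhd N Ω ε δ → a ∈ U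
  isOpen_univ _ _ := ⟨1, one_pos, 1, one_pos, fun _ _ => trivial⟩
  isOpen_inter U V hU hV b hb := by
    obtain ⟨ε₁, hε₁, δ₁, hδ₁, h₁⟩ := hU b hb.1
    obtain ⟨ε₂, hε₂, δ₂, hδ₂, h₂⟩ := hV b hb.2
    exact ⟨min ε₁ ε₂, lt_min hε₁ hε₂, min δ₁ δ₂, lt_min hδ₁ hδ₂, fun a ha =>
      ⟨h₁ a (measureNhd_mono N Ω (min_le_left _ _) (min_le_left _ _) ha),
        h₂ a (measureNhd_mono N Ω (min_le_right _ _) (min_le_right _ _) ha)⟩⟩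
  isOpen_sUnion S hS b hb := by
    obtain ⟨U, hU, hbU⟩ := hb
    obtain ⟨ε, hε, δ, hδ, h⟩ := hS U hU b hbU
    exact ⟨ε, hε, δ, hδ, fun a ha => ⟨U, hU, h a ha⟩⟩

/-- The topology of the operator norm on a subalgebra of the bounded operators. -/
@[reducible] def normTopology (A : StarSubalgebra ℂ (H →L[ℂ] H)) : TopologicalSpace A :=
  TopologicalSpace.induced (fun x : A => (x : H →L[ℂ] H)) inferInstance

/-- The strong operator topology (pointwise norm convergence on `H`). -/
@[reducible] def strongTopology (A : StarSubalgebra ℂ (H →L[ℂ] H)) : TopologicalSpace A :=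
  TopologicalSpace.induced (fun (x : A) (ξ : H) => (x : H →L[ℂ] H) ξ) Pi.topologicalSpace

/-- The measure topology on `M` itself, induced by the inclusion of `M` in the operators
affiliated with `M`. -/
@[reducible] def measureTopologyOn (M : VonNeumannAlgebra H) (Ω : H) : TopologicalSpace M.toStarSubalgebra :=
  TopologicalSpace.induced (fun x : M.toStarSubalgebra => ofMem M x x.2) (measureTopology M Ω)

/-- `A` is a unital C⋆-subalgebra of `M` (a norm closed unital ⋆-subalgebra) which is dense in `M`
for the weak operator topology. -/
structure IsWeaklyDenseCStar (M : VonNeumannAlgebra H) (A : StarSubalgebra ℂ (H →L[ℂ] H)) :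
    Prop where
  le : A ≤ M.toStarSubalgebra
  closed : IsClosed (A : Set (H →L[ℂ] H))
  dense : ∀ x ∈ M, (ContinuousLinearMapWOT.ofCLM x : H →WOT[ℂ] H) ∈
    closure ((ContinuousLinearMapWOT.ofCLM : _ → H →WOT[ℂ] H) '' (A : Set (H →L[ℂ] H)))

/-! ### Derivations -/

/-- A derivation from `A ⊆ M` into the algebra `𝒰` of operators affiliated with `M ⊗̄ Mᵒᵖ`, with
the bimodule structure `a · ξ = (a ⊗ 1ᵒᵖ) ξ` and `ξ · b = (1 ⊗ bᵒᵖ) ξ`. All operations are those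
of the algebra `𝒰`. -/
structure IsDerivation (M : VonNeumannAlgebra H) (A : StarSubalgebra ℂ (H →L[ℂ] H))
    (D : A → Affiliated (sq M)) : Prop where
  map_add : ∀ a b : A, (D (a + b)).op = ssum (D a).op (D b).op
  map_smul : ∀ (c : ℂ) (a : A), (D (c • a)).op = ssmul c (D a).op
  leibniz : ∀ a b : A, (D (a * b)).op =
    ssum (smulL (tens (a : H →L[ℂ] H) 1) (D b).op) (smulL (tens 1 (b : H →L[ℂ] H)) (D a).op)

/-- Continuity from the norm topology to the measure topology. -/
def NormMeasureContinuous (M : VonNeumannAlgebra H) (Ω : H) (A : StarSubalgebra ℂ (H →L[ℂ] H))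
    (D : A → Affiliated (sq M)) : Prop :=
  Continuous[normTopology A, measureTopology (sq M) (tensVec Ω)] D

end AffDer

end

/-! The heart of the matter is that a norm–measure continuous derivation `δ` is already continuous
for the measure topology on its domain. Let `a` be small in measure and let `b = f(a⋆a)`, with a
continuous `f` equal to 1 near 0 and vanishing away from 0; such a `b` stays in a C⋆-algebra, where
spectral projections need not exist. The Leibniz rule gives `δ(a) = δ(ab) - (a ⊗ 1) δ(b) + (1 ⊗ (1 -
b)ᵒᵖ) δ(a)`. The first term is small because `‖ab‖` is small. In the second, `‖b‖ ≤ 1` bounds `δ(b)`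
in measure uniformly, and `a` is small in measure. In the third, `1 - b` vanishes on a subspace of
small codimension, so the product is small however large `δ(a)` may be. This is
`IsDerivation.exists_measure_continuity`, built on `exists_cutoff` and `codim_ker_cutoff_lt`.

The affiliated operators form a complete Hausdorff group for the measure topology, so `δ` extends
continuously to all operators affiliated with `M` once its domain is dense in measure. A weakly
dense `A` is dense because `AΩ` is norm dense in `MΩ` and `‖xΩ‖` controls `x` in measure, as in
Chebyshev's inequality (`of_mem_ball_of_norm_lt`). The same estimate makes the inclusion of `M`
strong–measure continuous. Existence, uniqueness and both continuity statements then follow from the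
one extension.

The calculus of affiliated operators rests on the dimension function `codim` on closed subspaces
invariant under the commutant. The trace enters through `codim_ker_star`, which yields
`codim_comap_le` and subadditivity under intersections. Graph projections have matrix entries in
`N`; this shows that affiliated operators are bounded on large subspaces (`exists_bounded`) and are
determined there (`eq_of_eventually`). -/

noncomputable section

namespace AffDer

universe u

open Filter

section

variable {H : Type u} [NormedAddCommGroup H] [InnerProductSpace ℂ H] [CompleteSpace H]

/-! ### Closed subspaces affiliated with a von Neumann algebra -/

/-- A closed subspace invariant under the commutant of `N`. -/
structure InvSub (N : VonNeumannAlgebra H) where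
  sub : Submodule ℂ H
  isClosed : IsClosed (sub : Set H)
  inv : ∀ u ∈ N.commutant, ∀ ξ ∈ sub, u ξ ∈ sub

namespace InvSub

variable {N : VonNeumannAlgebra H}

instance : Membership H (InvSub N) := ⟨fun K ξ => ξ ∈ K.sub⟩

instance (K : InvSub N) : K.sub.HasOrthogonalProjection :=
  haveI := K.isClosed.completeSpace_coe
  inferInstance

theorem commutant_apply {x u : H →L[ℂ] H} (hx : x ∈ N) (hu : u ∈ N.commutant) (ξ : H) :
    x (u ξ) = u (x ξ) :=
  congrArg (fun T : H →L[ℂ] H => T ξ) (VonNeumannAlgebra.mem_commutant_iff.1 hu x hx)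

/-- The orthogonal projection onto the subspace. -/
def proj (K : InvSub N) : H →L[ℂ] H := K.sub.starProjection

theorem proj_mem_self (K : InvSub N) (ξ : H) : K.proj ξ ∈ K :=
  K.sub.starProjection_apply_mem ξ

theorem proj_eq_self {K : InvSub N} {ξ : H} (h : ξ ∈ K) : K.proj ξ = ξ :=
  Submodule.starProjection_eq_self_iff.2 h

theorem proj_mem (K : InvSub N) : K.proj ∈ N := by
  rw [proj, VonNeumannAlgebra.IsStarProjection.mem_iff isStarProjection_starProjection]
  intro y hy
  rw [Submodule.range_starProjection]
  exact fun ξ hξ => K.inv y hy ξ hξ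

theorem proj_isStarProjection (K : InvSub N) : IsStarProjection K.proj :=
  isStarProjection_starProjection

theorem norm_proj_apply_le (K : InvSub N) (ξ : H) : ‖K.proj ξ‖ ≤ ‖ξ‖ :=
  K.sub.norm_starProjection_apply_le ξ

theorem norm_mul_proj_le (K : InvSub N) (T : H →L[ℂ] H) : ‖T * K.proj‖ ≤ ‖T‖ := by
  refine ContinuousLinearMap.opNorm_le_bound _ (norm_nonneg _) fun ξ => ?_
  exact (T.le_opNorm _).trans (by gcongr; exact K.norm_proj_apply_le ξ)

/-- The kernel of an element of `N`. -/
def ker (x : H →L[ℂ] H) (hx : x ∈ N) : InvSub N where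
  sub := LinearMap.ker (x : H →ₗ[ℂ] H)
  isClosed := x.isClosed_ker
  inv u hu ξ hξ := by
    simp only [LinearMap.mem_ker, ContinuousLinearMap.coe_coe] at hξ ⊢
    rw [commutant_apply hx hu, hξ, map_zero]

@[simp] theorem mem_ker {x : H →L[ℂ] H} {hx : x ∈ N} {ξ : H} : ξ ∈ ker x hx ↔ x ξ = 0 := Iff.rfl

/-- The preimage of an affiliated closed subspace under an element of `N`. -/
def comap (K : InvSub N) (x : H →L[ℂ] H) (hx : x ∈ N) : InvSub N where
  sub := K.sub.comap (x : H →ₗ[ℂ] H)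
  isClosed := K.isClosed.preimage x.continuous
  inv u hu ξ hξ := by
    simp only [Submodule.mem_comap, ContinuousLinearMap.coe_coe] at hξ ⊢
    rw [commutant_apply hx hu]
    exact K.inv u hu _ hξ

@[simp] theorem mem_comap {K : InvSub N} {x : H →L[ℂ] H} {hx : x ∈ N} {ξ : H} :
    ξ ∈ K.comap x hx ↔ x ξ ∈ K := Iff.rfl

/-- The intersection of a family of affiliated closed subspaces. -/
def iInter {ι : Sort*} (K : ι → InvSub N) : InvSub N where
  sub := ⨅ i, (K i).sub
  isClosed := by
    rw [Submodule.coe_iInf]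
    exact isClosed_iInter fun i => (K i).isClosed
  inv u hu ξ hξ := by
    rw [Submodule.mem_iInf] at hξ ⊢
    exact fun i => (K i).inv u hu ξ (hξ i)

@[simp] theorem mem_iInter {ι : Sort*} {K : ι → InvSub N} {ξ : H} :
    ξ ∈ iInter K ↔ ∀ i, ξ ∈ K i := Submodule.mem_iInf _

/-- The intersection of two affiliated closed subspaces. -/
def inter (K L : InvSub N) : InvSub N where
  sub := K.sub ⊓ L.sub
  isClosed := K.isClosed.inter L.isClosed
  inv u hu ξ hξ := ⟨K.inv u hu ξ hξ.1, L.inv u hu ξ hξ.2⟩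

@[simp] theorem mem_inter {K L : InvSub N} {ξ : H} : ξ ∈ K.inter L ↔ ξ ∈ K ∧ ξ ∈ L := Iff.rfl

/-- The whole space. -/
def univ (N : VonNeumannAlgebra H) : InvSub N where
  sub := ⊤
  isClosed := isClosed_univ
  inv _ _ _ _ := trivial

@[simp] theorem mem_univ (ξ : H) : ξ ∈ univ N := trivial

/-- The range of a projection in `N`. -/
def ofProj (p : H →L[ℂ] H) (hp : p ∈ N) : InvSub N := ker (1 - p) (sub_mem (one_mem N) hp)

theorem mem_ofProj {p : H →L[ℂ] H} {hp : p ∈ N} {ξ : H} : ξ ∈ ofProj p hp ↔ p ξ = ξ := by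
  change ξ - p ξ = 0 ↔ _
  rw [sub_eq_zero, eq_comm]

theorem proj_ofProj {p : H →L[ℂ] H} (hp : p ∈ N) (h : IsStarProjection p) :
    (ofProj p hp).proj = p := by
  have h1 := isStarProjection_iff_eq_starProjection_range.1 h
  obtain ⟨h2, h3⟩ := h1
  refine Eq.trans ?_ h3.symm
  rw [proj]
  congr 1
  ext ξ
  constructor
  · intro hξ
    exact ⟨ξ, mem_ofProj.1 hξ⟩
  · rintro ⟨η, rfl⟩
    refine mem_ofProj.2 ?_
    exact congrArg (fun T : H →L[ℂ] H => T η) h.isIdempotentElem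

/-- The squared distance of the trace vector to the subspace, that is, the trace of the
projection onto the orthogonal complement. -/
def codim (Ω : H) (K : InvSub N) : ℝ := ‖Ω - K.proj Ω‖ ^ 2

theorem codim_nonneg (Ω : H) (K : InvSub N) : 0 ≤ codim Ω K := sq_nonneg _

theorem vtrace_one_sub_proj (Ω : H) (K : InvSub N) :
    (vtrace Ω (1 - K.proj)).re = codim Ω K := by
  have h := norm_sub_sq (𝕜 := ℂ) Ω (K.proj Ω)
  have h2 := Submodule.re_inner_starProjection_eq_normSq (𝕜 := ℂ) (K := K.sub) Ω
  have h3 := inner_re_symm (𝕜 := ℂ) (K.proj Ω) Ω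
  have h4 := inner_self_eq_norm_sq (𝕜 := ℂ) Ω
  change RCLike.re (inner ℂ (K.proj Ω) Ω) = ‖K.proj Ω‖ ^ 2 at h2
  rw [codim, h]
  simp only [vtrace, sub_apply, one_apply_eq_self, inner_sub_right,
    Complex.sub_re] at *
  simp only [RCLike.re_to_complex] at *
  linarith

theorem codim_mono {Ω : H} {K L : InvSub N} (h : ∀ ξ, ξ ∈ K → ξ ∈ L) : codim Ω L ≤ codim Ω K := by
  unfold codim
  gcongr
  rw [proj, Submodule.starProjection_minimal]
  exact ciInf_le ⟨0, by rintro _ ⟨x, rfl⟩; exact norm_nonneg _⟩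
    (⟨K.proj Ω, h _ (K.proj_mem_self Ω)⟩ : L.sub)

theorem codim_univ (Ω : H) : codim Ω (univ N) = 0 := by
  have : (univ N).proj Ω = Ω := proj_eq_self (mem_univ Ω)
  simp [codim, this]

theorem codim_eq_one_sub {Ω : H} (hΩ : ‖Ω‖ = 1) (K : InvSub N) :
    codim Ω K = 1 - (vtrace Ω K.proj).re := by
  rw [← vtrace_one_sub_proj]
  simp [vtrace, hΩ]

end InvSub

theorem IsTracialGNS.norm_eq_one {N : VonNeumannAlgebra H} {Ω : H} (h : IsTracialGNS N Ω) :
    ‖Ω‖ = 1 := by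
  have h1 := h.unital
  simp only [vtrace, one_apply_eq_self, inner_self_eq_norm_sq_to_K] at h1
  have h2 : ‖Ω‖ ^ 2 = 1 := RCLike.ofReal_injective (K := ℂ) (by simpa using h1)
  nlinarith [norm_nonneg Ω]


/-! ### Dimension theory -/

/-- For a contraction `x` one has `0 ≤ x x⋆ ≤ 1`. The mean ergodic theorem will be applied to the
contraction `1 - x x⋆`. -/
theorem norm_one_sub_mul_star_le {x : H →L[ℂ] H} (hx : ‖x‖ ≤ 1) : ‖1 - x * star x‖ ≤ 1 := by
  refine ContinuousLinearMap.opNorm_le_bound _ zero_le_one fun ξ => ?_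
  have h1 : inner ℂ ξ (x ((star x) ξ)) = ((‖(star x) ξ‖ ^ 2 : ℝ) : ℂ) := by
    rw [← ContinuousLinearMap.adjoint_inner_left, ← ContinuousLinearMap.star_eq_adjoint,
      inner_self_eq_norm_sq_to_K]
    simp
  have h2 : ‖x ((star x) ξ)‖ ≤ ‖(star x) ξ‖ := by
    simpa using x.le_of_opNorm_le hx ((star x) ξ)
  have h3 := norm_sub_sq (𝕜 := ℂ) ξ (x ((star x) ξ))
  rw [h1] at h3
  have h4 : ‖ξ - x ((star x) ξ)‖ ^ 2 ≤ ‖ξ‖ ^ 2 := by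
    rw [h3]
    simp only [RCLike.re_to_complex, Complex.ofReal_re]
    nlinarith [norm_nonneg (x ((star x) ξ)), norm_nonneg ((star x) ξ)]
  rw [one_mul]
  exact le_of_sq_le_sq h4 (norm_nonneg _)

omit [CompleteSpace H] in
theorem vtrace_add (Ω : H) (x y : H →L[ℂ] H) : vtrace Ω (x + y) = vtrace Ω x + vtrace Ω y := by
  simp [vtrace]

omit [CompleteSpace H] in
theorem vtrace_sub (Ω : H) (x y : H →L[ℂ] H) : vtrace Ω (x - y) = vtrace Ω x - vtrace Ω y := by
  simp [vtrace]

/-- The mean ergodic theorem computes the trace of the projection onto `ker x⋆`. -/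
theorem tendsto_average_vtrace {N : VonNeumannAlgebra H} (Ω : H) {x : H →L[ℂ] H} (hx : x ∈ N)
    (h : ‖x‖ ≤ 1) :
    Tendsto (fun n : ℕ => (n : ℂ)⁻¹ * ∑ k ∈ Finset.range n, vtrace Ω ((1 - x * star x) ^ k)) atTop
      (𝓝 (vtrace Ω (InvSub.ker (star x) (star_mem hx)).proj)) := by
  have h1 := (1 - x * star x).tendsto_birkhoffAverage_orthogonalProjection
    (norm_one_sub_mul_star_le h) Ω
  -- The fixed vectors are those with `x x⋆ ξ = 0`, equivalently `‖x⋆ ξ‖ = 0`.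
  have h2 : ((1 - x * star x).eqLocus (1 : H →L[ℂ] H)) =
      (InvSub.ker (star x) (star_mem hx)).sub := by
    ext ξ
    change (1 - x * star x) ξ = ξ ↔ (star x) ξ = 0
    constructor
    · intro h3
      have h4 : x ((star x) ξ) = 0 := by simpa using h3
      rw [← inner_self_eq_zero (𝕜 := ℂ)]
      nth_rw 1 [ContinuousLinearMap.star_eq_adjoint]
      rw [ContinuousLinearMap.adjoint_inner_left, h4, inner_zero_right]
    · intro h3
      simp [h3]
  have h5 : (((1 - x * star x).eqLocus (1 : H →L[ℂ] H)).orthogonalProjectionOnto Ω : H) =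
      (InvSub.ker (star x) (star_mem hx)).proj Ω := by
    rw [InvSub.proj, ← Submodule.starProjection_apply]
    congr 2
  rw [h5] at h1
  have h6 := (tendsto_const_nhds (x := Ω)).inner (𝕜 := ℂ) h1
  refine h6.congr fun n => ?_
  simp only [birkhoffAverage, birkhoffSum, inner_smul_right, inner_sum, vtrace, id]
  congr 2
  ext k
  congr 1
  induction k with
  | zero => simp
  | succ k ih => rw [Function.iterate_succ_apply', ih, pow_succ']; rfl

/-- The intertwining relation `(1 - x x⋆)^k x = x (1 - x⋆ x)^k` and the trace property match the two
sides by induction. Hence the ergodic averages attached to `x` and to `x⋆` have equal traces. -/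
theorem IsTracialGNS.vtrace_pow {N : VonNeumannAlgebra H} {Ω : H} (hN : IsTracialGNS N Ω)
    {x : H →L[ℂ] H} (hx : x ∈ N) (k : ℕ) :
    vtrace Ω ((1 - x * star x) ^ k) = vtrace Ω ((1 - star x * x) ^ k) := by
  have hc : ∀ k : ℕ, (1 - x * star x) ^ k * x = x * (1 - star x * x) ^ k := by
    intro k
    induction k with
    | zero => simp
    | succ k ih =>
      rw [pow_succ, pow_succ', mul_assoc]
      have : (1 - x * star x) * x = x * (1 - star x * x) := by noncomm_ring
      rw [this, ← mul_assoc, ih, mul_assoc, ← pow_succ, ← pow_succ']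
  induction k with
  | zero => simp
  | succ k ih =>
    have h1 : (1 - x * star x) ^ (k + 1) =
        (1 - x * star x) ^ k - (x * (1 - star x * x) ^ k) * star x := by
      rw [pow_succ, mul_sub, mul_one, ← mul_assoc, hc]
    have h2 : (1 - star x * x) ^ (k + 1) =
        (1 - star x * x) ^ k - star x * (x * (1 - star x * x) ^ k) := by
      rw [pow_succ', sub_mul, one_mul, mul_assoc]
    rw [h1, h2, vtrace_sub, vtrace_sub, ih, hN.tracial _ _ _ (star_mem hx)]
    exact mul_mem hx (pow_mem (sub_mem (one_mem N) (mul_mem (star_mem hx) hx)) k)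

namespace InvSub

variable {N : VonNeumannAlgebra H} {Ω : H}

/-- After scaling `x` to a contraction, both sides are limits of ergodic averages with the same
trace. This plays the role of the polar decomposition, which would exhibit the two complements as
equivalent projections. -/
theorem codim_ker_star (hN : IsTracialGNS N Ω) {x : H →L[ℂ] H} (hx : x ∈ N) :
    codim Ω (ker (star x) (star_mem hx)) = codim Ω (ker x hx) := by
  have key : ∀ y : H →L[ℂ] H, ∀ hy : y ∈ N, ‖y‖ ≤ 1 →
      codim Ω (ker (star y) (star_mem hy)) = codim Ω (ker y hy) := by
    intro y hy h1
    have h2 := tendsto_average_vtrace Ω hy h1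
    have h3 := tendsto_average_vtrace Ω (star_mem hy) (by rwa [norm_star])
    simp only [star_star] at h3
    simp only [hN.vtrace_pow hy] at h2
    rw [codim_eq_one_sub hN.norm_eq_one, codim_eq_one_sub hN.norm_eq_one,
      tendsto_nhds_unique h2 h3]
  by_cases h0 : x = 0
  · subst h0
    congr 2
    simp
  have h1 : (‖x‖ : ℂ)⁻¹ ≠ 0 := by simpa using h0
  have h2 : (‖x‖ : ℂ)⁻¹ • x ∈ N := N.toStarSubalgebra.smul_mem hx _
  have h3 := key _ h2 (by simp [norm_smul, h0])
  have h4 : ker ((‖x‖ : ℂ)⁻¹ • x) h2 = ker x hx := by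
    unfold ker
    congr 1
    ext ξ
    simp [h0]
  have h5 : ker (star ((‖x‖ : ℂ)⁻¹ • x)) (star_mem h2) = ker (star x) (star_mem hx) := by
    unfold ker
    congr 1
    ext ξ
    simp [h0]
  rwa [h4, h5] at h3

/-- Put `y = (1 - p) x`, with `p` the projection onto `K`. Then `ker y` lies in the preimage of `K`,
while `K` lies in `ker y⋆`; the two kernels have equal codimension. -/
theorem codim_comap_le (hN : IsTracialGNS N Ω) (K : InvSub N) {x : H →L[ℂ] H} (hx : x ∈ N) :
    codim Ω (K.comap x hx) ≤ codim Ω K := by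
  have hy : (1 - K.proj) * x ∈ N := mul_mem (sub_mem (one_mem N) K.proj_mem) hx
  have h1 := codim_ker_star hN hy
  refine (codim_mono ?_).trans (h1.ge.trans (codim_mono ?_))
  · intro ξ hξ
    have h2 : x ξ - K.proj (x ξ) = 0 := hξ
    rw [sub_eq_zero] at h2
    rw [mem_comap, h2]
    exact K.proj_mem_self _
  · intro ξ hξ
    have h2 : star ((1 - K.proj) * x) = star x * (1 - K.proj) := by
      rw [star_mul, star_sub, star_one, K.proj_isStarProjection.isSelfAdjoint.star_eq]
    rw [mem_ker, h2]
    simp [proj_eq_self hξ]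

/-- The preimage of `K` under the projection onto `L` is `(K ∩ L) ⊕ Lᗮ`. By Pythagoras its
codimension falls short of that of `K ∩ L` by exactly `codim L`, and it is at most `codim K`. -/
theorem codim_inter_le (hN : IsTracialGNS N Ω) (K L : InvSub N) :
    codim Ω (K.inter L) ≤ codim Ω K + codim Ω L := by
  have h1 := codim_comap_le hN K L.proj_mem
  have h0 : ∀ K : InvSub N, ∀ w ∈ K, inner ℂ (Ω - K.proj Ω) w = 0 :=
    fun K w hw => K.sub.starProjection_inner_eq_zero Ω w hw
  have hI := (K.inter L).proj_mem_self Ω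
  have hm : (K.comap L.proj L.proj_mem).proj Ω = (K.inter L).proj Ω + (Ω - L.proj Ω) := by
    refine Submodule.eq_starProjection_of_mem_of_inner_eq_zero ?_ ?_
    · refine mem_comap.2 ?_
      rw [map_add, map_sub, proj_eq_self hI.2, proj_eq_self (L.proj_mem_self Ω), sub_self, add_zero]
      exact hI.1
    · intro w hw
      have h2 : Ω - ((K.inter L).proj Ω + (Ω - L.proj Ω)) = L.proj Ω - (K.inter L).proj Ω := by abel
      have h3 : L.proj (L.proj Ω - (K.inter L).proj Ω) = L.proj Ω - (K.inter L).proj Ω := by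
        rw [map_sub, proj_eq_self hI.2, proj_eq_self (L.proj_mem_self Ω)]
      have h4 : L.proj Ω - (K.inter L).proj Ω = (Ω - (K.inter L).proj Ω) - (Ω - L.proj Ω) := by abel
      rw [h2, ← h3]
      refine (Submodule.inner_starProjection_left_eq_right L.sub _ w).trans ?_
      change inner ℂ _ (L.proj w) = 0
      rw [h4, inner_sub_left, h0 (K.inter L) (L.proj w) (mem_inter.2 ⟨hw, L.proj_mem_self w⟩), h0 _ _ (L.proj_mem_self w), sub_zero]
  have h5 : Ω - (K.inter L).proj Ω = (Ω - L.proj Ω) + (L.proj Ω - (K.inter L).proj Ω) := by abel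
  have h6 : Ω - (K.comap L.proj L.proj_mem).proj Ω = L.proj Ω - (K.inter L).proj Ω := by
    rw [hm]; abel
  have h7 : codim Ω (K.inter L) = codim Ω L + codim Ω (K.comap L.proj L.proj_mem) := by
    simp only [codim, h6, h5]
    refine (pow_two _).trans ((norm_add_sq_eq_norm_sq_add_norm_sq_of_inner_eq_zero (𝕜 := ℂ) _ _ ?_).trans
      (by simp only [pow_two]))
    exact h0 _ _ (L.sub.sub_mem (L.proj_mem_self Ω) hI.2)
  linarith

/-- The orthogonal complements increase, and their projections converge strongly to the projection
onto the complement of the intersection. -/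
theorem codim_iInter_le_of_antitone {K : ℕ → InvSub N} (hK : ∀ n, ∀ ξ ∈ K (n + 1), ξ ∈ K n)
    {c : ℝ} (hc : ∀ n, codim Ω (K n) ≤ c) : codim Ω (iInter K) ≤ c := by
  have hm : Monotone fun n => (K n).subᗮ :=
    monotone_nat_of_le_succ fun n => Submodule.orthogonal_le (hK n)
  have : ∀ n, ((K n).subᗮ).HasOrthogonalProjection := fun n => inferInstance
  have h1 := Submodule.starProjection_tendsto_closure_iSup (𝕜 := ℂ) (fun n => (K n).subᗮ) hm Ω
  have h2 : (⨆ n, (K n).subᗮ).topologicalClosure = (iInter K).subᗮ := by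
    rw [← Submodule.orthogonal_orthogonal_eq_closure, ← Submodule.iInf_orthogonal]
    congr 1
    simp only [iInter]
    congr 1
    ext1 n
    rw [Submodule.orthogonal_orthogonal_eq_closure]
    exact (K n).isClosed.submodule_topologicalClosure_eq
  simp_rw [h2] at h1
  simp only [Submodule.starProjection_orthogonal_val] at h1
  exact le_of_tendsto' (h1.norm.pow 2) hc

theorem codim_iInter_le (hN : IsTracialGNS N Ω) {K : ℕ → InvSub N} {c : ℝ}
    (hc : ∀ m, ∑ n ∈ Finset.range m, codim Ω (K n) ≤ c) : codim Ω (iInter K) ≤ c := by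
  let P : ℕ → InvSub N := fun m => iInter fun n : Fin m => K n
  have h1 : ∀ m, codim Ω (P m) ≤ ∑ n ∈ Finset.range m, codim Ω (K n) := by
    intro m
    induction m with
    | zero =>
      rw [Finset.sum_range_zero, ← codim_univ (N := N) Ω]
      exact codim_mono fun ξ _ => mem_iInter.2 fun i => i.elim0
    | succ m ih =>
      rw [Finset.sum_range_succ]
      refine (codim_mono ?_).trans ((codim_inter_le hN (P m) (K m)).trans (by gcongr))
      rintro ξ ⟨h1, h2⟩
      refine mem_iInter.2 fun i => ?_
      rcases Nat.lt_succ_iff_lt_or_eq.1 i.2 with h | h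
      · exact mem_iInter.1 h1 ⟨i, h⟩
      · rw [h]; exact h2
  refine (codim_mono ?_).trans (codim_iInter_le_of_antitone (K := P) ?_
    fun m => (h1 m).trans (hc m))
  · exact fun ξ hξ => mem_iInter.2 fun n => mem_iInter.1 (mem_iInter.1 hξ (n + 1)) ⟨n, n.lt_succ_self⟩
  · exact fun n ξ hξ => mem_iInter.2 fun i => mem_iInter.1 hξ ⟨i, i.2.trans n.lt_succ_self⟩

theorem codim_iInter_fintype_le (hN : IsTracialGNS N Ω) {ι : Type*} [Fintype ι]
    (K : ι → InvSub N) : codim Ω (iInter K) ≤ ∑ i, codim Ω (K i) := by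
  have e := Fintype.equivFin ι
  -- The finite family is padded with the whole space, of codimension zero.
  let K' : ℕ → InvSub N := fun n => if h : n < Fintype.card ι then K (e.symm ⟨n, h⟩) else univ N
  have h1 : ∀ m, ∑ n ∈ Finset.range m, codim Ω (K' n) ≤ ∑ i, codim Ω (K i) := by
    intro m
    have h2 : ∑ i, codim Ω (K i) = ∑ n ∈ Finset.range (Fintype.card ι), codim Ω (K' n) := by
      rw [Finset.sum_range, ← e.symm.sum_comp]
      refine Finset.sum_congr rfl fun i _ => ?_
      simp [K']
    rw [h2]
    rw [Finset.sum_subset (Finset.range_mono (le_max_right m (Fintype.card ι)))]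
    · exact Finset.sum_le_sum_of_subset_of_nonneg (Finset.range_mono (le_max_left _ _))
        fun n _ _ => codim_nonneg _ _
    · intro n _ hn
      have : ¬ n < Fintype.card ι := by simpa using hn
      simp [K', this, codim_univ]
  refine (codim_mono ?_).trans (codim_iInter_le hN h1)
  intro ξ hξ
  refine mem_iInter.2 fun i => ?_
  have h2 := mem_iInter.1 hξ (e i)
  simpa [K'] using h2

/-- A property of closed subspaces that passes to smaller ones and holds for subspaces of
arbitrarily small codimension holds along an increasing sequence. -/
theorem exists_exhaustion (hN : IsTracialGNS N Ω) {P : InvSub N → Prop}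
    (hP : ∀ K L : InvSub N, (∀ ξ ∈ K, ξ ∈ L) → P L → P K)
    (h : ∀ δ > 0, ∃ K, P K ∧ codim Ω K < δ) :
    ∃ Q : ℕ → InvSub N, (∀ n, P (Q n)) ∧ (∀ m n, m ≤ n → ∀ ξ ∈ Q m, ξ ∈ Q n) ∧
      Tendsto (fun n => codim Ω (Q n)) atTop (𝓝 0) := by
  choose K hK hK' using fun n : ℕ => h ((1 / 2 : ℝ) ^ n) (by positivity)
  -- Intersections of tails increase with `k`, and their codimension is at most `∑_{n ≥ k} 2⁻ⁿ = 2 ·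
  -- 2⁻ᵏ`.
  refine ⟨fun k => iInter fun n => K (k + n), fun k => ?_, ?_, ?_⟩
  · exact hP _ _ (fun ξ hξ => mem_iInter.1 hξ 0) (hK k)
  · intro m n hmn ξ hξ
    refine mem_iInter.2 fun i => ?_
    have := mem_iInter.1 hξ (n - m + i)
    rwa [← add_assoc, Nat.add_sub_cancel' hmn] at this
  · refine squeeze_zero (g := fun k : ℕ => (1 / 2 : ℝ) ^ k * 2) (fun _ => codim_nonneg _ _)
      (fun k => ?_) ?_
    · refine codim_iInter_le hN fun m => ?_
      calc ∑ n ∈ Finset.range m, codim Ω (K (k + n))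
          ≤ ∑ n ∈ Finset.range m, (1 / 2 : ℝ) ^ k * (1 / 2 : ℝ) ^ n := by
            refine Finset.sum_le_sum fun n _ => ?_
            rw [← pow_add]
            exact (hK' _).le
        _ = (1 / 2 : ℝ) ^ k * ∑ n ∈ Finset.range m, (1 / 2 : ℝ) ^ n := by rw [Finset.mul_sum]
        _ ≤ (1 / 2 : ℝ) ^ k * 2 := by
            gcongr
            exact sum_geometric_two_le m
    · simpa using (tendsto_pow_atTop_nhds_zero_of_lt_one (r := (1 / 2 : ℝ)) (by norm_num)
        (by norm_num)).mul_const 2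

/-- The closure of the orbit of a vector under the commutant. -/
def cyclicSub (N : VonNeumannAlgebra H) (Ω : H) : InvSub N where
  sub := (N.commutant.toStarSubalgebra.toSubalgebra.toSubmodule.map
    (LinearMap.applyₗ Ω ∘ₗ ContinuousLinearMap.coeLM ℂ : (H →L[ℂ] H) →ₗ[ℂ] H)).topologicalClosure
  isClosed := Submodule.isClosed_topologicalClosure _
  inv u hu ξ hξ := by
    refine map_mem_closure (f := u) u.continuous hξ ?_
    rintro _ ⟨x, hx, rfl⟩
    have hx' : x ∈ N.commutant := hx
    exact ⟨u * x, (mul_mem hu hx' : u * x ∈ N.commutant), rfl⟩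

/-- The projection onto the closure of `N'Ω` lies in `N` and fixes `Ω`, so faithfulness forces it to
be 1. -/
theorem dense_commutant_apply (hN : IsTracialGNS N Ω) :
    Dense {ξ : H | ∃ u ∈ N.commutant, u Ω = ξ} := by
  have h1 : Ω ∈ cyclicSub N Ω := subset_closure ⟨1, one_mem N.commutant, rfl⟩
  have h2 : 1 - (cyclicSub N Ω).proj = 0 := by
    refine hN.faithful _ (sub_mem (one_mem N) (proj_mem _)) ?_
    simp [vtrace, proj_eq_self h1]
  intro ξ
  have h3 : (cyclicSub N Ω).proj ξ = ξ := by
    have := congrArg (fun T : H →L[ℂ] H => T ξ) h2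
    simp only [sub_apply, one_apply_eq_self, zero_apply] at this
    exact (sub_eq_zero.1 this).symm
  rw [← h3]
  exact proj_mem_self (cyclicSub N Ω) ξ

/-- For `u` in the commutant, `‖uΩ - p uΩ‖ ≤ ‖u‖ ‖Ω - pΩ‖`, and the vectors `uΩ` are dense. So
convergence at the single vector `Ω` gives strong convergence. -/
theorem tendsto_proj_apply (hN : IsTracialGNS N Ω) {K : ℕ → InvSub N}
    (hK : Tendsto (fun n => codim Ω (K n)) atTop (𝓝 0)) (ξ : H) :
    Tendsto (fun n => (K n).proj ξ) atTop (𝓝 ξ) := by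
  have h1 : Tendsto (fun n => ‖Ω - (K n).proj Ω‖) atTop (𝓝 0) := by
    have := hK.sqrt
    simpa [codim, Real.sqrt_sq] using this
  rw [Metric.tendsto_atTop]
  intro ε hε
  obtain ⟨_, ⟨u, hu, rfl⟩, hξ⟩ := Metric.mem_closure_iff.1 (dense_commutant_apply hN ξ) (ε / 3)
    (by positivity)
  have h2 : Tendsto (fun n => ‖u‖ * ‖Ω - (K n).proj Ω‖) atTop (𝓝 0) := by
    simpa using h1.const_mul ‖u‖
  obtain ⟨n₀, hn₀⟩ := Metric.tendsto_atTop.1 h2 (ε / 3) (by positivity)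
  refine ⟨n₀, fun n hn => ?_⟩
  have h3 := hn₀ n hn
  rw [Real.dist_eq, sub_zero, abs_of_nonneg (by positivity)] at h3
  have h4 : ‖u Ω - (K n).proj (u Ω)‖ ≤ ‖u‖ * ‖Ω - (K n).proj Ω‖ := by
    rw [commutant_apply (K n).proj_mem hu, ← map_sub]
    exact u.le_opNorm _
  have h5 : ‖(K n).proj (ξ - u Ω)‖ ≤ ‖ξ - u Ω‖ := norm_proj_apply_le _ _
  rw [dist_eq_norm] at hξ ⊢
  have h6 : (K n).proj ξ - ξ = (K n).proj (ξ - u Ω) - (u Ω - (K n).proj (u Ω)) - (ξ - u Ω) := by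
    rw [map_sub]; abel
  rw [h6]
  refine (norm_sub_le _ _).trans_lt ?_
  have := norm_sub_le ((K n).proj (ξ - u Ω)) (u Ω - (K n).proj (u Ω))
  linarith

end InvSub

end

section

/-! ### Invariant subspaces of finite powers of `H` -/

section Amplification

variable {H : Type u} [NormedAddCommGroup H] [InnerProductSpace ℂ H] [CompleteSpace H]
variable {N : VonNeumannAlgebra H} {Ω : H} {ι : Type*} [Fintype ι] [DecidableEq ι]

/-- The operator with coordinatewise action `u`. -/
def diagOp (ι : Type*) [Fintype ι] (u : H →L[ℂ] H) (v : PiLp 2 fun _ : ι => H) :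
    PiLp 2 fun _ : ι => H :=
  WithLp.toLp 2 fun i => u (v i)

/-- The inclusion of a coordinate. -/
def coordIncl (j : ι) : H →L[ℂ] PiLp 2 fun _ : ι => H :=
  ((PiLp.continuousLinearEquiv 2 ℂ fun _ : ι => H).symm : (ι → H) →L[ℂ] PiLp 2 fun _ : ι => H) ∘L
    ContinuousLinearMap.single ℂ (fun _ : ι => H) j

theorem coordIncl_apply (j : ι) (ξ : H) :
    coordIncl j ξ = WithLp.toLp 2 (Pi.single j ξ) := rfl

theorem diagOp_coordIncl (u : H →L[ℂ] H) (j : ι) (ξ : H) :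
    diagOp ι u (coordIncl j ξ) = coordIncl j (u ξ) := by
  ext i
  by_cases h : i = j
  · subst h; simp [diagOp, coordIncl_apply]
  · simp [diagOp, coordIncl_apply, h]

theorem sum_coordIncl (v : PiLp 2 fun _ : ι => H) : ∑ j, coordIncl j (v j) = v := by
  ext i
  simp only [coordIncl_apply, WithLp.ofLp_sum, Finset.sum_apply]
  rw [Finset.sum_eq_single i]
  · simp
  · intro b _ hb
    simp [hb.symm]
  · simp

variable {G : Submodule ℂ (PiLp 2 fun _ : ι => H)} [G.HasOrthogonalProjection]

/-- The commutant is closed under adjoints, so the complement of `G` is invariant as well.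
Consequently the matrix entries of the projection lie in the bicommutant. -/
theorem starProjection_diagOp (hinv : ∀ u ∈ N.commutant, ∀ v ∈ G, diagOp ι u v ∈ G)
    {u : H →L[ℂ] H} (hu : u ∈ N.commutant) (v : PiLp 2 fun _ : ι => H) :
    G.starProjection (diagOp ι u v) = diagOp ι u (G.starProjection v) := by
  refine Submodule.eq_starProjection_of_mem_of_inner_eq_zero
    (hinv u hu _ (G.starProjection_apply_mem v)) fun w hw => ?_
  have h1 := G.starProjection_inner_eq_zero v _ (hinv (star u) (star_mem hu) w hw)
  rw [← h1]
  simp only [PiLp.inner_apply]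
  refine Finset.sum_congr rfl fun i _ => ?_
  simp [diagOp, ContinuousLinearMap.star_eq_adjoint, ContinuousLinearMap.adjoint_inner_right]

/-- The matrix entries of the projection onto a subspace of a power of `H`. -/
def projEntry (G : Submodule ℂ (PiLp 2 fun _ : ι => H)) [G.HasOrthogonalProjection] (i j : ι) :
    H →L[ℂ] H :=
  (PiLp.proj 2 (fun _ : ι => H) i : _ →L[ℂ] H) ∘L G.starProjection ∘L coordIncl j

theorem projEntry_apply (i j : ι) (ξ : H) :
    projEntry G i j ξ = G.starProjection (coordIncl j ξ) i := rfl

theorem starProjection_apply_eq_sum (v : PiLp 2 fun _ : ι => H) (i : ι) :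
    G.starProjection v i = ∑ j, projEntry G i j (v j) := by
  conv_lhs => rw [← sum_coordIncl v, map_sum]
  simp only [WithLp.ofLp_sum, Finset.sum_apply]
  rfl

theorem projEntry_mem (hinv : ∀ u ∈ N.commutant, ∀ v ∈ G, diagOp ι u v ∈ G) (i j : ι) :
    projEntry G i j ∈ N := by
  rw [← N.commutant_commutant, VonNeumannAlgebra.mem_commutant_iff]
  intro u hu
  ext ξ
  have h := congrArg (fun w : PiLp 2 fun _ : ι => H => w i)
    (starProjection_diagOp hinv hu (coordIncl j ξ))
  rw [diagOp_coordIncl] at h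
  exact h.symm

/-- Elements of a closed invariant subspace can be approximated by elements all of whose
coordinates lie in given subspaces of codimension tending to zero. -/
theorem exists_approx (hN : IsTracialGNS N Ω)
    (hinv : ∀ u ∈ N.commutant, ∀ v ∈ G, diagOp ι u v ∈ G) {K : ℕ → InvSub N}
    (hK : Tendsto (fun n => InvSub.codim Ω (K n)) atTop (𝓝 0)) {v : PiLp 2 fun _ : ι => H}
    (hv : v ∈ G) :
    ∃ w : ℕ → PiLp 2 fun _ : ι => H, (∀ n, w n ∈ G) ∧ (∀ n i, w n i ∈ K n) ∧
      Tendsto w atTop (𝓝 v) := by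
  let R : ℕ → InvSub N := fun n =>
    InvSub.iInter fun ij : ι × ι => (K n).comap (projEntry G ij.1 ij.2) (projEntry_mem hinv _ _)
  have hR : Tendsto (fun n => InvSub.codim Ω (R n)) atTop (𝓝 0) := by
    refine squeeze_zero (g := fun n => ∑ _ij : ι × ι, InvSub.codim Ω (K n))
      (fun _ => InvSub.codim_nonneg _ _) (fun n => ?_) ?_
    · exact (InvSub.codim_iInter_fintype_le hN _).trans
        (Finset.sum_le_sum fun _ _ => InvSub.codim_comap_le hN _ _)
    · simpa using tendsto_finsetSum (Finset.univ : Finset (ι × ι)) fun _ _ => hK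
  -- Every matrix entry of the graph-type projection sends `R n` into `K n`. Cutting the coordinates
  -- down to `R n` and projecting back to `G` therefore lands in `G` with coordinates in `K n`.
  let x : ℕ → PiLp 2 fun _ : ι => H := fun n => WithLp.toLp 2 fun j => (R n).proj (v j)
  refine ⟨fun n => G.starProjection (x n), fun n => G.starProjection_apply_mem _, ?_, ?_⟩
  · intro n i
    rw [starProjection_apply_eq_sum]
    refine (K n).sub.sum_mem fun j _ => ?_
    exact InvSub.mem_iInter.1 ((R n).proj_mem_self (v j)) (i, j)
  · have h1 : Tendsto x atTop (𝓝 v) := by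
      have h2 : Tendsto (fun n => fun j => (R n).proj (v j)) atTop (𝓝 fun j => v j) :=
        tendsto_pi_nhds.2 fun j => InvSub.tendsto_proj_apply hN hR (v j)
      exact ((PiLp.continuous_toLp 2 fun _ : ι => H).tendsto _).comp h2
    have h3 := (G.starProjection.continuous.tendsto v).comp h1
    rwa [Submodule.starProjection_eq_self_iff.2 hv] at h3

end Amplification

/-! ### Spectral subspaces -/

section Spectral

variable {H : Type u} [NormedAddCommGroup H] [InnerProductSpace ℂ H] [CompleteSpace H]
variable {N : VonNeumannAlgebra H} {Ω : H}

theorem isClosed_coe (N : VonNeumannAlgebra H) : IsClosed (N.toStarSubalgebra : Set (H →L[ℂ] H)) := by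
  rw [VonNeumannAlgebra.coe_toStarSubalgebra, ← N.centralizer_centralizer]
  exact Set.isClosed_centralizer _

theorem cfc_mem_coe (N : VonNeumannAlgebra H) (f : ℝ → ℝ) {x : H →L[ℂ] H} (hx : x ∈ N) :
    cfc f x ∈ N :=
  have := isClosed_coe N
  cfc_mem (s := N.toStarSubalgebra) (𝕜' := ℂ) f hx

theorem InvSub.codim_le_of_mem {K : InvSub N} {ξ : H} (h : ξ ∈ K) : codim Ω K ≤ ‖Ω - ξ‖ ^ 2 := by
  unfold codim
  gcongr
  rw [proj, Submodule.starProjection_minimal]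
  exact ciInf_le ⟨0, by rintro _ ⟨x, rfl⟩; exact norm_nonneg _⟩ (⟨ξ, h⟩ : K.sub)

/-- A self-adjoint operator with dense range is boundedly invertible on subspaces of arbitrarily
small codimension. -/
theorem exists_bounded_inverse (Ω : H) {h : H →L[ℂ] H} (hh : h ∈ N) (hs : IsSelfAdjoint h)
    (hd : DenseRange h) {δ : ℝ} (hδ : 0 < δ) :
    ∃ K : InvSub N, InvSub.codim Ω K < δ ∧ ∃ g ∈ N, ∀ ξ ∈ K, h (g ξ) = ξ := by
  -- `Ω` is within `√δ / 2` of `h η`, and the threshold `s` is chosen so that truncating `h` at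
  -- height `s` moves `h η` by less than `√δ / 2`.
  obtain ⟨_, ⟨η, rfl⟩, hη⟩ := Metric.mem_closure_iff.1 (hd Ω) (√δ / 2) (by positivity)
  obtain ⟨s, hs0, hsη⟩ : ∃ s : ℝ, 0 < s ∧ s * ‖η‖ < √δ / 2 := by
    refine ⟨√δ / 2 / (‖η‖ + 1), by positivity, ?_⟩
    rw [div_mul_eq_mul_div, div_lt_iff₀ (by positivity)]
    nlinarith [Real.sqrt_pos.2 hδ, norm_nonneg η]
  -- These satisfy `t g(t) = 1 - f(t)`, `f k = 0` and `|t - k(t)| ≤ s`. So `g(h)` inverts `h` on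
  -- `ker f(h)`, and this kernel contains `k(h) η`, a vector close to `Ω`.
  let f : ℝ → ℝ := fun t => max (1 - t ^ 2 / s ^ 2) 0
  let g : ℝ → ℝ := fun t => t / max (t ^ 2) (s ^ 2)
  let k : ℝ → ℝ := fun t => t - min (max t (-s)) s
  have hf : Continuous f := by fun_prop
  have hpos : ∀ t : ℝ, 0 < max (t ^ 2) (s ^ 2) := fun t => lt_max_of_lt_right (by positivity)
  have hg : Continuous g := Continuous.div (by fun_prop) (by fun_prop) fun t => (hpos t).ne'
  have hk : Continuous k := by fun_prop
  have h1 : h * cfc g h = 1 - cfc f h := by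
    rw [← cfc_one ℝ h, ← cfc_sub (1 : ℝ → ℝ) f h]
    conv_lhs => enter [1]; rw [← cfc_id' ℝ h]
    rw [← cfc_mul (fun t => t) g h]
    refine cfc_congr fun t _ => ?_
    simp only [f, g, Pi.one_apply]
    rcases le_total (t ^ 2) (s ^ 2) with h2 | h2
    · rw [max_eq_right h2, max_eq_left]
      · field_simp; ring
      · rw [sub_nonneg, div_le_one (by positivity)]; exact h2
    · rw [max_eq_left h2, max_eq_right]
      · have : t ≠ 0 := by
          rintro rfl
          have : 0 < s ^ 2 := by positivity
          simp at h2; nlinarith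
        field_simp; ring
      · rw [sub_nonpos, le_div_iff₀ (by positivity), one_mul]; exact h2
  have h3 : cfc f h * cfc k h = 0 := by
    rw [← cfc_mul f k h, ← cfc_zero ℝ h]
    refine cfc_congr fun t _ => ?_
    simp only [f, k, Pi.zero_apply]
    rcases le_total (t ^ 2) (s ^ 2) with h2 | h2
    · have := abs_le.1 (abs_le_of_sq_le_sq h2 hs0.le)
      rw [max_eq_left this.1, min_eq_left this.2, sub_self, mul_zero]
    · rw [max_eq_right, zero_mul]
      rw [sub_nonpos, le_div_iff₀ (by positivity), one_mul]; exact h2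
  have h4 : ‖h - cfc k h‖ ≤ s := by
    have : h - cfc k h = cfc (fun t => t - k t) h := by
      rw [cfc_sub (fun t => t) k h, cfc_id' ℝ h]
    rw [this]
    refine norm_cfc_le hs0.le fun t _ => ?_
    simp only [k, sub_sub_cancel, Real.norm_eq_abs, abs_le]
    constructor
    · exact le_min (le_max_right _ _) (by linarith)
    · exact min_le_right _ _
  refine ⟨InvSub.ker (cfc f h) (cfc_mem_coe N f hh), ?_, cfc g h, cfc_mem_coe N g hh, ?_⟩
  · refine (InvSub.codim_le_of_mem (ξ := cfc k h η) ?_).trans_lt ?_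
    · rw [InvSub.mem_ker]
      exact congrArg (fun T : H →L[ℂ] H => T η) h3
    · have h5 : ‖Ω - cfc k h η‖ < √δ := by
        have h6 : Ω - cfc k h η = (Ω - h η) + (h - cfc k h) η := by
          rw [sub_apply]; abel
        rw [h6]
        refine (norm_add_le _ _).trans_lt ?_
        have h7 := (h - cfc k h).le_of_opNorm_le h4 η
        rw [dist_eq_norm] at hη
        linarith
      calc ‖Ω - cfc k h η‖ ^ 2 < √δ ^ 2 := by gcongr
        _ = δ := Real.sq_sqrt hδ.le
  · intro ξ hξ
    have h5 := congrArg (fun T : H →L[ℂ] H => T ξ) h1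
    simpa [InvSub.mem_ker.1 hξ] using h5

end Spectral

end

section

variable {H : Type u} [NormedAddCommGroup H] [InnerProductSpace ℂ H] [CompleteSpace H]
variable {N : VonNeumannAlgebra H} {Ω : H}

/-! ### Essentially dense sets -/

/-- The filter of essentially dense sets: those containing affiliated closed subspaces of
arbitrarily small codimension. -/
def ess (hN : IsTracialGNS N Ω) : Filter H where
  sets := {S | ∀ δ > 0, ∃ K : InvSub N, InvSub.codim Ω K < δ ∧ ∀ ξ ∈ K, ξ ∈ S}
  univ_sets δ hδ := ⟨InvSub.univ N, by rwa [InvSub.codim_univ], fun _ _ => trivial⟩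
  sets_of_superset {S T} hS hST δ hδ := by
    obtain ⟨K, hK, h⟩ := hS δ hδ
    exact ⟨K, hK, fun ξ hξ => hST (h ξ hξ)⟩
  inter_sets {S T} hS hT δ hδ := by
    obtain ⟨K, hK, h⟩ := hS (δ / 2) (by positivity)
    obtain ⟨L, hL, h'⟩ := hT (δ / 2) (by positivity)
    refine ⟨K.inter L, (InvSub.codim_inter_le hN K L).trans_lt (by linarith), ?_⟩
    exact fun ξ hξ => ⟨h ξ hξ.1, h' ξ hξ.2⟩

theorem eventually_ess {hN : IsTracialGNS N Ω} {p : H → Prop} :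
    (∀ᶠ ξ in ess hN, p ξ) ↔
      ∀ δ > 0, ∃ K : InvSub N, InvSub.codim Ω K < δ ∧ ∀ ξ ∈ K, p ξ := Iff.rfl

/-! ### Graphs of affiliated operators -/

/-- Affiliation is only required for unitaries; every element of the commutant is a combination of
four of them. -/
theorem commutant_induction {p : (H →L[ℂ] H) → Prop}
    (hu : ∀ u ∈ N.commutant, u ∈ unitary (H →L[ℂ] H) → p u)
    (hadd : ∀ x y, p x → p y → p (x + y)) (hsmul : ∀ (c : ℂ) x, p x → p (c • x))
    {x : H →L[ℂ] H} (hx : x ∈ N.commutant) : p x := by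
  have := isClosed_coe N.commutant
  obtain ⟨u, c, h, -⟩ := CStarAlgebra.exists_sum_four_unitary
    (⟨x, hx⟩ : N.commutant.toStarSubalgebra)
  have h1 : x = ∑ i, c i • ((u i : N.commutant.toStarSubalgebra) : H →L[ℂ] H) := by
    have := congrArg (fun y : N.commutant.toStarSubalgebra => (y : H →L[ℂ] H)) h
    simpa using this
  have h2 : ∀ i, p (c i • ((u i : N.commutant.toStarSubalgebra) : H →L[ℂ] H)) := by
    intro i
    refine hsmul _ _ (hu _ (u i : N.commutant.toStarSubalgebra).2 ?_)
    have h3 := (u i).2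
    rw [Unitary.mem_iff] at h3 ⊢
    exact ⟨congrArg Subtype.val h3.1, congrArg Subtype.val h3.2⟩
  rw [h1, Fin.sum_univ_four]
  exact hadd _ _ (hadd _ _ (hadd _ _ (h2 0) (h2 1)) (h2 2)) (h2 3)

namespace Affiliated

/-- `a.Rel ξ η` means that `ξ` is in the domain of `a` and `a ξ = η`. -/
def Rel (a : Affiliated N) (ξ η : H) : Prop := (ξ, η) ∈ a.op.graph

theorem Rel.add {a : Affiliated N} {ξ η ξ' η' : H} (h : a.Rel ξ η) (h' : a.Rel ξ' η') :
    a.Rel (ξ + ξ') (η + η') := a.op.graph.add_mem h h'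

theorem Rel.smul {a : Affiliated N} {ξ η : H} (c : ℂ) (h : a.Rel ξ η) :
    a.Rel (c • ξ) (c • η) := a.op.graph.smul_mem c h

theorem rel_zero (a : Affiliated N) : a.Rel 0 0 := a.op.graph.zero_mem

theorem Rel.unique {a : Affiliated N} {ξ η η' : H} (h : a.Rel ξ η) (h' : a.Rel ξ η') : η = η' :=
  a.op.mem_graph_snd_inj h h' rfl

theorem Rel.tendsto {a : Affiliated N} {α : Type*} {l : Filter α} [l.NeBot] {x y : α → H} {ξ η : H}
    (h : ∀ᶠ n in l, a.Rel (x n) (y n)) (hx : Tendsto x l (𝓝 ξ)) (hy : Tendsto y l (𝓝 η)) :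
    a.Rel ξ η :=
  a.closed.mem_of_tendsto (hx.prodMk_nhds hy) h

theorem Rel.commutant {a : Affiliated N} {ξ η : H} (h : a.Rel ξ η) {u : H →L[ℂ] H}
    (hu : u ∈ N.commutant) : a.Rel (u ξ) (u η) :=
  commutant_induction (p := fun u => a.Rel (u ξ) (u η))
    (fun u hu hu' => a.affiliated u hu hu' ξ η h) (fun _ _ h h' => h.add h')
    (fun c _ h => h.smul c) hu

theorem ext_op {a b : Affiliated N} (h : a.op = b.op) : a = b := by
  cases a; cases b; cases h; rfl

theorem ext_rel {a b : Affiliated N} (h : ∀ ξ η, a.Rel ξ η ↔ b.Rel ξ η) : a = b :=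
  ext_op (LinearPMap.eq_of_eq_graph (Submodule.ext fun p => h p.1 p.2))

/-- An operator with values on `K` given by an affiliated operator is in `N`. -/
theorem comp_proj_mem {a : Affiliated N} {K : InvSub N} {T : H →L[ℂ] H}
    (h : ∀ ξ ∈ K, a.Rel ξ (T ξ)) : T * K.proj ∈ N := by
  have hmem : T * K.proj ∈ N.commutant.commutant ↔ T * K.proj ∈ N := by
    rw [N.commutant_commutant]
  rw [← hmem, VonNeumannAlgebra.mem_commutant_iff]
  intro u hu
  ext ξ
  have h1 := (h _ (K.proj_mem_self ξ)).commutant hu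
  have h2 := h _ (K.proj_mem_self (u ξ))
  rw [InvSub.commutant_apply K.proj_mem hu] at h2
  have h3 := h1.unique h2
  change u (T (K.proj ξ)) = T (K.proj (u ξ))
  rw [h3, InvSub.commutant_apply K.proj_mem hu]

/-- The graph as a subspace of `H ⊕ H`. -/
def graph₂ (a : Affiliated N) : Submodule ℂ (PiLp 2 fun _ : Fin 2 => H) where
  carrier := {v | a.Rel (v 0) (v 1)}
  add_mem' h h' := h.add h'
  zero_mem' := a.rel_zero
  smul_mem' c _ h := h.smul c

theorem continuous_coord {ι : Type*} [Fintype ι] (i : ι) :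
    Continuous fun v : PiLp 2 fun _ : ι => H => v i :=
  (PiLp.proj 2 (fun _ : ι => H) i : _ →L[ℂ] H).continuous

theorem isClosed_graph₂ (a : Affiliated N) :
    IsClosed (a.graph₂ : Set (PiLp 2 fun _ : Fin 2 => H)) :=
  a.closed.preimage ((continuous_coord 0).prodMk (continuous_coord 1))

instance (a : Affiliated N) : a.graph₂.HasOrthogonalProjection :=
  have := a.isClosed_graph₂.completeSpace_coe
  inferInstance

theorem graph₂_inv (a : Affiliated N) : ∀ u ∈ N.commutant, ∀ v ∈ a.graph₂,
    diagOp (Fin 2) u v ∈ a.graph₂ := fun _ hu _ hv => Rel.commutant hv hu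

/-- An affiliated operator is bounded on affiliated closed subspaces of arbitrarily small
codimension. -/
theorem exists_bounded (a : Affiliated N) (Ω : H) {δ : ℝ} (hδ : 0 < δ) :
    ∃ K : InvSub N, InvSub.codim Ω K < δ ∧ ∃ T ∈ N, ∀ ξ ∈ K, a.Rel ξ (T ξ) := by
  -- This corner of the graph projection is `(1 + a⋆a)⁻¹`. Its range lies in the domain of `a`, and
  -- `a h` is the bounded lower-left entry, so it suffices to invert `h` on a large subspace.
  let h : H →L[ℂ] H := projEntry a.graph₂ 0 0
  have hin : ∀ ξ η : H, inner ℂ (h ξ) η =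
      inner ℂ (a.graph₂.starProjection (coordIncl 0 ξ)) (coordIncl 0 η) := by
    intro ξ η
    rw [PiLp.inner_apply, Fin.sum_univ_two]
    simp [coordIncl_apply, h, projEntry_apply]
  have hs : IsSelfAdjoint h := by
    rw [ContinuousLinearMap.isSelfAdjoint_iff_isSymmetric]
    intro ξ η
    change inner ℂ (h ξ) η = inner ℂ ξ (h η)
    rw [hin, Submodule.inner_starProjection_left_eq_right, ← inner_conj_symm, ← hin,
      inner_conj_symm]
  have hker : ∀ ξ, h ξ = 0 → ξ = 0 := by
    intro ξ hξ
    have h1 : a.graph₂.starProjection (coordIncl 0 ξ) = 0 := by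
      have h2 := Submodule.re_inner_starProjection_eq_normSq (𝕜 := ℂ) (K := a.graph₂)
        (coordIncl 0 ξ)
      rw [← hin, hξ, inner_zero_left] at h2
      have h3 : ‖a.graph₂.starProjection (coordIncl 0 ξ)‖ ^ 2 = 0 := by
        refine h2.symm.trans ?_
        simp
      simpa using h3
    -- Now `(ξ, 0)` is orthogonal to the graph, hence `ξ` is orthogonal to the dense domain.
    have h2 : ∀ η ∈ a.op.domain, inner ℂ ξ η = 0 := by
      intro η hη
      have hη' : WithLp.toLp 2 ![η, a.op ⟨η, hη⟩] ∈ a.graph₂ := a.op.mem_graph ⟨η, hη⟩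
      have h4 := a.graph₂.starProjection_inner_eq_zero (coordIncl 0 ξ) _ hη'
      rw [h1, sub_zero, PiLp.inner_apply, Fin.sum_univ_two] at h4
      simpa [coordIncl_apply] using h4
    exact a.dense.eq_zero_of_inner_left (𝕜 := ℂ) h2
  have hd : DenseRange h := by
    have h1 : (h.range)ᗮ = ⊥ := by
      rw [ContinuousLinearMap.orthogonal_range, ← ContinuousLinearMap.star_eq_adjoint, hs.star_eq,
        LinearMap.ker_eq_bot']
      exact hker
    have h2 := (Submodule.topologicalClosure_eq_top_iff (K := h.range)).2 h1
    exact (Submodule.dense_iff_topologicalClosure_eq_top.2 h2 :)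
  obtain ⟨K, hK, g, hg, hK'⟩ := exists_bounded_inverse Ω (projEntry_mem a.graph₂_inv 0 0) hs hd hδ
  refine ⟨K, hK, projEntry a.graph₂ 1 0 * g, mul_mem (projEntry_mem a.graph₂_inv 1 0) hg,
    fun ξ hξ => ?_⟩
  have h1 : a.Rel (h (g ξ)) (projEntry a.graph₂ 1 0 (g ξ)) :=
    a.graph₂.starProjection_apply_mem (coordIncl 0 (g ξ))
  rwa [hK' ξ hξ] at h1

theorem eventually_rel (a : Affiliated N) (hN : IsTracialGNS N Ω) :
    ∀ᶠ ξ in ess hN, ∃ η, a.Rel ξ η := fun δ hδ => by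
  obtain ⟨K, hK, T, -, h⟩ := a.exists_bounded Ω hδ
  exact ⟨K, hK, fun ξ hξ => ⟨T ξ, h ξ hξ⟩⟩

theorem exists_exhaustion_of_eventually {hN : IsTracialGNS N Ω} {p : H → Prop}
    (h : ∀ᶠ ξ in ess hN, p ξ) :
    ∃ Q : ℕ → InvSub N, (∀ n, ∀ ξ ∈ Q n, p ξ) ∧ (∀ m n, m ≤ n → ∀ ξ ∈ Q m, ξ ∈ Q n) ∧
      Tendsto (fun n => InvSub.codim Ω (Q n)) atTop (𝓝 0) :=
  InvSub.exists_exhaustion hN (P := fun K => ∀ ξ ∈ K, p ξ)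
    (fun _ _ hKL hL ξ hξ => hL ξ (hKL ξ hξ))
    (fun δ hδ => let ⟨K, hK, hK'⟩ := h δ hδ; ⟨K, hK', hK⟩)

/-- Affiliated operators that agree on an essentially dense set are equal. -/
theorem eq_of_eventually (hN : IsTracialGNS N Ω) {a b : Affiliated N}
    (h : ∀ᶠ ξ in ess hN, ∃ η, a.Rel ξ η ∧ b.Rel ξ η) : a = b := by
  obtain ⟨Q, hQ, -, hQ'⟩ := exists_exhaustion_of_eventually h
  have key : ∀ {a b : Affiliated N}, (∀ n, ∀ ξ ∈ Q n, ∃ η, a.Rel ξ η ∧ b.Rel ξ η) →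
      ∀ ξ η, a.Rel ξ η → b.Rel ξ η := by
    intro a b hQ ξ η hξ
    -- A point of the graph of `a` is a limit of points of that graph lying over some `Q n`. There
    -- `b` takes the same values, and `b` is closed.
    obtain ⟨w, hw, hwQ, hlim⟩ := exists_approx hN a.graph₂_inv hQ'
      (v := WithLp.toLp 2 ![ξ, η]) hξ
    refine Rel.tendsto (l := atTop) (Eventually.of_forall fun n => ?_)
      (((continuous_coord 0).tendsto _).comp hlim) (((continuous_coord 1).tendsto _).comp hlim)
    obtain ⟨ζ, h1, h2⟩ := hQ n _ (hwQ n 0)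
    change b.Rel (w n 0) (w n 1)
    rwa [Rel.unique (hw n) h1]
  exact ext_rel fun ξ η => ⟨key hQ ξ η,
    key (fun n ξ hξ => let ⟨ζ, h1, h2⟩ := hQ n ξ hξ; ⟨ζ, h2, h1⟩) ξ η⟩

end Affiliated

end

section

variable {H : Type u} [NormedAddCommGroup H] [InnerProductSpace ℂ H] [CompleteSpace H]
variable {N : VonNeumannAlgebra H} {Ω : H}

/-! ### Construction of affiliated operators from bounded pieces -/

section Construction

/-- The union of the graphs of the restrictions `T n |_{Q n}`. -/
def pieceGraph (Q : ℕ → InvSub N) (T : ℕ → H →L[ℂ] H) : Set (H × H) :=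
  {p | ∃ n, ∃ ξ ∈ Q n, p = (ξ, T n ξ)}

variable {Q : ℕ → InvSub N} {T : ℕ → H →L[ℂ] H}

/-- `pieceGraph` as a subspace. -/
def pieceSubmodule (hQ : ∀ m n, m ≤ n → ∀ ξ ∈ Q m, ξ ∈ Q n)
    (hT : ∀ m n, m ≤ n → ∀ ξ ∈ Q m, T n ξ = T m ξ) : Submodule ℂ (H × H) where
  carrier := pieceGraph Q T
  add_mem' := by
    rintro _ _ ⟨m, ξ, hξ, rfl⟩ ⟨n, ξ', hξ', rfl⟩
    refine ⟨max m n, ξ + ξ', (Q _).sub.add_mem (hQ m _ (le_max_left _ _) _ hξ)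
      (hQ n _ (le_max_right _ _) _ hξ'), ?_⟩
    rw [Prod.mk_add_mk, map_add, hT m _ (le_max_left _ _) _ hξ, hT n _ (le_max_right _ _) _ hξ']
  zero_mem' := ⟨0, 0, (Q 0).sub.zero_mem, by rw [map_zero]; rfl⟩
  smul_mem' := by
    rintro c _ ⟨m, ξ, hξ, rfl⟩
    exact ⟨m, c • ξ, (Q _).sub.smul_mem c hξ, by simp⟩

/-- This is closability in weak form. With `S n = T n p n`, where `p n` projects onto `Q n`, a
vector `w` killed by all `(S (k+m) (1 - p k))⋆` sees only the bounded piece `T k p k`, and that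
identity survives closure. The kernels decrease in `m`. Each has the codimension of `ker (S (k+m) (1
- p k))`, which contains `Q k`, so the bound is uniform and passes to the intersection. -/
theorem inner_eq_of_mem_closure_pieceGraph (hN : IsTracialGNS N Ω)
    (hQ : ∀ m n, m ≤ n → ∀ ξ ∈ Q m, ξ ∈ Q n)
    (hT : ∀ m n, m ≤ n → ∀ ξ ∈ Q m, T n ξ = T m ξ) (hmem : ∀ n, T n * (Q n).proj ∈ N) (k : ℕ) :
    ∃ F : InvSub N, InvSub.codim Ω F ≤ InvSub.codim Ω (Q k) ∧
      ∀ p ∈ closure (pieceGraph Q T), ∀ w ∈ F, inner ℂ w p.2 = inner ℂ w (T k ((Q k).proj p.1)) := by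
  let S : ℕ → H →L[ℂ] H := fun n => T n * (Q n).proj
  have hSS : ∀ m n, m ≤ n → S m = S n * (Q m).proj := by
    intro m n hmn
    ext ξ
    have h1 := (Q m).proj_mem_self ξ
    change T m ((Q m).proj ξ) = T n ((Q n).proj ((Q m).proj ξ))
    rw [InvSub.proj_eq_self (hQ m n hmn _ h1), hT m n hmn _ h1]
  have hPP : ∀ m n, m ≤ n → (Q n).proj * (Q m).proj = (Q m).proj := by
    intro m n hmn
    ext ξ
    exact InvSub.proj_eq_self (hQ m n hmn _ ((Q m).proj_mem_self ξ))
  have hPP' : ∀ m n, m ≤ n → (Q m).proj * (Q n).proj = (Q m).proj := by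
    intro m n hmn
    have := congrArg star (hPP m n hmn)
    rwa [star_mul, (Q m).proj_isStarProjection.isSelfAdjoint.star_eq,
      (Q n).proj_isStarProjection.isSelfAdjoint.star_eq] at this
  have hy : ∀ m, S (k + m) * (1 - (Q k).proj) ∈ N := fun m =>
    mul_mem (hmem _) (sub_mem (one_mem N) (Q k).proj_mem)
  let F : ℕ → InvSub N := fun m => InvSub.ker (star (S (k + m) * (1 - (Q k).proj))) (star_mem (hy m))
  refine ⟨InvSub.iInter F, InvSub.codim_iInter_le_of_antitone ?_ ?_, ?_⟩
  · intro m ξ hξ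
    have h1 : S (k + m) * (1 - (Q k).proj) =
        (S (k + (m + 1)) * (1 - (Q k).proj)) * (Q (k + m)).proj := by
      rw [hSS (k + m) (k + (m + 1)) (by omega)]
      simp only [mul_sub, sub_mul, mul_one, mul_assoc, hPP k (k + m) (by omega),
        hPP' k (k + m) (by omega)]
    refine InvSub.mem_ker.2 ?_
    rw [h1, star_mul]
    change star (Q (k + m)).proj (star (S (k + (m + 1)) * (1 - (Q k).proj)) ξ) = 0
    rw [InvSub.mem_ker.1 hξ, map_zero]
  · intro m
    rw [InvSub.codim_ker_star hN (hy m)]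
    refine InvSub.codim_mono fun ξ hξ => ?_
    rw [InvSub.mem_ker]
    simp [InvSub.proj_eq_self hξ]
  · intro p hp w hw
    have hc : IsClosed {p : H × H | inner ℂ w p.2 = inner ℂ w (T k ((Q k).proj p.1))} :=
      isClosed_eq (by fun_prop) (by fun_prop)
    refine closure_minimal (s := pieceGraph Q T) ?_ hc hp
    rintro _ ⟨m, ξ, hξ, rfl⟩
    simp only [Set.mem_ofPred_eq]
    have h1 : T m ξ = S (k + m) ξ := by
      have h2 := hQ m (k + m) (by omega) ξ hξ
      change _ = T (k + m) ((Q (k + m)).proj ξ)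
      rw [InvSub.proj_eq_self h2, hT m (k + m) (by omega) ξ hξ]
    have h2 : S (k + m) ξ = S (k + m) ((Q k).proj ξ) + (S (k + m) * (1 - (Q k).proj)) ξ := by
      simp
    have h3 : T k ((Q k).proj ξ) = S (k + m) ((Q k).proj ξ) :=
      congrArg (fun T : H →L[ℂ] H => T ξ) (hSS k (k + m) (by omega))
    have h4 := InvSub.mem_ker.1 (InvSub.mem_iInter.1 hw m)
    rw [h1, h2, h3, inner_add_right, add_eq_left, ← ContinuousLinearMap.adjoint_inner_left,
      ← ContinuousLinearMap.star_eq_adjoint, h4, inner_zero_left]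

/-- Compatible bounded pieces on an increasing sequence of affiliated closed subspaces with
codimension tending to zero define an affiliated operator. -/
theorem exists_affiliated (hN : IsTracialGNS N Ω)
    (hQ : ∀ m n, m ≤ n → ∀ ξ ∈ Q m, ξ ∈ Q n)
    (hlim : Tendsto (fun n => InvSub.codim Ω (Q n)) atTop (𝓝 0))
    (hT : ∀ m n, m ≤ n → ∀ ξ ∈ Q m, T n ξ = T m ξ) (hmem : ∀ n, T n * (Q n).proj ∈ N) :
    ∃ a : Affiliated N, (a.op.graph : Set (H × H)) = closure (pieceGraph Q T) := by
  let G := (pieceSubmodule hQ hT).topologicalClosure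
  have hG : (G : Set (H × H)) = closure (pieceGraph Q T) := Submodule.topologicalClosure_coe _
  -- If `(0, η)` lies in the closure, then `η` is orthogonal to every `F k`; the projections onto `F
  -- k` tend strongly to 1.
  have hfun : ∀ p ∈ G, p.1 = 0 → p.2 = 0 := by
    intro p hp h0
    choose F hF hFp using inner_eq_of_mem_closure_pieceGraph hN hQ hT hmem
    have hFlim : Tendsto (fun n => InvSub.codim Ω (F n)) atTop (𝓝 0) :=
      squeeze_zero (fun _ => InvSub.codim_nonneg _ _) hF hlim
    have h1 := (InvSub.tendsto_proj_apply hN hFlim p.2).inner (𝕜 := ℂ)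
      (tendsto_const_nhds (x := p.2))
    have h2 : ∀ k, inner ℂ ((F k).proj p.2) p.2 = 0 := by
      intro k
      rw [hFp k p (hG ▸ hp) _ ((F k).proj_mem_self _), h0]
      simp
    simp_rw [h2] at h1
    exact inner_self_eq_zero.1 (tendsto_nhds_unique h1 tendsto_const_nhds)
  have hgr : G.toLinearPMap.graph = G := G.toLinearPMap_graph_eq hfun
  have hin : ∀ {n ξ}, ξ ∈ Q n → (ξ, T n ξ) ∈ G := fun {n ξ} hξ =>
    subset_closure ⟨n, ξ, hξ, rfl⟩
  refine ⟨⟨G.toLinearPMap, ?_, ?_, ?_⟩, by rw [hgr, hG]⟩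
  · intro ξ
    refine mem_closure_of_tendsto (InvSub.tendsto_proj_apply hN hlim ξ) (Eventually.of_forall ?_)
    intro n
    exact LinearPMap.mem_domain_iff.2 ⟨_, hgr ▸ hin ((Q n).proj_mem_self ξ)⟩
  · rw [LinearPMap.IsClosed, hgr, hG]
    exact isClosed_closure
  · intro u hu _ ξ η h
    rw [hgr, ← SetLike.mem_coe, hG] at h ⊢
    refine map_mem_closure (f := fun p : H × H => (u p.1, u p.2)) (by fun_prop) h ?_
    rintro _ ⟨n, ξ, hξ, rfl⟩
    have h1 := (Q n).inv u hu ξ hξ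
    refine ⟨n, u ξ, h1, Prod.ext rfl ?_⟩
    have h2 := InvSub.commutant_apply (hmem n) hu ξ
    change T n ((Q n).proj (u ξ)) = u (T n ((Q n).proj ξ)) at h2
    rw [InvSub.proj_eq_self h1, InvSub.proj_eq_self hξ] at h2
    exact h2.symm

end Construction

/-! ### Strong sums, differences and products -/

namespace Affiliated

/-- The joint graph of two affiliated operators. -/
def jointGraph (a b : Affiliated N) : Submodule ℂ (PiLp 2 fun _ : Fin 3 => H) where
  carrier := {v | a.Rel (v 0) (v 1) ∧ b.Rel (v 0) (v 2)}
  add_mem' h h' := ⟨h.1.add h'.1, h.2.add h'.2⟩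
  zero_mem' := ⟨a.rel_zero, b.rel_zero⟩
  smul_mem' c _ h := ⟨h.1.smul c, h.2.smul c⟩

theorem isClosed_jointGraph (a b : Affiliated N) :
    IsClosed (a.jointGraph b : Set (PiLp 2 fun _ : Fin 3 => H)) :=
  (a.closed.preimage ((continuous_coord 0).prodMk (continuous_coord 1))).inter
    (b.closed.preimage ((continuous_coord 0).prodMk (continuous_coord 2)))

instance (a b : Affiliated N) : (a.jointGraph b).HasOrthogonalProjection :=
  have := (a.isClosed_jointGraph b).completeSpace_coe
  inferInstance

/-- The closure of a combination `S a + T b` of affiliated operators, where `S` and `T` are in `N`,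
is affiliated. -/
theorem exists_closure_eq (hN : IsTracialGNS N Ω) (a b : Affiliated N) {S T : H →L[ℂ] H}
    (hS : S ∈ N) (hT : T ∈ N) {f : H →ₗ.[ℂ] H}
    (hf : ∀ ξ η, (ξ, η) ∈ f.graph ↔ ∃ ζ ζ', a.Rel ξ ζ ∧ b.Rel ξ ζ' ∧ η = S ζ + T ζ') :
    ∃ c : Affiliated N, f.closure = c.op ∧
      ∀ ξ ζ ζ', a.Rel ξ ζ → b.Rel ξ ζ' → c.Rel ξ (S ζ + T ζ') := by
  obtain ⟨Q, hP, hQ, hlim⟩ := InvSub.exists_exhaustion hN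
    (P := fun K => ∃ A B : H →L[ℂ] H, ∀ ξ ∈ K, a.Rel ξ (A ξ) ∧ b.Rel ξ (B ξ))
    (fun K L hKL ⟨A, B, h⟩ => ⟨A, B, fun ξ hξ => h ξ (hKL ξ hξ)⟩) (by
      intro δ hδ
      obtain ⟨K, hK, A, -, hA⟩ := a.exists_bounded Ω (half_pos hδ)
      obtain ⟨L, hL, B, -, hB⟩ := b.exists_bounded Ω (half_pos hδ)
      exact ⟨K.inter L, ⟨A, B, fun ξ hξ => ⟨hA ξ hξ.1, hB ξ hξ.2⟩⟩,
        (InvSub.codim_inter_le hN K L).trans_lt (by linarith)⟩)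
  choose A B hAB using hP
  let R : ℕ → H →L[ℂ] H := fun n => S * A n + T * B n
  have hR : ∀ n, ∀ ξ ∈ Q n, (ξ, R n ξ) ∈ f.graph := fun n ξ hξ =>
    (hf _ _).2 ⟨_, _, (hAB n ξ hξ).1, (hAB n ξ hξ).2, rfl⟩
  obtain ⟨c, hc⟩ := exists_affiliated hN hQ hlim (T := R)
    (fun m n hmn ξ hξ => f.mem_graph_snd_inj (hR n ξ (hQ m n hmn ξ hξ)) (hR m ξ hξ) rfl)
    (fun n => by
      have h1 : R n * (Q n).proj = S * (A n * (Q n).proj) + T * (B n * (Q n).proj) := by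
        simp only [R, add_mul, mul_assoc]
      rw [h1]
      exact add_mem (mul_mem hS (comp_proj_mem fun ξ hξ => (hAB n ξ hξ).1))
        (mul_mem hT (comp_proj_mem fun ξ hξ => (hAB n ξ hξ).2)))
  -- Approximating the triple `(ξ, aξ, bξ)` inside the joint graph keeps both values under control
  -- at once. Over `Q n` the combination is the bounded piece `R n`, so the pieces are dense in the
  -- graph of `f`.
  have hle : (f.graph : Set (H × H)) ⊆ closure (pieceGraph Q R) := by
    rintro ⟨ξ, η⟩ h
    obtain ⟨ζ, ζ', h1, h2, rfl⟩ := (hf ξ η).1 h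
    obtain ⟨w, hw, hwQ, hwlim⟩ := exists_approx hN (G := a.jointGraph b)
      (fun u hu v hv => ⟨hv.1.commutant hu, hv.2.commutant hu⟩) hlim
      (v := WithLp.toLp 2 ![ξ, ζ, ζ']) ⟨h1, h2⟩
    have hl : ∀ i : Fin 3, Tendsto (fun n => w n i) atTop (𝓝 (![ξ, ζ, ζ'] i)) := fun i =>
      ((continuous_coord i).tendsto _).comp hwlim
    refine mem_closure_of_tendsto ((hl 0).prodMk_nhds
      (((S.continuous.tendsto _).comp (hl 1)).add ((T.continuous.tendsto _).comp (hl 2))))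
      (Eventually.of_forall fun n => ⟨n, w n 0, hwQ n 0, Prod.ext rfl ?_⟩)
    have h3 := hAB n _ (hwQ n 0)
    simp only [Function.comp, Rel.unique (hw n).1 h3.1, Rel.unique (hw n).2 h3.2]
    rfl
  have heq : f.graph.topologicalClosure = c.op.graph := by
    refine SetLike.coe_injective ?_
    rw [Submodule.topologicalClosure_coe, hc]
    refine subset_antisymm (closure_minimal hle isClosed_closure) (closure_mono ?_)
    rintro _ ⟨n, ξ, hξ, rfl⟩
    exact hR n ξ hξ
  have hcl : f.IsClosable := ⟨c.op, heq⟩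
  refine ⟨c, LinearPMap.eq_of_eq_graph (hcl.graph_closure_eq_closure_graph.symm.trans heq), ?_⟩
  intro ξ ζ ζ' h1 h2
  have h3 : (ξ, S ζ + T ζ') ∈ f.graph := (hf _ _).2 ⟨ζ, ζ', h1, h2, rfl⟩
  rw [Rel, ← heq]
  exact subset_closure h3

theorem exists_ssum (hN : IsTracialGNS N Ω) (a b : Affiliated N) :
    ∃ c : Affiliated N, c.op = ssum a.op b.op ∧
      ∀ ξ ζ ζ', a.Rel ξ ζ → b.Rel ξ ζ' → c.Rel ξ (ζ + ζ') := by
  obtain ⟨c, h, h'⟩ := exists_closure_eq hN a b (one_mem N) (one_mem N) (f := a.op + b.op) (by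
    intro ξ η
    simp only [Rel, LinearPMap.mem_graph_iff]
    constructor
    · rintro ⟨x, rfl, rfl⟩
      exact ⟨_, _, ⟨⟨x, x.2.1⟩, rfl, rfl⟩, ⟨⟨x, x.2.2⟩, rfl, rfl⟩, rfl⟩
    · rintro ⟨_, _, ⟨⟨ξ, hx⟩, rfl, rfl⟩, ⟨⟨ξ', hx'⟩, rfl, rfl⟩, rfl⟩
      refine ⟨⟨ξ', hx, hx'⟩, rfl, ?_⟩
      rfl)
  exact ⟨c, h.symm, h'⟩

theorem exists_sdiff (hN : IsTracialGNS N Ω) (a b : Affiliated N) :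
    ∃ c : Affiliated N, c.op = sdiff a.op b.op ∧
      ∀ ξ ζ ζ', a.Rel ξ ζ → b.Rel ξ ζ' → c.Rel ξ (ζ - ζ') := by
  obtain ⟨c, h, h'⟩ := exists_closure_eq hN a b (one_mem N) (neg_mem (one_mem N))
      (f := a.op - b.op) (by
    intro ξ η
    simp only [Rel, LinearPMap.mem_graph_iff]
    constructor
    · rintro ⟨x, rfl, rfl⟩
      exact ⟨_, _, ⟨⟨x, x.2.1⟩, rfl, rfl⟩, ⟨⟨x, x.2.2⟩, rfl, rfl⟩, sub_eq_add_neg _ _⟩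
    · rintro ⟨_, _, ⟨⟨ξ, hx⟩, rfl, rfl⟩, ⟨⟨ξ', hx'⟩, rfl, rfl⟩, rfl⟩
      refine ⟨⟨ξ', hx, hx'⟩, rfl, ?_⟩
      exact sub_eq_add_neg _ _)
  exact ⟨c, h.symm, fun ξ ζ ζ' h1 h2 => by simpa [sub_eq_add_neg] using h' ξ ζ ζ' h1 h2⟩

theorem exists_smulL (hN : IsTracialGNS N Ω) {T : H →L[ℂ] H} (hT : T ∈ N) (a : Affiliated N) :
    ∃ c : Affiliated N, c.op = smulL T a.op ∧ ∀ ξ ζ, a.Rel ξ ζ → c.Rel ξ (T ζ) := by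
  obtain ⟨c, h, h'⟩ := exists_closure_eq hN a a hT (zero_mem N)
      (f := (T : H →ₗ[ℂ] H).compPMap a.op) (by
    intro ξ η
    simp only [Rel, LinearPMap.mem_graph_iff]
    constructor
    · rintro ⟨x, rfl, rfl⟩
      exact ⟨_, _, ⟨x, rfl, rfl⟩, ⟨x, rfl, rfl⟩, by simp⟩
    · rintro ⟨_, _, ⟨x, rfl, rfl⟩, -, rfl⟩
      exact ⟨x, rfl, by simp; rfl⟩)
  exact ⟨c, h.symm, fun ξ ζ h1 => by simpa using h' ξ ζ ζ h1 h1⟩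

end Affiliated

end

section

variable {H : Type u} [NormedAddCommGroup H] [InnerProductSpace ℂ H] [CompleteSpace H]
variable {N : VonNeumannAlgebra H} {Ω : H}

/-! ### The module of affiliated operators -/

/-- The affiliated operators, with the algebraic structure given by the strong operations. -/
def UAff (_hN : IsTracialGNS N Ω) : Type u := Affiliated N

namespace UAff

variable {hN : IsTracialGNS N Ω}

/-- The graph relation of an affiliated operator. -/
def Rel (a : UAff hN) (ξ η : H) : Prop := Affiliated.Rel a ξ η

/-- The underlying partially defined operator. -/
def op (a : UAff hN) : H →ₗ.[ℂ] H := Affiliated.op a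

theorem ext_op {a b : UAff hN} (h : a.op = b.op) : a = b := Affiliated.ext_op h

theorem eventually_rel (a : UAff hN) : ∀ᶠ ξ in ess hN, ∃ η, a.Rel ξ η :=
  Affiliated.eventually_rel a hN

theorem eq_of_eventually {a b : UAff hN} (h : ∀ᶠ ξ in ess hN, ∃ η, a.Rel ξ η ∧ b.Rel ξ η) :
    a = b := Affiliated.eq_of_eventually hN h

/-- An element of `N` as an affiliated operator. -/
def of (hN : IsTracialGNS N Ω) (x : N.toStarSubalgebra) : UAff hN := ofMem N x x.2

theorem rel_of (x : N.toStarSubalgebra) (ξ : H) : (of hN x).Rel ξ ((x : H →L[ℂ] H) ξ) := by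
  simp [Rel, Affiliated.Rel, of, ofMem]

instance : Add (UAff hN) := ⟨fun a b => (Affiliated.exists_ssum hN a b).choose⟩
instance : Sub (UAff hN) := ⟨fun a b => (Affiliated.exists_sdiff hN a b).choose⟩
instance : SMul N.toStarSubalgebra (UAff hN) :=
  ⟨fun T a => (Affiliated.exists_smulL hN T.2 a).choose⟩
instance : Zero (UAff hN) := ⟨of hN 0⟩
instance : Neg (UAff hN) := ⟨fun a => (-1 : N.toStarSubalgebra) • a⟩

theorem add_op (a b : UAff hN) : (a + b).op = ssum a.op b.op :=
  (Affiliated.exists_ssum hN a b).choose_spec.1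

theorem sub_op (a b : UAff hN) : (a - b).op = sdiff a.op b.op :=
  (Affiliated.exists_sdiff hN a b).choose_spec.1

theorem smul_op (T : N.toStarSubalgebra) (a : UAff hN) : (T • a).op = smulL T a.op :=
  (Affiliated.exists_smulL hN T.2 a).choose_spec.1

theorem Rel.add {a b : UAff hN} {ξ ζ ζ' : H} (h : a.Rel ξ ζ) (h' : b.Rel ξ ζ') :
    (a + b).Rel ξ (ζ + ζ') :=
  (Affiliated.exists_ssum hN a b).choose_spec.2 ξ ζ ζ' h h'

theorem Rel.sub {a b : UAff hN} {ξ ζ ζ' : H} (h : a.Rel ξ ζ) (h' : b.Rel ξ ζ') :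
    (a - b).Rel ξ (ζ - ζ') :=
  (Affiliated.exists_sdiff hN a b).choose_spec.2 ξ ζ ζ' h h'

theorem Rel.smul {a : UAff hN} {ξ ζ : H} (T : N.toStarSubalgebra) (h : a.Rel ξ ζ) :
    (T • a).Rel ξ ((T : H →L[ℂ] H) ζ) :=
  (Affiliated.exists_smulL hN T.2 a).choose_spec.2 ξ ζ h

theorem rel_zero (ξ : H) : (0 : UAff hN).Rel ξ 0 := rel_of 0 ξ

theorem Rel.neg {a : UAff hN} {ξ ζ : H} (h : a.Rel ξ ζ) : (-a).Rel ξ (-ζ) := by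
  simpa using! h.smul (-1 : N.toStarSubalgebra)

theorem Rel.unique {a : UAff hN} {ξ η η' : H} (h : a.Rel ξ η) (h' : a.Rel ξ η') : η = η' :=
  Affiliated.Rel.unique h h'

/-- Each axiom holds pointwise wherever all operators involved are defined. This is an essentially
dense set, which determines the affiliated operators. -/
instance : AddCommGroup (UAff hN) where
  add_assoc a b c := by
    refine eq_of_eventually ?_
    filter_upwards [a.eventually_rel, b.eventually_rel, c.eventually_rel] with
      ξ ⟨α, ha⟩ ⟨β, hb⟩ ⟨γ, hc⟩
    exact ⟨_, (ha.add hb).add hc, add_assoc α β γ ▸ ha.add (hb.add hc)⟩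
  zero_add a := by
    refine eq_of_eventually ?_
    filter_upwards [a.eventually_rel] with ξ ⟨α, ha⟩
    exact ⟨_, (rel_zero ξ).add ha, (zero_add α).symm ▸ ha⟩
  add_zero a := by
    refine eq_of_eventually ?_
    filter_upwards [a.eventually_rel] with ξ ⟨α, ha⟩
    exact ⟨_, ha.add (rel_zero ξ), (add_zero α).symm ▸ ha⟩
  add_comm a b := by
    refine eq_of_eventually ?_
    filter_upwards [a.eventually_rel, b.eventually_rel] with ξ ⟨α, ha⟩ ⟨β, hb⟩
    exact ⟨_, ha.add hb, add_comm β α ▸ hb.add ha⟩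
  neg_add_cancel a := by
    refine eq_of_eventually ?_
    filter_upwards [a.eventually_rel] with ξ ⟨α, ha⟩
    exact ⟨_, ha.neg.add ha, (neg_add_cancel α).symm ▸ rel_zero ξ⟩
  sub_eq_add_neg a b := by
    refine eq_of_eventually ?_
    filter_upwards [a.eventually_rel, b.eventually_rel] with ξ ⟨α, ha⟩ ⟨β, hb⟩
    exact ⟨_, ha.sub hb, (sub_eq_add_neg α β).symm ▸ ha.add hb.neg⟩
  nsmul := nsmulRec
  zsmul := zsmulRec

instance : Module N.toStarSubalgebra (UAff hN) where
  one_smul a := by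
    refine eq_of_eventually ?_
    filter_upwards [a.eventually_rel] with ξ ⟨α, ha⟩
    exact ⟨_, ha.smul 1, ha⟩
  mul_smul S T a := by
    refine eq_of_eventually ?_
    filter_upwards [a.eventually_rel] with ξ ⟨α, ha⟩
    exact ⟨_, ha.smul (S * T), (ha.smul T).smul S⟩
  smul_zero S := by
    refine eq_of_eventually ?_
    filter_upwards with ξ
    exact ⟨_, (rel_zero ξ).smul S, (map_zero (S : H →L[ℂ] H)).symm ▸ rel_zero ξ⟩
  smul_add S a b := by
    refine eq_of_eventually ?_
    filter_upwards [a.eventually_rel, b.eventually_rel] with ξ ⟨α, ha⟩ ⟨β, hb⟩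
    exact ⟨_, (ha.add hb).smul S, (map_add (S : H →L[ℂ] H) α β).symm ▸ (ha.smul S).add (hb.smul S)⟩
  add_smul S T a := by
    refine eq_of_eventually ?_
    filter_upwards [a.eventually_rel] with ξ ⟨α, ha⟩
    exact ⟨_, ha.smul (S + T), (ha.smul S).add (ha.smul T)⟩
  zero_smul a := by
    refine eq_of_eventually ?_
    filter_upwards [a.eventually_rel] with ξ ⟨α, ha⟩
    exact ⟨_, ha.smul 0, rel_zero ξ⟩

theorem algebraMap_smul_op (c : ℂ) (a : UAff hN) :
    (algebraMap ℂ N.toStarSubalgebra c • a).op = ssmul c a.op := by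
  rw [smul_op, smulL, ssmul]
  congr 1

theorem of_add (x y : N.toStarSubalgebra) : of hN (x + y) = of hN x + of hN y :=
  eq_of_eventually (Eventually.of_forall fun ξ => ⟨_, rel_of (x + y) ξ, (rel_of x ξ).add (rel_of y ξ)⟩)

theorem of_sub (x y : N.toStarSubalgebra) : of hN (x - y) = of hN x - of hN y :=
  eq_of_eventually (Eventually.of_forall fun ξ => ⟨_, rel_of (x - y) ξ, (rel_of x ξ).sub (rel_of y ξ)⟩)

/-! ### The neighbourhoods of zero of the measure topology -/

/-- `a` is bounded by less than `ε` on an affiliated closed subspace of codimension less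
than `δ`. -/
def ball (hN : IsTracialGNS N Ω) (ε δ : ℝ) : Set (UAff hN) :=
  {a | ∃ K : InvSub N, InvSub.codim Ω K < δ ∧ ∃ T : H →L[ℂ] H, ‖T‖ < ε ∧ ∀ ξ ∈ K, a.Rel ξ (T ξ)}

theorem mem_measureNhd_iff {a : UAff hN} {ε δ : ℝ} :
    a.op ∈ measureNhd N Ω ε δ ↔ a ∈ ball hN ε δ := by
  constructor
  · rintro ⟨p, hp, hp', ⟨T, hT, hT'⟩, h⟩
    refine ⟨InvSub.ofProj p hp, ?_, T, hT, fun ξ hξ => ?_⟩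
    · rwa [← InvSub.vtrace_one_sub_proj, InvSub.proj_ofProj hp hp']
    · have := hT' ξ
      rwa [InvSub.mem_ofProj.1 hξ] at this
  · rintro ⟨K, hK, T, hT, h⟩
    refine ⟨K.proj, K.proj_mem, K.proj_isStarProjection, ⟨T * K.proj, ?_, fun ξ => ?_⟩, ?_⟩
    · exact (K.norm_mul_proj_le T).trans_lt hT
    · exact h _ (K.proj_mem_self ξ)
    · rwa [InvSub.vtrace_one_sub_proj]

theorem ball_mono {ε ε' δ δ' : ℝ} (hε : ε ≤ ε') (hδ : δ ≤ δ') : ball hN ε δ ⊆ ball hN ε' δ' :=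
  fun _ ⟨K, hK, T, hT, h⟩ => ⟨K, hK.trans_le hδ, T, hT.trans_le hε, h⟩

theorem of_mem_ball {x : N.toStarSubalgebra} {ε δ : ℝ} (hδ : 0 < δ) (hx : ‖(x : H →L[ℂ] H)‖ < ε) :
    of hN x ∈ ball hN ε δ :=
  ⟨InvSub.univ N, by rwa [InvSub.codim_univ], x, hx, fun ξ _ => rel_of x ξ⟩

theorem zero_mem_ball {ε δ : ℝ} (hε : 0 < ε) (hδ : 0 < δ) : (0 : UAff hN) ∈ ball hN ε δ :=
  of_mem_ball hδ (by simpa using hε)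

theorem add_mem_ball {a b : UAff hN} {ε ε' δ δ' : ℝ} (ha : a ∈ ball hN ε δ)
    (hb : b ∈ ball hN ε' δ') : a + b ∈ ball hN (ε + ε') (δ + δ') := by
  obtain ⟨K, hK, T, hT, h⟩ := ha
  obtain ⟨L, hL, S, hS, h'⟩ := hb
  refine ⟨K.inter L, (InvSub.codim_inter_le hN K L).trans_lt (add_lt_add hK hL), T + S,
    (norm_add_le _ _).trans_lt (add_lt_add hT hS), fun ξ hξ => (h ξ hξ.1).add (h' ξ hξ.2)⟩

theorem neg_mem_ball {a : UAff hN} {ε δ : ℝ} (ha : a ∈ ball hN ε δ) : -a ∈ ball hN ε δ := by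
  obtain ⟨K, hK, T, hT, h⟩ := ha
  exact ⟨K, hK, -T, by rwa [norm_neg], fun ξ hξ => (h ξ hξ).neg⟩

theorem sub_mem_ball {a b : UAff hN} {ε ε' δ δ' : ℝ} (ha : a ∈ ball hN ε δ)
    (hb : b ∈ ball hN ε' δ') : a - b ∈ ball hN (ε + ε') (δ + δ') := by
  rw [sub_eq_add_neg]
  exact add_mem_ball ha (neg_mem_ball hb)

theorem smul_mem_ball {a : UAff hN} {ε δ C : ℝ} {S : N.toStarSubalgebra} (hC : 0 < C)
    (hS : ‖(S : H →L[ℂ] H)‖ ≤ C) (ha : a ∈ ball hN ε δ) : S • a ∈ ball hN (C * ε) δ := by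
  obtain ⟨K, hK, T, hT, h⟩ := ha
  refine ⟨K, hK, S * T, ?_, fun ξ hξ => (h ξ hξ).smul S⟩
  refine (norm_mul_le _ _).trans_lt ?_
  exact mul_lt_mul' hS hT (norm_nonneg _) hC

theorem exists_mem_ball (a : UAff hN) {δ : ℝ} (hδ : 0 < δ) : ∃ C > 0, a ∈ ball hN C δ := by
  obtain ⟨K, hK, T, -, h⟩ := Affiliated.exists_bounded a Ω hδ
  exact ⟨‖T‖ + 1, by positivity, K, hK, T, by linarith, h⟩

/-- The estimate for the product of an element of `N` that is small in measure with an affiliated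
operator. -/
theorem smul_mem_ball_of_mem {a : UAff hN} {ε δ ε' δ' : ℝ} {S : N.toStarSubalgebra}
    (hS : of hN S ∈ ball hN ε' δ') (ha : a ∈ ball hN ε δ) :
    S • a ∈ ball hN (ε' * ε) (δ' + δ) := by
  obtain ⟨K, hK, T, hT, h⟩ := ha
  obtain ⟨L, hL, R, hR, h'⟩ := hS
  -- Since `a` restricted to `K` is given by an element of `N`, the vectors that it sends into `L`
  -- contain an affiliated subspace of controlled codimension.
  have hT' : T * K.proj ∈ N := Affiliated.comp_proj_mem h
  refine ⟨(L.comap _ hT').inter K, ?_, R * T, ?_, fun ξ hξ => ?_⟩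
  · refine (InvSub.codim_inter_le hN _ _).trans_lt (add_lt_add_of_le_of_lt ?_ hK) |>.trans_le le_rfl
    exact (InvSub.codim_comap_le hN L hT').trans hL.le
  · refine (norm_mul_le _ _).trans_lt ?_
    exact mul_lt_mul'' hR hT (norm_nonneg _) (norm_nonneg _)
  · have h1 : (T * K.proj) ξ ∈ L := hξ.1
    have h2 : (T * K.proj) ξ = T ξ := congrArg T (InvSub.proj_eq_self hξ.2)
    rw [h2] at h1
    have h3 := (rel_of S (T ξ)).unique (h' _ h1)
    have h4 := (h ξ hξ.2).smul S
    rw [h3] at h4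
    exact h4

theorem exists_norm_mul_proj_lt {S : N.toStarSubalgebra} {ε δ : ℝ} (hS : of hN S ∈ ball hN ε δ) :
    ∃ K : InvSub N, InvSub.codim Ω K < δ ∧ ‖(S : H →L[ℂ] H) * K.proj‖ < ε := by
  obtain ⟨K, hK, T, hT, h⟩ := hS
  have h1 : (S : H →L[ℂ] H) * K.proj = T * K.proj := by
    ext ξ
    exact (rel_of S _).unique (h _ (K.proj_mem_self ξ))
  exact ⟨K, hK, h1 ▸ (K.norm_mul_proj_le T).trans_lt hT⟩

/-- If `S p` has small norm, so has its adjoint `p S⋆`. The latter agrees with `S⋆` on the preimage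
of the range of `p` under `S⋆`, which is at least as large as that range. -/
theorem of_star_mem_ball {S : N.toStarSubalgebra} {ε δ : ℝ} (hS : of hN S ∈ ball hN ε δ) :
    of hN (star S) ∈ ball hN ε δ := by
  obtain ⟨K, hK, h2⟩ := exists_norm_mul_proj_lt hS
  have h3 : K.proj * star (S : H →L[ℂ] H) = star ((S : H →L[ℂ] H) * K.proj) := by
    rw [star_mul, K.proj_isStarProjection.isSelfAdjoint.star_eq]
  refine ⟨K.comap (star (S : H →L[ℂ] H)) (star_mem S.2),
    (InvSub.codim_comap_le hN K _).trans_lt hK, K.proj * star (S : H →L[ℂ] H), ?_, fun ξ hξ => ?_⟩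
  · rwa [h3, norm_star]
  · have h4 : (K.proj * star (S : H →L[ℂ] H)) ξ = star (S : H →L[ℂ] H) ξ :=
      InvSub.proj_eq_self (InvSub.mem_comap.1 hξ)
    rw [h4]
    exact rel_of (star S) ξ

theorem of_mul_mem_ball {S T : N.toStarSubalgebra} {ε δ C : ℝ} (hC : 0 < C)
    (hT : ‖(T : H →L[ℂ] H)‖ ≤ C) (hS : of hN S ∈ ball hN ε δ) :
    of hN (S * T) ∈ ball hN (C * ε) δ := by
  obtain ⟨K, hK, R, hR, h⟩ := hS
  refine ⟨K.comap T T.2, (InvSub.codim_comap_le hN K _).trans_lt hK, R * (T : H →L[ℂ] H), ?_, ?_⟩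
  · rw [mul_comm]
    exact (norm_mul_le _ _).trans_lt (mul_lt_mul_of_nonneg_of_pos hR hT (norm_nonneg _) hC)
  · intro ξ hξ
    have h1 := (rel_of S _).unique (h _ (InvSub.mem_comap.1 hξ))
    have h2 := rel_of (hN := hN) (S * T) ξ
    change Rel _ ξ ((S : H →L[ℂ] H) ((T : H →L[ℂ] H) ξ)) at h2
    rw [h1] at h2
    exact h2

theorem of_smul_eq (S T : N.toStarSubalgebra) : of hN (S * T) = S • of hN T :=
  eq_of_eventually (Eventually.of_forall fun ξ => ⟨_, rel_of (S * T) ξ, (rel_of T ξ).smul S⟩)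

/-- Taking bounds `1 / (n + 1)` on subspaces of summable codimension, `a` vanishes on their
intersection. This gives the Hausdorff property. -/
theorem eq_zero_of_forall_mem_ball {a : UAff hN} (h : ∀ ε > 0, ∀ δ > 0, a ∈ ball hN ε δ) :
    a = 0 := by
  refine eq_of_eventually (eventually_ess.2 fun δ hδ => ?_)
  choose K hK T hT hKT using fun n : ℕ =>
    h (1 / ((n : ℝ) + 1)) (by positivity) (δ / 4 * (1 / 2 : ℝ) ^ n) (by positivity)
  refine ⟨InvSub.iInter K, (InvSub.codim_iInter_le hN (c := δ / 2) fun m => ?_).trans_lt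
    (by linarith), fun ξ hξ => ⟨0, ?_, rel_zero ξ⟩⟩
  · calc ∑ n ∈ Finset.range m, InvSub.codim Ω (K n)
        ≤ ∑ n ∈ Finset.range m, δ / 4 * (1 / 2 : ℝ) ^ n := Finset.sum_le_sum fun n _ => (hK n).le
      _ = δ / 4 * ∑ n ∈ Finset.range m, (1 / 2 : ℝ) ^ n := by rw [Finset.mul_sum]
      _ ≤ δ / 4 * 2 := by gcongr; exact sum_geometric_two_le m
      _ = δ / 2 := by ring
  · have h1 : ∀ n, T n ξ = T 0 ξ := fun n =>
      (hKT n ξ (InvSub.mem_iInter.1 hξ n)).unique (hKT 0 ξ (InvSub.mem_iInter.1 hξ 0))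
    have h2 : ∀ n : ℕ, ‖T 0 ξ‖ ≤ 1 / ((n : ℝ) + 1) * ‖ξ‖ := fun n => by
      rw [← h1 n]
      exact (T n).le_of_opNorm_le (hT n).le ξ
    have h3 : ‖T 0 ξ‖ ≤ 0 := by
      refine ge_of_tendsto' (x := atTop) (f := fun n : ℕ => 1 / ((n : ℝ) + 1) * ‖ξ‖) ?_ h2
      simpa using (tendsto_one_div_add_atTop_nhds_zero_nat (𝕜 := ℝ)).mul_const ‖ξ‖
    have h4 := hKT 0 ξ (InvSub.mem_iInter.1 hξ 0)
    rwa [norm_le_zero_iff.1 h3] at h4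

end UAff

end

section

variable {H : Type u} [NormedAddCommGroup H] [InnerProductSpace ℂ H] [CompleteSpace H]
variable {N : VonNeumannAlgebra H} {Ω : H}

/-! ### The measure topology -/

namespace UAff

variable {hN : IsTracialGNS N Ω}

theorem exists_ball_subset_inter {ε δ ε' δ' : ℝ} (h : 0 < ε ∧ 0 < δ) (h' : 0 < ε' ∧ 0 < δ') :
    ∃ r, (0 < r ∧ 0 < r) ∧ ball hN r r ⊆ ball hN ε δ ∩ ball hN ε' δ' := by
  refine ⟨min (min ε δ) (min ε' δ'), ?_, Set.subset_inter (ball_mono ?_ ?_) (ball_mono ?_ ?_)⟩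
  · have : 0 < min (min ε δ) (min ε' δ') := lt_min (lt_min h.1 h.2) (lt_min h'.1 h'.2)
    exact ⟨this, this⟩
  all_goals simp

/-- The filter basis of the measure topology. -/
@[reducible]
def ballBasis (hN : IsTracialGNS N Ω) : AddGroupFilterBasis (UAff hN) :=
  addGroupFilterBasisOfComm {V | ∃ ε > 0, ∃ δ > 0, V = ball hN ε δ}
    ⟨_, 1, one_pos, 1, one_pos, rfl⟩
    (by
      rintro _ _ ⟨ε, hε, δ, hδ, rfl⟩ ⟨ε', hε', δ', hδ', rfl⟩
      obtain ⟨r, hr, h⟩ := exists_ball_subset_inter (hN := hN) ⟨hε, hδ⟩ ⟨hε', hδ'⟩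
      exact ⟨_, ⟨r, hr.1, r, hr.1, rfl⟩, h⟩)
    (by
      rintro _ ⟨ε, hε, δ, hδ, rfl⟩
      exact zero_mem_ball hε hδ)
    (by
      rintro _ ⟨ε, hε, δ, hδ, rfl⟩
      refine ⟨_, ⟨ε / 2, half_pos hε, δ / 2, half_pos hδ, rfl⟩, ?_⟩
      rintro _ ⟨a, ha, b, hb, rfl⟩
      have := add_mem_ball ha hb
      rwa [add_halves, add_halves] at this)
    (by
      rintro _ ⟨ε, hε, δ, hδ, rfl⟩
      exact ⟨_, ⟨ε, hε, δ, hδ, rfl⟩, fun a ha => neg_mem_ball ha⟩)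

instance : TopologicalSpace (UAff hN) := measureTopology N Ω

theorem isOpen_iff {U : Set (UAff hN)} :
    IsOpen U ↔ ∀ b ∈ U, ∃ ε > 0, ∃ δ > 0, ∀ a : UAff hN, a - b ∈ ball hN ε δ → a ∈ U := by
  have h : ∀ (a b : UAff hN) (ε δ : ℝ),
      sdiff (Affiliated.op a) (Affiliated.op b) ∈ measureNhd N Ω ε δ ↔ a - b ∈ ball hN ε δ := by
    intro a b ε δ
    rw [← mem_measureNhd_iff, sub_op]
    rfl
  simp only [← h]
  rfl

/-- Identifying the given topology with a group topology provides the uniform structure used for the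
extension. -/
theorem ballBasis_topology : (ballBasis hN).topology = (inferInstance : TopologicalSpace (UAff hN)) := by
  ext U
  rw [isOpen_iff, @isOpen_iff_mem_nhds _ (ballBasis hN).topology]
  refine forall₂_congr fun b _ => ?_
  rw [((ballBasis hN).nhds_hasBasis b).mem_iff]
  constructor
  · rintro ⟨_, ⟨ε, hε, δ, hδ, rfl⟩, h⟩
    exact ⟨ε, hε, δ, hδ, fun a ha => h ⟨a - b, ha, add_sub_cancel b a⟩⟩
  · rintro ⟨ε, hε, δ, hδ, h⟩
    refine ⟨_, ⟨ε, hε, δ, hδ, rfl⟩, ?_⟩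
    rintro _ ⟨a, ha, rfl⟩
    refine h _ ?_
    rwa [add_sub_cancel_left]

instance : IsTopologicalAddGroup (UAff hN) := by
  have h := (ballBasis hN).isTopologicalAddGroup
  rwa [ballBasis_topology] at h

theorem nhds_zero_hasBasis : (𝓝 (0 : UAff hN)).HasBasis (fun r : ℝ × ℝ => 0 < r.1 ∧ 0 < r.2)
    fun r => ball hN r.1 r.2 := by
  have h := (ballBasis hN).nhds_zero_hasBasis
  rw [ballBasis_topology] at h
  refine ⟨fun U => h.mem_iff.trans ?_⟩
  constructor
  · rintro ⟨_, ⟨ε, hε, δ, hδ, rfl⟩, h⟩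
    exact ⟨(ε, δ), ⟨hε, hδ⟩, h⟩
  · rintro ⟨⟨ε, δ⟩, ⟨hε, hδ⟩, h⟩
    exact ⟨_, ⟨ε, hε, δ, hδ, rfl⟩, h⟩

theorem ball_mem_nhds {ε δ : ℝ} (hε : 0 < ε) (hδ : 0 < δ) : ball hN ε δ ∈ 𝓝 (0 : UAff hN) :=
  nhds_zero_hasBasis.mem_of_mem (i := (ε, δ)) ⟨hε, hδ⟩

instance : T2Space (UAff hN) := by
  refine IsTopologicalAddGroup.t2Space_of_zero_sep fun a ha => ?_
  by_contra h
  push Not at h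
  exact ha (eq_zero_of_forall_mem_ball fun ε hε δ hδ => h _ (ball_mem_nhds hε hδ))

instance : UniformSpace (UAff hN) := IsTopologicalAddGroup.rightUniformSpace _

instance : IsUniformAddGroup (UAff hN) := isUniformAddGroup_of_addCommGroup

theorem nhds_zero_hasAntitoneBasis : (𝓝 (0 : UAff hN)).HasBasis (fun _ : ℕ => True)
    fun n => ball hN ((1 / 2) ^ n) ((1 / 2) ^ n) := by
  refine nhds_zero_hasBasis.to_hasBasis ?_ ?_
  · rintro ⟨ε, δ⟩ ⟨hε, hδ⟩
    obtain ⟨n, hn⟩ := exists_pow_lt_of_lt_one (lt_min hε hδ) (by norm_num : (1 / 2 : ℝ) < 1)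
    exact ⟨n, trivial, ball_mono (hn.le.trans (min_le_left _ _)) (hn.le.trans (min_le_right _ _))⟩
  · intro n _
    exact ⟨(_, _), ⟨by positivity, by positivity⟩, subset_rfl⟩

instance : (𝓝 (0 : UAff hN)).IsCountablyGenerated :=
  nhds_zero_hasAntitoneBasis.isCountablyGenerated

instance : (uniformity (UAff hN)).IsCountablyGenerated := by
  rw [uniformity_eq_comap_nhds_zero]
  infer_instance

/-- Off a set of small codimension all increments from index `k` on are bounded operators with
summable norms, so the sequence converges there in operator norm. The limits on an exhaustion are
compatible and glue to an affiliated operator. -/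
theorem exists_tendsto_of_sub_mem_ball (v : ℕ → UAff hN)
    (hv : ∀ n, v (n + 1) - v n ∈ ball hN ((1 / 2) ^ n) ((1 / 2) ^ n)) :
    ∃ a, Tendsto v atTop (𝓝 a) := by
  obtain ⟨Q, hP, hQ, hlim⟩ := InvSub.exists_exhaustion hN
    (P := fun K => ∃ T : H →L[ℂ] H, ∃ R : ℕ → H →L[ℂ] H,
      (∀ᶠ n in atTop, ∀ ξ ∈ K, (v n).Rel ξ (R n ξ)) ∧ Tendsto R atTop (𝓝 T))
    (fun K L hKL ⟨T, R, h, h'⟩ => ⟨T, R, h.mono fun n hn ξ hξ => hn ξ (hKL ξ hξ), h'⟩) (by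
      intro δ hδ
      choose K hK S hS hKS using hv
      -- The increments from `k` on cost codimension `2 · 2⁻ᵏ < δ / 2`; the other half is spent on
      -- making `v k` bounded.
      obtain ⟨k, hk⟩ := exists_pow_lt_of_lt_one (by positivity : 0 < δ / 4)
        (by norm_num : (1 / 2 : ℝ) < 1)
      obtain ⟨L, hL, B, -, hB⟩ := Affiliated.exists_bounded (v k) Ω (half_pos hδ)
      have hsum : Summable fun i => S (k + i) := by
        refine Summable.of_norm_bounded (g := fun i : ℕ => (1 / 2 : ℝ) ^ k * (1 / 2 : ℝ) ^ i)
          (summable_geometric_two.mul_left _) fun i => ?_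
        rw [← pow_add]
        exact (hS _).le
      refine ⟨L.inter (InvSub.iInter fun i => K (k + i)), ⟨B + ∑' i, S (k + i),
        fun n => B + ∑ i ∈ Finset.range (n - k), S (k + i), ?_, ?_⟩, ?_⟩
      · filter_upwards [eventually_ge_atTop k] with n hn ξ hξ
        obtain ⟨j, rfl⟩ := Nat.exists_eq_add_of_le hn
        rw [Nat.add_sub_cancel_left]
        clear hn
        induction j with
        | zero => simpa using! hB ξ hξ.1
        | succ j ih =>
          have h1 := ih.add (hKS (k + j) ξ (InvSub.mem_iInter.1 hξ.2 j))
          rw [add_sub_cancel] at h1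
          rw [Finset.sum_range_succ, ← add_assoc (B : H →L[ℂ] H)]
          exact h1
      · exact (hsum.hasSum.tendsto_sum_nat.comp (tendsto_sub_atTop_nat k)).const_add B
      · have h1 : InvSub.codim Ω (InvSub.iInter fun i => K (k + i)) ≤ (1 / 2 : ℝ) ^ k * 2 := by
          refine InvSub.codim_iInter_le hN fun m => ?_
          calc ∑ n ∈ Finset.range m, InvSub.codim Ω (K (k + n))
              ≤ ∑ n ∈ Finset.range m, (1 / 2 : ℝ) ^ k * (1 / 2 : ℝ) ^ n := by
                refine Finset.sum_le_sum fun n _ => ?_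
                rw [← pow_add]
                exact (hK _).le
            _ = (1 / 2 : ℝ) ^ k * ∑ n ∈ Finset.range m, (1 / 2 : ℝ) ^ n := by rw [Finset.mul_sum]
            _ ≤ (1 / 2 : ℝ) ^ k * 2 := by
                gcongr
                exact sum_geometric_two_le m
        refine (InvSub.codim_inter_le hN _ _).trans_lt ?_
        linarith)
  choose T R hR hRT using hP
  have happ : ∀ n ξ, Tendsto (fun j => R n j ξ) atTop (𝓝 (T n ξ)) := fun n ξ =>
    (ContinuousLinearMap.apply ℂ H ξ).continuous.tendsto _ |>.comp (hRT n)
  obtain ⟨a, ha⟩ := exists_affiliated hN hQ hlim (T := T)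
    (fun m n hmn ξ hξ => by
      refine tendsto_nhds_unique (happ n ξ) ((happ m ξ).congr' ?_)
      filter_upwards [hR m, hR n] with j h1 h2
      exact (h1 ξ hξ).unique (h2 ξ (hQ m n hmn ξ hξ)))
    (fun n => by
      have h1 : Tendsto (fun j => R n j * (Q n).proj) atTop (𝓝 (T n * (Q n).proj)) :=
        (hRT n).mul_const _
      refine (isClosed_coe N).mem_of_tendsto h1 ?_
      filter_upwards [hR n] with j hj
      exact Affiliated.comp_proj_mem hj)
  let b : UAff hN := a
  refine ⟨b, ?_⟩
  have h0 : Tendsto (fun n => v n - b) atTop (𝓝 0) := by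
    rw [nhds_zero_hasBasis.tendsto_right_iff]
    rintro ⟨ε, δ⟩ ⟨hε, hδ⟩
    obtain ⟨n, hn⟩ := (hlim.eventually (gt_mem_nhds hδ)).exists
    filter_upwards [hR n, (Metric.tendsto_nhds.1 (hRT n)) ε hε] with j h1 h2
    refine ⟨Q n, hn, R n j - T n, by rwa [← dist_eq_norm], fun ξ hξ => ?_⟩
    refine (h1 ξ hξ).sub ?_
    have h3 : (ξ, T n ξ) ∈ (a.op.graph : Set (H × H)) := by
      rw [ha]
      exact subset_closure ⟨n, ξ, hξ, rfl⟩
    exact h3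
  have := h0.add_const b
  simpa using this

instance : CompleteSpace (UAff hN) := by
  refine UniformSpace.complete_of_convergent_controlled_sequences
    (fun n => {p : UAff hN × UAff hN | p.2 - p.1 ∈ ball hN ((1 / 2) ^ n) ((1 / 2) ^ n)})
    (fun n => ?_) (fun v hv => ?_)
  · rw [uniformity_eq_comap_nhds_zero]
    exact preimage_mem_comap (ball_mem_nhds (by positivity) (by positivity))
  · exact exists_tendsto_of_sub_mem_ball v fun n => hv n n (n + 1) le_rfl n.le_succ

end UAff

end

section

variable {H : Type u} [NormedAddCommGroup H] [InnerProductSpace ℂ H] [CompleteSpace H]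

/-! ### Von Neumann algebras generated by tracial `⋆`-algebras -/

section Generated

variable {S : Set (H →L[ℂ] H)} {Ω : H}

theorem span_mul_mem (hmul : ∀ x ∈ S, ∀ y ∈ S, x * y ∈ S) {x y : H →L[ℂ] H}
    (hx : x ∈ Submodule.span ℂ S) (hy : y ∈ Submodule.span ℂ S) : x * y ∈ Submodule.span ℂ S := by
  have h := Submodule.mul_mem_mul hx hy
  rw [Submodule.span_mul_span] at h
  refine Submodule.span_mono ?_ h
  rintro _ ⟨x, hx, y, hy, rfl⟩
  exact hmul x hx y hy

theorem span_star_mem (hstar : ∀ x ∈ S, star x ∈ S) {x : H →L[ℂ] H}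
    (hx : x ∈ Submodule.span ℂ S) : star x ∈ Submodule.span ℂ S := by
  induction hx using Submodule.span_induction with
  | mem x h => exact Submodule.subset_span (hstar x h)
  | zero => simp
  | add x y _ _ hx hy => rw [star_add]; exact add_mem hx hy
  | smul c x _ hx => rw [star_smul]; exact Submodule.smul_mem _ _ hx

theorem span_tracial (htr : ∀ x ∈ S, ∀ y ∈ S, vtrace Ω (x * y) = vtrace Ω (y * x))
    {x y : H →L[ℂ] H} (hx : x ∈ Submodule.span ℂ S) (hy : y ∈ Submodule.span ℂ S) :
    vtrace Ω (x * y) = vtrace Ω (y * x) := by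
  have hs : ∀ (c : ℂ) (x : H →L[ℂ] H), vtrace Ω (c • x) = c * vtrace Ω x := fun c x => by
    simp [vtrace]
  induction hx using Submodule.span_induction with
  | zero => simp
  | add x z _ _ hx hz => rw [add_mul, mul_add, vtrace_add, vtrace_add, hx, hz]
  | smul c x _ hx => rw [smul_mul_assoc, mul_smul_comm, hs, hs, hx]
  | mem x h =>
    induction hy using Submodule.span_induction with
    | zero => simp
    | add y z _ _ hy hz => rw [add_mul, mul_add, vtrace_add, vtrace_add, hy, hz]
    | smul c y _ hy => rw [smul_mul_assoc, mul_smul_comm, hs, hs, hy]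
    | mem y h' => exact htr x h y h'

theorem norm_sq_apply (Ω : H) (x : H →L[ℂ] H) : ((‖x Ω‖ ^ 2 : ℝ) : ℂ) = vtrace Ω (star x * x) := by
  rw [vtrace, mul_apply_eq_comp, ContinuousLinearMap.star_eq_adjoint,
    ContinuousLinearMap.adjoint_inner_right, inner_self_eq_norm_sq_to_K]
  simp

/-- The vector state on the generated von Neumann algebra inherits the trace property from a
multiplicative self-adjoint generating set with cyclic vector. -/
theorem isTracialGNS_generated (hone : 1 ∈ S) (hmul : ∀ x ∈ S, ∀ y ∈ S, x * y ∈ S)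
    (hstar : ∀ x ∈ S, star x ∈ S) (hu : vtrace Ω 1 = 1)
    (htr : ∀ x ∈ S, ∀ y ∈ S, vtrace Ω (x * y) = vtrace Ω (y * x))
    (hcyc : Dense {ξ : H | ∃ x ∈ Submodule.span ℂ S, x Ω = ξ}) :
    IsTracialGNS (generated S) Ω := by
  let B := Submodule.span ℂ S
  let e : B →ₗ[ℂ] H := (LinearMap.applyₗ Ω ∘ₗ ContinuousLinearMap.coeLM ℂ) ∘ₗ B.subtype
  have he : ∀ x : B, e x = (x : H →L[ℂ] H) Ω := fun _ => rfl
  have hde : DenseRange e := by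
    refine hcyc.mono ?_
    rintro _ ⟨x, hx, rfl⟩
    exact ⟨⟨x, hx⟩, rfl⟩
  have hnorm : ∀ {x}, x ∈ B → ‖star x Ω‖ = ‖x Ω‖ := by
    intro x hx
    have h1 : ((‖star x Ω‖ ^ 2 : ℝ) : ℂ) = ((‖x Ω‖ ^ 2 : ℝ) : ℂ) := by
      rw [norm_sq_apply, norm_sq_apply, star_star]
      exact span_tracial htr hx (span_star_mem hstar hx)
    exact (sq_eq_sq₀ (norm_nonneg _) (norm_nonneg _)).1 (Complex.ofReal_injective h1)
  -- By the trace property right multiplication is bounded on `BΩ`: `‖xyΩ‖ = ‖y⋆x⋆Ω‖ ≤ ‖y‖ ‖x⋆Ω‖ =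
  -- ‖y‖ ‖xΩ‖`. Its extensions `r y` lie in the commutant.
  have hbound : ∀ {x y}, x ∈ B → y ∈ B → ‖(x * y) Ω‖ ≤ ‖y‖ * ‖x Ω‖ := by
    intro x y hx hy
    rw [← hnorm (span_mul_mem hmul hx hy), star_mul, ← hnorm hx, ← norm_star y]
    exact (star y).le_opNorm _
  have hright : ∀ y ∈ B, ∃ r : H →L[ℂ] H, ∀ x ∈ B, r (x Ω) = (x * y) Ω := by
    intro y hy
    let f : B →ₗ[ℂ] H := (LinearMap.applyₗ (y Ω) ∘ₗ ContinuousLinearMap.coeLM ℂ) ∘ₗ B.subtype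
    refine ⟨f.extendOfNorm e, fun x hx => ?_⟩
    exact LinearMap.extendOfNorm_eq hde ⟨‖y‖, fun x => hbound x.2 hy⟩ ⟨x, hx⟩
  choose! r hr using hright
  have hrc : ∀ y ∈ B, ∀ z ∈ S, z * r y = r y * z := by
    intro y hy z hz
    refine ContinuousLinearMap.ext fun ξ => ?_
    refine hde.induction_on (p := fun ξ => (z * r y) ξ = (r y * z) ξ) ξ
      (isClosed_eq (by fun_prop) (by fun_prop)) fun x => ?_
    rw [he, mul_apply_eq_comp, mul_apply_eq_comp, hr y hy _ x.2]
    have h1 := hr y hy _ (span_mul_mem hmul (Submodule.subset_span hz) x.2)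
    rw [mul_apply_eq_comp] at h1
    rw [h1]
    rfl
  have hmem : ∀ y ∈ B, ∀ T ∈ generated S, T * r y = r y * T := by
    intro y hy T hT
    have h1 : T ∈ Set.centralizer ((StarSubalgebra.centralizer ℂ S : Set (H →L[ℂ] H)) ∪
      star (StarSubalgebra.centralizer ℂ S : Set (H →L[ℂ] H))) := hT
    refine (h1 (r y) (Or.inl ?_)).symm
    rw [SetLike.mem_coe, StarSubalgebra.mem_centralizer_iff]
    exact fun z hz => ⟨hrc y hy z hz, hrc y hy _ (hstar z hz)⟩
  have hoB : (1 : H →L[ℂ] H) ∈ B := Submodule.subset_span hone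
  have hTr : ∀ y ∈ B, ∀ T ∈ generated S, T (y Ω) = r y (T Ω) := by
    intro y hy T hT
    have h1 := hr y hy 1 hoB
    rw [one_mul, one_apply_eq_self] at h1
    rw [← h1]
    exact congrArg (fun T : H →L[ℂ] H => T Ω) (hmem y hy T hT)
  -- the first slot of the trace property restricted to the span
  have hstep : ∀ T ∈ generated S, ∀ y ∈ B, inner ℂ (star T Ω) (y Ω) = inner ℂ (star y Ω) (T Ω) := by
    intro T hT y hy
    have hadj : ∀ x ∈ B, inner ℂ (star y Ω) (x Ω) = inner ℂ Ω ((x * y) Ω) := by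
      intro x hx
      have h1 := span_tracial htr hy hx
      rw [vtrace, vtrace, mul_apply_eq_comp] at h1
      rw [ContinuousLinearMap.star_eq_adjoint, ContinuousLinearMap.adjoint_inner_left, h1]
    have h2 : ∀ ξ : H, inner ℂ (star y Ω) ξ = inner ℂ Ω (r y ξ) := by
      intro ξ
      refine hde.induction_on (p := fun ξ => inner ℂ (star y Ω) ξ = inner ℂ Ω (r y ξ)) ξ
        (isClosed_eq (by fun_prop) (by fun_prop)) fun x => ?_
      rw [he, hadj _ x.2, hr y hy _ x.2]
    rw [ContinuousLinearMap.star_eq_adjoint, ContinuousLinearMap.adjoint_inner_left, h2,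
      hTr y hy T hT]
  refine ⟨hu, ?_, ?_, ?_⟩
  · intro x hx y hy
    have hx' : star x ∈ generated S := star_mem hx
    have hy' : star y ∈ generated S := star_mem hy
    obtain ⟨b, hb, hlim⟩ : ∃ b : ℕ → H →L[ℂ] H, (∀ n, b n ∈ B) ∧
        Tendsto (fun n => b n Ω) atTop (𝓝 (y Ω)) := by
      obtain ⟨w, hw, hlim⟩ := mem_closure_iff_seq_limit.1 (hcyc (y Ω))
      choose b hb hbw using hw
      exact ⟨b, hb, by simpa only [hbw] using hlim⟩
    -- The map `bΩ ↦ b⋆Ω` is isometric on `BΩ`, so the adjoints converge too, with limit `y⋆Ω`. The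
    -- trace identity with one factor in `B` then passes to the limit.
    have hcau : CauchySeq fun n => star (b n) Ω := by
      have h1 := hlim.cauchySeq
      rw [Metric.cauchySeq_iff] at h1 ⊢
      intro ε hε
      obtain ⟨n₀, h2⟩ := h1 ε hε
      refine ⟨n₀, fun m hm n hn => ?_⟩
      have h3 := h2 m hm n hn
      rw [dist_eq_norm] at h3 ⊢
      have h4 := hnorm (B.sub_mem (hb m) (hb n))
      rw [star_sub] at h4
      simp only [sub_apply] at h4
      rwa [h4]
    obtain ⟨ζ, hζ⟩ := cauchySeq_tendsto_of_complete hcau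
    have hζy : ζ = star y Ω := by
      refine hde.eq_of_inner_left (𝕜 := ℂ) (fun z => ?_)
      rw [he]
      have h1 : Tendsto (fun n => inner ℂ (star (b n) Ω) ((z : H →L[ℂ] H) Ω)) atTop
          (𝓝 (inner ℂ ζ ((z : H →L[ℂ] H) Ω))) := hζ.inner tendsto_const_nhds
      have h2 : Tendsto (fun n => inner ℂ (star (z : H →L[ℂ] H) Ω) (b n Ω)) atTop
          (𝓝 (inner ℂ (star (z : H →L[ℂ] H) Ω) (y Ω))) := tendsto_const_nhds.inner hlim
      rw [hstep y hy _ z.2]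
      refine tendsto_nhds_unique h1 (h2.congr fun n => ?_)
      have h3 := span_tracial htr z.2 (hb n)
      rw [vtrace, vtrace, mul_apply_eq_comp, mul_apply_eq_comp] at h3
      rw [ContinuousLinearMap.star_eq_adjoint, ContinuousLinearMap.adjoint_inner_left, h3,
        ContinuousLinearMap.star_eq_adjoint, ContinuousLinearMap.adjoint_inner_left]
    have h1 : Tendsto (fun n => inner ℂ (star x Ω) (b n Ω)) atTop
        (𝓝 (inner ℂ (star x Ω) (y Ω))) := tendsto_const_nhds.inner hlim
    have h2 : Tendsto (fun n => inner ℂ (star (b n) Ω) (x Ω)) atTop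
        (𝓝 (inner ℂ (star y Ω) (x Ω))) := hζy ▸ hζ.inner tendsto_const_nhds
    have h3 := tendsto_nhds_unique (h1.congr fun n => hstep x hx _ (hb n)) h2
    rwa [ContinuousLinearMap.star_eq_adjoint, ContinuousLinearMap.adjoint_inner_left,
      ContinuousLinearMap.star_eq_adjoint, ContinuousLinearMap.adjoint_inner_left] at h3
  · intro x hx h0
    rw [← norm_sq_apply] at h0
    have h1 : x Ω = 0 := by simpa using h0
    refine ContinuousLinearMap.ext fun ξ => ?_
    refine hde.induction_on (p := fun ξ => x ξ = (0 : H →L[ℂ] H) ξ) ξ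
      (isClosed_eq (by fun_prop) (by fun_prop)) fun y => ?_
    rw [he, hTr _ y.2 x hx, h1, map_zero]
    rfl
  · refine hcyc.mono ?_
    rintro _ ⟨x, hx, rfl⟩
    refine ⟨x, ?_, rfl⟩
    refine Submodule.span_le (p := (generated S).toStarSubalgebra.toSubalgebra.toSubmodule)
      |>.2 ?_ hx
    exact subset_generated S

end Generated

/-! ### The tensor square -/

section Tensor

theorem tens_coe (x y : H →L[ℂ] H) (t : H ⊗[ℂ] Conj H) :
    tens x y (t : HTensor H) = ((TensorProduct.mapL x (opRep y) t : H ⊗[ℂ] Conj H) : HTensor H) :=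
  ContinuousLinearMap.completion_apply_coe _ _

theorem tens_tmul (x y : H →L[ℂ] H) (ξ η : H) :
    tens x y ((ξ ⊗ₜ[ℂ] toConj η : H ⊗[ℂ] Conj H) : HTensor H) =
      ((x ξ ⊗ₜ[ℂ] toConj (star y η) : H ⊗[ℂ] Conj H) : HTensor H) := by
  rw [tens_coe]
  rfl

theorem hTensor_ext {E : Type*} [NormedAddCommGroup E] [NormedSpace ℂ E] {S T : HTensor H →L[ℂ] E}
    (h : ∀ ξ η : H, S ((ξ ⊗ₜ[ℂ] toConj η : H ⊗[ℂ] Conj H) : HTensor H) =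
      T ((ξ ⊗ₜ[ℂ] toConj η : H ⊗[ℂ] Conj H) : HTensor H)) : S = T := by
  refine ContinuousLinearMap.ext fun t => ?_
  induction t using UniformSpace.Completion.induction_on with
  | hp => exact isClosed_eq (by fun_prop) (by fun_prop)
  | ih t =>
    induction t using TensorProduct.induction_on with
    | zero => rw [UniformSpace.Completion.coe_zero, map_zero, map_zero]
    | tmul ξ η => exact h ξ (toConj.symm η)
    | add a b ha hb => rw [UniformSpace.Completion.coe_add, map_add, map_add, ha, hb]

theorem tens_mul (x x' y y' : H →L[ℂ] H) : tens x y * tens x' y' = tens (x * x') (y' * y) := by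
  refine hTensor_ext fun ξ η => ?_
  rw [mul_apply_eq_comp, tens_tmul, tens_tmul, tens_tmul, star_mul]
  rfl

theorem tens_one : tens (1 : H →L[ℂ] H) 1 = 1 := by
  refine hTensor_ext fun ξ η => ?_
  rw [tens_tmul]
  rw [star_one]
  rfl

theorem tens_add_left (x x' y : H →L[ℂ] H) : tens (x + x') y = tens x y + tens x' y := by
  refine hTensor_ext fun ξ η => ?_
  simp only [add_apply, tens_tmul, TensorProduct.add_tmul, UniformSpace.Completion.coe_add]

theorem tens_add_right (x y y' : H →L[ℂ] H) : tens x (y + y') = tens x y + tens x y' := by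
  refine hTensor_ext fun ξ η => ?_
  simp only [add_apply, tens_tmul, star_add, map_add, TensorProduct.tmul_add,
    UniformSpace.Completion.coe_add]

theorem star_tens (x y : H →L[ℂ] H) : star (tens x y) = tens (star x) (star y) := by
  refine hTensor_ext fun ξ η => ?_
  refine ext_inner_right ℂ fun t => ?_
  rw [ContinuousLinearMap.star_eq_adjoint, ContinuousLinearMap.adjoint_inner_left, tens_tmul,
    star_star]
  refine DFunLike.congr_fun (hTensor_ext
    (S := (innerSL ℂ ((ξ ⊗ₜ[ℂ] toConj η : H ⊗[ℂ] Conj H) : HTensor H)) ∘L tens x y)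
    (T := innerSL ℂ ((star x ξ ⊗ₜ[ℂ] toConj (y η) : H ⊗[ℂ] Conj H) : HTensor H)) fun ξ' η' => ?_) t
  simp only [ContinuousLinearMap.comp_apply, innerSL_apply_apply, tens_tmul,
    UniformSpace.Completion.inner_coe, TensorProduct.inner_tmul, inner_toConj,
    ContinuousLinearMap.star_eq_adjoint, ContinuousLinearMap.adjoint_inner_left]

theorem norm_opRep_le (x : H →L[ℂ] H) : ‖opRep x‖ ≤ ‖x‖ := by
  refine ContinuousLinearMap.opNorm_le_bound _ (norm_nonneg _) fun ξ => ?_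
  rw [← norm_star x]
  exact (star x).le_opNorm (toConj.symm ξ)

theorem norm_tens_le (x y : H →L[ℂ] H) : ‖tens x y‖ ≤ ‖x‖ * ‖y‖ := by
  refine ContinuousLinearMap.opNorm_le_bound _ (by positivity) fun t => ?_
  induction t using UniformSpace.Completion.induction_on with
  | hp => exact isClosed_le (by fun_prop) (by fun_prop)
  | ih t =>
    rw [tens_coe, UniformSpace.Completion.norm_coe, UniformSpace.Completion.norm_coe]
    refine (ContinuousLinearMap.le_opNorm _ _).trans ?_
    gcongr
    exact (TensorProduct.norm_mapL_le _ _).trans (by gcongr; exact norm_opRep_le y)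

variable {M : VonNeumannAlgebra H} {Ω : H}

theorem tens_mem_sq {x y : H →L[ℂ] H} (hx : x ∈ M) (hy : y ∈ M) : tens x y ∈ sq M :=
  subset_generated _ ⟨x, hx, y, hy, rfl⟩

/-- Elementary tensors form a self-adjoint multiplicative family on which the vector state is a
product of traces. Cyclicity follows by approximating both legs of `ξ ⊗ η̄` by vectors in `MΩ`. -/
theorem IsTracialGNS.sq (hM : IsTracialGNS M Ω) : IsTracialGNS (AffDer.sq M) (tensVec Ω) := by
  refine isTracialGNS_generated ⟨1, one_mem M, 1, one_mem M, tens_one.symm⟩ ?_ ?_ ?_ ?_ ?_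
  · rintro _ ⟨x, hx, y, hy, rfl⟩ _ ⟨x', hx', y', hy', rfl⟩
    exact ⟨_, mul_mem hx hx', _, mul_mem hy' hy, tens_mul _ _ _ _⟩
  · rintro _ ⟨x, hx, y, hy, rfl⟩
    exact ⟨_, star_mem hx, _, star_mem hy, star_tens _ _⟩
  · rw [← tens_one, vtrace_tens, hM.unital, one_mul]
  · rintro _ ⟨x, hx, y, hy, rfl⟩ _ ⟨x', hx', y', hy', rfl⟩
    rw [tens_mul, tens_mul, vtrace_tens, vtrace_tens, hM.tracial x hx x' hx',
      hM.tracial y' hy' y hy]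
  · let W : Submodule ℂ (HTensor H) :=
      (Submodule.span ℂ {T | ∃ x ∈ M, ∃ y ∈ M, T = tens x y}).map
        (LinearMap.applyₗ (tensVec Ω) ∘ₗ ContinuousLinearMap.coeLM ℂ :
          (HTensor H →L[ℂ] HTensor H) →ₗ[ℂ] HTensor H)
    have hpure : ∀ ξ η : H, ((ξ ⊗ₜ[ℂ] toConj η : H ⊗[ℂ] Conj H) : HTensor H) ∈
        W.topologicalClosure := by
      intro ξ η
      have hc : Continuous fun p : H × H =>
          ((p.1 ⊗ₜ[ℂ] toConj p.2 : H ⊗[ℂ] Conj H) : HTensor H) := by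
        refine (UniformSpace.Completion.continuous_coe _).comp ?_
        have h1 : Continuous fun η : H => (toConj η : Conj H) := continuous_id
        exact TensorProduct.continuous_tmul.comp
          (continuous_fst.prodMk (h1.comp continuous_snd))
      refine map_mem_closure₂ (f := fun ξ η => ((ξ ⊗ₜ[ℂ] toConj η : H ⊗[ℂ] Conj H) : HTensor H))
        hc (hM.cyclic ξ) (hM.cyclic η) ?_
      rintro _ ⟨x, hx, rfl⟩ _ ⟨y, hy, rfl⟩
      refine ⟨tens x (star y), Submodule.subset_span ⟨x, hx, _, star_mem hy, rfl⟩, ?_⟩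
      change tens x (star y) (tensVec Ω) = _
      rw [tensVec, tens_tmul, star_star]
    have hall : ∀ t : HTensor H, t ∈ W.topologicalClosure := by
      intro t
      induction t using UniformSpace.Completion.induction_on with
      | hp => exact Submodule.isClosed_topologicalClosure W
      | ih t =>
        induction t using TensorProduct.induction_on with
        | zero => rw [UniformSpace.Completion.coe_zero]; exact zero_mem _
        | tmul ξ η => exact hpure ξ (toConj.symm η)
        | add a b ha hb => rw [UniformSpace.Completion.coe_add]; exact add_mem ha hb
    intro t
    exact hall t

/-- The left action of `M` on the operators affiliated with `M ⊗̄ Mᵒᵖ`. -/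
def tensLeft (x : M.toStarSubalgebra) : (AffDer.sq M).toStarSubalgebra :=
  ⟨tens x 1, tens_mem_sq x.2 (one_mem M)⟩

/-- The right action of `M` on the operators affiliated with `M ⊗̄ Mᵒᵖ`. -/
def tensRight (x : M.toStarSubalgebra) : (AffDer.sq M).toStarSubalgebra :=
  ⟨tens 1 x, tens_mem_sq (one_mem M) x.2⟩

theorem tensLeft_add (x y : M.toStarSubalgebra) : tensLeft (x + y) = tensLeft x + tensLeft y :=
  Subtype.ext (tens_add_left _ _ _)

theorem tensRight_add (x y : M.toStarSubalgebra) :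
    tensRight (x + y) = tensRight x + tensRight y :=
  Subtype.ext (tens_add_right _ _ _)

theorem tensLeft_sub (x y : M.toStarSubalgebra) : tensLeft (x - y) = tensLeft x - tensLeft y := by
  rw [eq_sub_iff_add_eq, ← tensLeft_add, sub_add_cancel]

theorem tensRight_sub (x y : M.toStarSubalgebra) :
    tensRight (x - y) = tensRight x - tensRight y := by
  rw [eq_sub_iff_add_eq, ← tensRight_add, sub_add_cancel]

theorem tensRight_one : tensRight (1 : M.toStarSubalgebra) = 1 := Subtype.ext tens_one

theorem star_tensRight (x : M.toStarSubalgebra) : star (tensRight x) = tensRight (star x) :=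
  Subtype.ext ((star_tens _ _).trans (by simp [tensRight]))

theorem tens_isStarProjection_left {p : H →L[ℂ] H} (hp : IsStarProjection p) :
    IsStarProjection (tens p 1) where
  isIdempotentElem := by
    rw [IsIdempotentElem, tens_mul, hp.isIdempotentElem.eq, one_mul]
  isSelfAdjoint := by
    rw [IsSelfAdjoint, star_tens, hp.isSelfAdjoint.star_eq, star_one]

theorem tens_isStarProjection_right {p : H →L[ℂ] H} (hp : IsStarProjection p) :
    IsStarProjection (tens 1 p) where
  isIdempotentElem := by
    rw [IsIdempotentElem, tens_mul, hp.isIdempotentElem.eq, one_mul]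
  isSelfAdjoint := by
    rw [IsSelfAdjoint, star_tens, hp.isSelfAdjoint.star_eq, star_one]

theorem vtrace_one_sub_tens_left (hM : IsTracialGNS M Ω) (p : H →L[ℂ] H) :
    vtrace (tensVec Ω) (1 - tens p 1) = vtrace Ω (1 - p) := by
  rw [← tens_one, vtrace_sub, vtrace_sub, vtrace_tens, vtrace_tens, hM.unital, mul_one, mul_one]

theorem vtrace_one_sub_tens_right (hM : IsTracialGNS M Ω) (p : H →L[ℂ] H) :
    vtrace (tensVec Ω) (1 - tens 1 p) = vtrace Ω (1 - p) := by
  rw [← tens_one, vtrace_sub, vtrace_sub, vtrace_tens, vtrace_tens, hM.unital, one_mul, one_mul]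

open UAff in
-- If `x p` is small, then so is `(x ⊗ 1)(p ⊗ 1)`, and `1 - p ⊗ 1` has the trace of `1 - p`.
theorem of_tensLeft_mem_ball (hM : IsTracialGNS M Ω) {x : M.toStarSubalgebra} {ε δ : ℝ}
    (hx : of hM x ∈ ball hM ε δ) : of hM.sq (tensLeft x) ∈ ball hM.sq ε δ := by
  obtain ⟨K, hK, h2⟩ := exists_norm_mul_proj_lt hx
  rw [← mem_measureNhd_iff]
  refine ⟨tens K.proj 1, tens_mem_sq K.proj_mem (one_mem M),
    tens_isStarProjection_left K.proj_isStarProjection,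
    ⟨tens ((x : H →L[ℂ] H) * K.proj) 1, ?_, fun ξ => ?_⟩, ?_⟩
  · refine (norm_tens_le _ _).trans_lt (lt_of_le_of_lt ?_ h2)
    exact mul_le_of_le_one_right (norm_nonneg _) ContinuousLinearMap.norm_id_le
  · have h3 := rel_of (hN := hM.sq) (tensLeft x) (tens K.proj 1 ξ)
    have h4 : tens ((x : H →L[ℂ] H) * K.proj) 1 = tens x 1 * tens K.proj 1 := by
      rw [tens_mul, one_mul]
    rw [h4]
    exact h3
  · rwa [vtrace_one_sub_tens_left hM, InvSub.vtrace_one_sub_proj]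

open UAff in
-- The second leg reverses products: a small `p x⋆ = (x p)⋆` gives a small `(1 ⊗ (x⋆)ᵒᵖ)(1 ⊗ pᵒᵖ)`.
-- So the estimate is obtained for `x⋆` and then transferred by taking adjoints.
theorem of_tensRight_mem_ball (hM : IsTracialGNS M Ω) {x : M.toStarSubalgebra} {ε δ : ℝ}
    (hx : of hM x ∈ ball hM ε δ) : of hM.sq (tensRight x) ∈ ball hM.sq ε δ := by
  have hx' : of hM.sq (tensRight (star x)) ∈ ball hM.sq ε δ := by
    obtain ⟨K, hK, h2⟩ := exists_norm_mul_proj_lt hx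
    have h5 : K.proj * star (x : H →L[ℂ] H) = star ((x : H →L[ℂ] H) * K.proj) := by
      rw [star_mul, K.proj_isStarProjection.isSelfAdjoint.star_eq]
    rw [← mem_measureNhd_iff]
    refine ⟨tens 1 K.proj, tens_mem_sq (one_mem M) K.proj_mem,
      tens_isStarProjection_right K.proj_isStarProjection,
      ⟨tens 1 (K.proj * star (x : H →L[ℂ] H)), ?_, fun ξ => ?_⟩, ?_⟩
    · refine (norm_tens_le _ _).trans_lt (lt_of_le_of_lt ?_ h2)
      rw [h5, norm_star]
      exact mul_le_of_le_one_left (norm_nonneg _) ContinuousLinearMap.norm_id_le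
    · have h3 := rel_of (hN := hM.sq) (tensRight (star x)) (tens 1 K.proj ξ)
      have h4 : tens 1 (K.proj * star (x : H →L[ℂ] H)) =
          tens 1 (star (x : H →L[ℂ] H)) * tens 1 K.proj := by
        rw [tens_mul, one_mul]
      rw [h4]
      exact h3
    · rwa [vtrace_one_sub_tens_right hM, InvSub.vtrace_one_sub_proj]
  have h := of_star_mem_ball hx'
  rwa [star_tensRight, star_star] at h

end Tensor

end

section

variable {H : Type u} [NormedAddCommGroup H] [InnerProductSpace ℂ H] [CompleteSpace H]
variable {M : VonNeumannAlgebra H} {Ω : H}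

/-! ### Spectral cut-offs in C⋆-algebras -/

theorem one_sub_cfc {h : H →L[ℂ] H} (hh : IsSelfAdjoint h) {f : ℝ → ℝ} (hf : Continuous f) :
    1 - cfc f h = cfc (fun t => 1 - f t) h := by
  have h1 := cfc_sub (fun _ : ℝ => (1 : ℝ)) f h (by fun_prop) (by fun_prop)
  rw [h1, cfc_const_one ℝ h hh]

theorem one_sub_cfc_mul_eq_zero {h : H →L[ℂ] H} (hh : IsSelfAdjoint h) {f g : ℝ → ℝ}
    (hf : Continuous f) (hg : Continuous g) (hfg : ∀ t, (1 - f t) * (1 - g t * t) = 0) :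
    (1 - cfc f h) * (1 - cfc g h * h) = 0 := by
  have hgt : Continuous fun t => g t * t := hg.mul continuous_id
  have h1 : cfc g h * h = cfc (fun t => g t * t) h := by
    rw [cfc_mul g (fun t => t) h, cfc_id' ℝ h]
  have hf' : Continuous fun t => 1 - f t := by fun_prop
  have hg' : Continuous fun t => 1 - g t * t := by fun_prop
  rw [h1, one_sub_cfc hh hf, one_sub_cfc hh hgt, ← cfc_mul _ _ h hf'.continuousOn hg'.continuousOn]
  simp only [hfg]
  exact cfc_const_zero ℝ h

/-- Continuous functional calculus provides an approximate spectral projection `b` of `z⋆ z` for a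
neighbourhood of `0`, together with a partial inverse `w` away from `0`. -/
theorem exists_cutoff {A : StarSubalgebra ℂ (H →L[ℂ] H)} (hA : IsClosed (A : Set (H →L[ℂ] H)))
    {z : H →L[ℂ] H} (hz : z ∈ A) {s : ℝ} (hs : 0 < s) :
    ∃ b ∈ A, ∃ w : H →L[ℂ] H, ‖b‖ ≤ 1 ∧ ‖z * b‖ ≤ s ∧ ‖w * star z‖ ≤ 2 / s ∧
      (1 - b) * (1 - w * star z * z) = 0 := by
  let h : H →L[ℂ] H := star z * z
  have hh : IsSelfAdjoint h := .star_mul_self z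
  -- `f` is 1 for `|t| ≤ s² / 2` and 0 for `|t| ≥ s²`, while `g(t) = 1 / t` for `|t| ≥ s² / 2`, so
  -- `(1 - f(t)) (1 - t g(t)) = 0`. The norm bounds come from `‖z b‖² = ‖b h b‖` and `‖w z⋆‖² = ‖w h
  -- w‖`.
  let f : ℝ → ℝ := fun t => max 0 (min 1 (2 - 2 * |t| / s ^ 2))
  let g : ℝ → ℝ := fun t => t / max (t ^ 2) ((s ^ 2 / 2) ^ 2)
  have hf : Continuous f := by fun_prop
  have hpos : ∀ t : ℝ, 0 < max (t ^ 2) ((s ^ 2 / 2) ^ 2) := fun t =>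
    lt_max_of_lt_right (by positivity)
  have hg : Continuous g := Continuous.div (by fun_prop) (by fun_prop) fun t => (hpos t).ne'
  have hs2 : 0 < s ^ 2 := by positivity
  have hf0 : ∀ t, 0 ≤ f t := fun t => le_max_left _ _
  have hf1 : ∀ t, f t ≤ 1 := fun t => max_le zero_le_one (min_le_left _ _)
  have hf2 : ∀ t, f t = 0 ∨ |t| ≤ s ^ 2 := by
    intro t
    by_cases ht : |t| ≤ s ^ 2
    · exact Or.inr ht
    · refine Or.inl (max_eq_left ((min_le_right _ _).trans ?_))
      rw [sub_nonpos, le_div_iff₀ hs2]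
      linarith
  have hf3 : ∀ t, f t = 1 ∨ s ^ 2 / 2 ≤ |t| := by
    intro t
    by_cases ht : s ^ 2 / 2 ≤ |t|
    · exact Or.inr ht
    · left
      have h1 : (1 : ℝ) ≤ 2 - 2 * |t| / s ^ 2 := by
        have : 2 * |t| / s ^ 2 ≤ 1 := by
          rw [div_le_one hs2]; linarith
        linarith
      change max 0 (min 1 (2 - 2 * |t| / s ^ 2)) = 1
      rw [min_eq_left h1, max_eq_right zero_le_one]
  have hstar : ∀ k : ℝ → ℝ, star (cfc k h) = cfc k h := fun k =>
    (cfc_predicate k h : IsSelfAdjoint (cfc k h))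
  have hconj : ∀ k : ℝ → ℝ, Continuous k → cfc k h * h * cfc k h = cfc (fun t => k t * t * k t) h := by
    intro k hk
    rw [cfc_mul (fun t => k t * t) k h, cfc_mul k (fun t => t) h, cfc_id' ℝ h]
  refine ⟨cfc f h, cfc_mem (𝕜' := ℂ) f (mul_mem (star_mem hz) hz), cfc g h, ?_, ?_, ?_, ?_⟩
  · refine norm_cfc_le zero_le_one fun t _ => ?_
    rw [Real.norm_eq_abs, abs_of_nonneg (hf0 t)]
    exact hf1 t
  · refine le_of_sq_le_sq ?_ hs.le
    have h1 : ‖z * cfc f h‖ ^ 2 = ‖cfc f h * h * cfc f h‖ := by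
      rw [pow_two, ← CStarRing.norm_star_mul_self, star_mul, hstar]
      simp only [h, mul_assoc]
    rw [h1, hconj f hf]
    refine norm_cfc_le hs2.le fun t _ => ?_
    rw [norm_mul, norm_mul, Real.norm_eq_abs, Real.norm_eq_abs, abs_of_nonneg (hf0 t)]
    rcases hf2 t with h2 | h2
    · rw [h2]; simpa using hs2.le
    · calc f t * |t| * f t ≤ 1 * s ^ 2 * 1 := by
            refine mul_le_mul (mul_le_mul (hf1 t) h2 (abs_nonneg t) zero_le_one) (hf1 t) (hf0 t) ?_
            positivity
        _ = s ^ 2 := by ring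
  · refine le_of_sq_le_sq ?_ (by positivity)
    have h1 : ‖cfc g h * star z‖ ^ 2 = ‖cfc g h * h * cfc g h‖ := by
      rw [pow_two, ← CStarRing.norm_self_mul_star, star_mul, hstar, star_star]
      simp only [h, mul_assoc]
    rw [h1, hconj g hg]
    refine norm_cfc_le (by positivity) fun t _ => ?_
    rw [norm_mul, norm_mul, Real.norm_eq_abs, Real.norm_eq_abs, abs_div, abs_of_pos (hpos t)]
    have h2 : (2 / s) ^ 2 = 4 / s ^ 2 := by ring
    rw [h2]
    rcases le_total (t ^ 2) ((s ^ 2 / 2) ^ 2) with h3 | h3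
    · rw [max_eq_right h3]
      have h4 : |t| ≤ s ^ 2 / 2 := abs_le_of_sq_le_sq h3 (by positivity)
      calc |t| / (s ^ 2 / 2) ^ 2 * |t| * (|t| / (s ^ 2 / 2) ^ 2)
          ≤ (s ^ 2 / 2) / (s ^ 2 / 2) ^ 2 * (s ^ 2 / 2) * ((s ^ 2 / 2) / (s ^ 2 / 2) ^ 2) := by
            gcongr
        _ = 2 / s ^ 2 := by field_simp
        _ ≤ 4 / s ^ 2 := by gcongr; norm_num
    · rw [max_eq_left h3]
      have h4 : s ^ 2 / 2 ≤ |t| := by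
        rw [← abs_of_pos (by positivity : 0 < s ^ 2 / 2)]
        exact sq_le_sq.1 h3
      have h5 : 0 < |t| := lt_of_lt_of_le (by positivity) h4
      rw [← sq_abs t]
      calc |t| / |t| ^ 2 * |t| * (|t| / |t| ^ 2) = 1 / |t| := by field_simp
        _ ≤ 1 / (s ^ 2 / 2) := by gcongr
        _ = 2 / s ^ 2 := by field_simp
        _ ≤ 4 / s ^ 2 := by gcongr; norm_num
  · rw [mul_assoc (cfc g h)]
    refine one_sub_cfc_mul_eq_zero hh hf hg fun t => ?_
    rcases hf3 t with h2 | h2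
    · rw [h2, sub_self, zero_mul]
    · have h3 : (s ^ 2 / 2) ^ 2 ≤ t ^ 2 := by
        rw [← sq_abs t]
        gcongr
      have h4 : t ≠ 0 := by
        rintro rfl
        rw [abs_zero] at h2
        linarith
      have h5 : g t * t = 1 := by
        simp only [g, max_eq_left h3]
        field_simp
      rw [h5, sub_self, mul_zero]

/-- If `1 - p` sends `ξ` into `L`, where `p` projects onto `K`, then `(1 - p) ξ` lies in `L ∩ Kᗮ =
0`. So the preimage of `L` is contained in `K`. -/
theorem InvSub.codim_le_codim_of_disjoint (hM : IsTracialGNS M Ω) {K L : InvSub M}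
    (h : ∀ ξ ∈ L, ξ ∈ K.subᗮ → ξ = 0) : codim Ω K ≤ codim Ω L := by
  have hE : 1 - K.proj ∈ M := sub_mem (one_mem M) K.proj_mem
  refine (codim_mono fun ξ hξ => ?_).trans (codim_comap_le hM L hE)
  have h1 : ξ - K.proj ξ = 0 :=
    h _ (mem_comap.1 hξ) (Submodule.sub_starProjection_mem_orthogonal (K := K.sub) ξ)
  rw [sub_eq_zero.1 h1]
  exact K.proj_mem_self ξ

open UAff in
/-- Elements of `M` that are small in the trace norm are small in measure. -/
theorem of_mem_ball_of_norm_lt (hM : IsTracialGNS M Ω) {ε δ : ℝ} (hε : 0 < ε) (hδ : 0 < δ) :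
    ∃ r > 0, ∀ x : M.toStarSubalgebra, ‖(x : H →L[ℂ] H) Ω‖ < r → of hM x ∈ ball hM ε δ := by
  -- The cut-off at height `ε / 2` has `‖w x⋆‖ ≤ 4 / ε`. With this radius `(1 - w x⋆ x) Ω`, which
  -- lies in `ker (1 - b)`, is within `√δ` of `Ω`.
  refine ⟨√δ * ε / 4, by positivity, fun x hx => ?_⟩
  obtain ⟨b, hb, w, -, h1, h2, h3⟩ := exists_cutoff (isClosed_coe M) x.2 (half_pos hε)
  have hb' : 1 - b ∈ M := sub_mem (one_mem M) hb
  refine ⟨InvSub.ker (1 - b) hb', ?_, (x : H →L[ℂ] H) * b, by linarith, fun ξ hξ => ?_⟩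
  · refine (InvSub.codim_le_of_mem (ξ := (1 - w * star (x : H →L[ℂ] H) * x) Ω) ?_).trans_lt ?_
    · rw [InvSub.mem_ker]
      exact congrArg (fun T : H →L[ℂ] H => T Ω) h3
    · have h4 : Ω - (1 - w * star (x : H →L[ℂ] H) * x) Ω =
          (w * star (x : H →L[ℂ] H)) ((x : H →L[ℂ] H) Ω) := by
        rw [sub_apply, one_apply_eq_self, sub_sub_cancel]
        rfl
      rw [h4]
      have h5 : ‖(w * star (x : H →L[ℂ] H)) ((x : H →L[ℂ] H) Ω)‖ < √δ := by
        refine (ContinuousLinearMap.le_of_opNorm_le _ h2 _).trans_lt ?_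
        calc 2 / (ε / 2) * ‖(x : H →L[ℂ] H) Ω‖ < 2 / (ε / 2) * (√δ * ε / 4) := by gcongr
          _ = √δ := by field_simp; ring
      calc _ < √δ ^ 2 := by gcongr
        _ = δ := Real.sq_sqrt hδ.le
  · have h4 : ξ - b ξ = 0 := hξ
    rw [mul_apply_eq_comp, ← sub_eq_zero.1 h4]
    exact rel_of x ξ

open UAff in
/-- The kernel of `1 - b` for the cut-off of an element that is small in measure is large. -/
theorem codim_ker_cutoff_lt (hM : IsTracialGNS M Ω) {x : M.toStarSubalgebra} {ε δ s : ℝ}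
    (hs : 0 < s) (hε : ε ≤ s / 2) (hx : of hM x ∈ ball hM ε δ) {b w : H →L[ℂ] H}
    (hb : 1 - b ∈ M) (hw : ‖w * star (x : H →L[ℂ] H)‖ ≤ 2 / s)
    (hbw : (1 - b) * (1 - w * star (x : H →L[ℂ] H) * x) = 0) :
    InvSub.codim Ω (InvSub.ker (1 - b) hb) < δ := by
  obtain ⟨L, hL, T, hT, h⟩ := hx
  -- For `ξ ∈ L` orthogonal to `ker (1 - b)`, which contains `(1 - w x⋆ x) ξ`, one gets `‖ξ‖² = ⟪ξ,
  -- w x⋆ x ξ⟫ ≤ (2 / s) ‖T‖ ‖ξ‖²` with `‖T‖ < s / 2`. Hence `ξ = 0`.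
  refine (InvSub.codim_le_codim_of_disjoint hM (L := L) fun ξ hξ hξ' => ?_).trans_lt hL
  by_contra h0
  have hpos : 0 < ‖ξ‖ := norm_pos_iff.2 h0
  have h1 : (1 - w * star (x : H →L[ℂ] H) * x) ξ ∈ InvSub.ker (1 - b) hb := by
    rw [InvSub.mem_ker]
    exact congrArg (fun T : H →L[ℂ] H => T ξ) hbw
  have h2 := Submodule.inner_left_of_mem_orthogonal h1 hξ'
  have h3 : (1 - w * star (x : H →L[ℂ] H) * x) ξ =
      ξ - (w * star (x : H →L[ℂ] H)) ((x : H →L[ℂ] H) ξ) := rfl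
  rw [h3, inner_sub_right, sub_eq_zero] at h2
  have h4 : ‖ξ‖ ^ 2 ≤ ‖ξ‖ * ‖(w * star (x : H →L[ℂ] H)) ((x : H →L[ℂ] H) ξ)‖ := by
    rw [← inner_self_eq_norm_sq (𝕜 := ℂ) ξ, h2]
    exact re_inner_le_norm _ _
  have h5 : ‖(w * star (x : H →L[ℂ] H)) ((x : H →L[ℂ] H) ξ)‖ ≤ 2 / s * (‖T‖ * ‖ξ‖) := by
    refine (ContinuousLinearMap.le_of_opNorm_le _ hw _).trans ?_
    rw [(rel_of x ξ).unique (h ξ hξ)]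
    gcongr
    exact T.le_opNorm ξ
  have h6 : 2 / s * (‖T‖ * ‖ξ‖) < ‖ξ‖ := by
    have : 2 / s * ‖T‖ < 1 := by
      rw [div_mul_eq_mul_div, div_lt_one hs]
      linarith
    calc 2 / s * (‖T‖ * ‖ξ‖) = (2 / s * ‖T‖) * ‖ξ‖ := by ring
      _ < 1 * ‖ξ‖ := by gcongr
      _ = ‖ξ‖ := one_mul _
  nlinarith

/-! ### Derivations -/

section Derivation

variable {A : StarSubalgebra ℂ (H →L[ℂ] H)} {D : A → Affiliated (sq M)}

open UAff

namespace IsDerivation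

/-- A derivation as an additive map into the module of affiliated operators. -/
def toAddMonoidHom (hM : IsTracialGNS M Ω) (hD : IsDerivation M A D) : A →+ UAff hM.sq :=
  AddMonoidHom.mk' D fun a b => ext_op ((hD.map_add a b).trans (add_op _ _).symm)

theorem toAddMonoidHom_smul (hM : IsTracialGNS M Ω) (hD : IsDerivation M A D) (c : ℂ) (a : A) :
    hD.toAddMonoidHom hM (c • a) =
      algebraMap ℂ (sq M).toStarSubalgebra c • hD.toAddMonoidHom hM a :=
  ext_op ((hD.map_smul c a).trans (algebraMap_smul_op _ _).symm)

theorem toAddMonoidHom_mul (hM : IsTracialGNS M Ω) (hD : IsDerivation M A D)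
    (hA : A ≤ M.toStarSubalgebra) (a b : A) :
    hD.toAddMonoidHom hM (a * b) =
      tensLeft (StarSubalgebra.inclusion hA a) • hD.toAddMonoidHom hM b +
        tensRight (StarSubalgebra.inclusion hA b) • hD.toAddMonoidHom hM a := by
  refine ext_op ((hD.leibniz a b).trans ?_)
  rw [add_op, smul_op, smul_op]
  rfl

end IsDerivation

theorem NormMeasureContinuous.exists_norm_lt (hM : IsTracialGNS M Ω) (hD : IsDerivation M A D)
    (hc : NormMeasureContinuous M Ω A D) {ε δ : ℝ} (hε : 0 < ε) (hδ : 0 < δ) :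
    ∃ η > 0, ∀ a : A, ‖(a : H →L[ℂ] H)‖ < η → hD.toAddMonoidHom hM a ∈ ball hM.sq ε δ := by
  let f : A → UAff hM.sq := hD.toAddMonoidHom hM
  have h1 : Continuous[normTopology A, inferInstance] f := hc
  have h2 := @Continuous.tendsto _ _ (normTopology A) _ f h1 0
  have h3 : f 0 = 0 := (hD.toAddMonoidHom hM).map_zero
  rw [h3, nhds_induced] at h2
  have h4 := h2 (ball_mem_nhds hε hδ)
  rw [mem_map, mem_comap] at h4
  obtain ⟨t, ht, hts⟩ := h4
  obtain ⟨η, hη, h5⟩ := Metric.mem_nhds_iff.1 ht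
  refine ⟨η, hη, fun a ha => hts (h5 ?_)⟩
  simpa using ha

/-- A norm-measure continuous derivation on a C⋆-subalgebra is continuous for the measure
topologies. -/
theorem IsDerivation.exists_measure_continuity (hM : IsTracialGNS M Ω) (hD : IsDerivation M A D)
    (hA : A ≤ M.toStarSubalgebra) (hAc : IsClosed (A : Set (H →L[ℂ] H)))
    (hc : NormMeasureContinuous M Ω A D) {ε δ : ℝ} (hε : 0 < ε) (hδ : 0 < δ) :
    ∃ ε' > 0, ∃ δ' > 0, ∀ a : A, of hM (StarSubalgebra.inclusion hA a) ∈ ball hM ε' δ' →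
      hD.toAddMonoidHom hM a ∈ ball hM.sq ε δ := by
  set d := hD.toAddMonoidHom hM with hd
  obtain ⟨η, hη, hηD⟩ := hc.exists_norm_lt hM hD (by positivity : 0 < ε / 3)
    (by positivity : 0 < δ / 3)
  obtain ⟨θ, hθ, hθD⟩ := hc.exists_norm_lt hM hD one_pos (by positivity : 0 < δ / 6)
  -- Continuity at zero and scaling by `θ / 2` bound the image of the whole unit ball in measure,
  -- uniformly.
  have hbdd : ∀ b : A, ‖(b : H →L[ℂ] H)‖ ≤ 1 → d b ∈ ball hM.sq (2 / θ) (δ / 6) := by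
    intro b hb
    have h1 : d (((θ / 2 : ℝ) : ℂ) • b) ∈ ball hM.sq 1 (δ / 6) := by
      refine hθD _ ?_
      have h2 : ‖(((θ / 2 : ℝ) : ℂ) • (b : H →L[ℂ] H))‖ ≤ θ / 2 * 1 := by
        rw [norm_smul, Complex.norm_real, Real.norm_eq_abs, abs_of_pos (half_pos hθ)]
        gcongr
      exact h2.trans_lt (by linarith)
    have h2 : d b = algebraMap ℂ (sq M).toStarSubalgebra ((2 / θ : ℝ) : ℂ) •
        d (((θ / 2 : ℝ) : ℂ) • b) := by
      rw [hd, ← hD.toAddMonoidHom_smul hM, smul_smul, ← Complex.ofReal_mul]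
      have : 2 / θ * (θ / 2) = 1 := by field_simp
      rw [this, Complex.ofReal_one, one_smul]
    have h3 : ‖(algebraMap ℂ (sq M).toStarSubalgebra ((2 / θ : ℝ) : ℂ) :
        HTensor H →L[ℂ] HTensor H)‖ ≤ 2 / θ := ?_
    · rw [h2]
      simpa only [mul_one] using smul_mem_ball (by positivity) h3 h1
    refine ContinuousLinearMap.opNorm_le_bound _ (by positivity) fun ξ => ?_
    change ‖((2 / θ : ℝ) : ℂ) • ξ‖ ≤ _
    rw [norm_smul, Complex.norm_real, Real.norm_eq_abs, abs_of_pos (by positivity)]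
  -- The bound `η / 4` is what `codim_ker_cutoff_lt` needs for a cut-off at height `η / 2`; the
  -- other one offsets the factor `2 / θ` from `hbdd`. Each of the two products adds up two
  -- codimensions below `δ / 6`.
  refine ⟨min (η / 4) (ε / 3 * (θ / 2)), by positivity, δ / 6, by positivity, fun a ha => ?_⟩
  obtain ⟨b, hb, w, hb1, hab, hw, hbw⟩ := exists_cutoff hAc a.2 (half_pos hη)
  have hbM : 1 - b ∈ M := sub_mem (one_mem M) (hA hb)
  let b' : A := ⟨b, hb⟩
  let ι := StarSubalgebra.inclusion hA
  have hK := codim_ker_cutoff_lt hM (half_pos hη) ((min_le_left _ _).trans (by linarith)) ha hbM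
    hw hbw
  have h1 : d (a * b') ∈ ball hM.sq (ε / 3) (δ / 3) :=
    hηD _ (hab.trans_lt (half_lt_self hη))
  have h2 : tensLeft (ι a) • d b' ∈ ball hM.sq (ε / 3) (δ / 3) := by
    refine ball_mono ?_ ?_ (smul_mem_ball_of_mem (of_tensLeft_mem_ball hM ha) (hbdd b' hb1))
    · calc min (η / 4) (ε / 3 * (θ / 2)) * (2 / θ) ≤ (ε / 3 * (θ / 2)) * (2 / θ) := by
            gcongr
            exact min_le_right _ _
        _ = ε / 3 := by field_simp
    · linarith
  have h3 : tensRight (1 - ι b') • d a ∈ ball hM.sq (ε / 3) (δ / 3) := by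
    obtain ⟨C, hC, hCa⟩ := exists_mem_ball (d a) (by positivity : 0 < δ / 6)
    -- `C` depends on `a`, but this does no harm: `1 - b` is exactly zero on a large subspace, hence
    -- below any positive bound there.
    have h4 : of hM (1 - ι b') ∈ ball hM (ε / 3 / C) (δ / 6) := by
      refine ⟨_, hK, 0, by rw [norm_zero]; positivity, fun ξ hξ => ?_⟩
      have h5 := rel_of (hN := hM) (1 - ι b') ξ
      have h6 : ((1 - ι b' : M.toStarSubalgebra) : H →L[ℂ] H) ξ = 0 := hξ
      rwa [h6] at h5
    refine ball_mono ?_ ?_ (smul_mem_ball_of_mem (of_tensRight_mem_ball hM h4) hCa)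
    · rw [div_mul_cancel₀ _ hC.ne']
    · linarith
  have h4 : d a = d (a * b') - tensLeft (ι a) • d b' + tensRight (1 - ι b') • d a := by
    rw [tensRight_sub, tensRight_one, sub_smul, one_smul, hd, hD.toAddMonoidHom_mul hM hA]
    abel
  rw [h4]
  exact ball_mono (by linarith) (by linarith) (add_mem_ball (sub_mem_ball h1 h2) h3)

end Derivation

end

/-! ### Extension by continuity -/

section

/-- An additive map on a group that is continuous at zero for the topology induced by a
homomorphism with dense range extends continuously. -/
theorem exists_continuous_addMonoidHom_extension {G X Y : Type*} [AddCommGroup G]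
    [AddCommGroup X] [UniformSpace X] [IsUniformAddGroup X] [AddCommGroup Y] [UniformSpace Y]
    [IsUniformAddGroup Y] [CompleteSpace Y] [T2Space Y] {i : G →+ X} (hi : DenseRange i)
    {f : G →+ Y} (hf : Tendsto f (comap i (𝓝 0)) (𝓝 0)) :
    ∃ E : X →+ Y, Continuous E ∧ ∀ g, E (i g) = f g := by
  let : UniformSpace G := UniformSpace.comap i inferInstance
  have : IsUniformAddGroup G := IsUniformAddGroup.comap i
  have hi' : IsUniformInducing i := ⟨rfl⟩
  have hf' : UniformContinuous f := by
    refine uniformContinuous_of_continuousAt_zero f ?_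
    rw [ContinuousAt, map_zero, hi'.isInducing.nhds_eq_comap, map_zero]
    exact hf
  have hdi := hi'.isDenseInducing hi
  have hE : Continuous (hdi.extend f) := (uniformContinuous_uniformly_extend hi' hi hf').continuous
  have hEi : ∀ g, hdi.extend f (i g) = f g := fun g => hdi.extend_eq hf'.continuous g
  refine ⟨AddMonoidHom.mk' (hdi.extend f) fun x y => ?_, hE, hEi⟩
  refine hi.induction_on₂ (p := fun x y => hdi.extend f (x + y) = hdi.extend f x + hdi.extend f y)
    ?_ (fun g g' => ?_) x y
  · exact isClosed_eq (by fun_prop) (by fun_prop)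
  · rw [← map_add, hEi, hEi, hEi, map_add]

variable {H : Type u} [NormedAddCommGroup H] [InnerProductSpace ℂ H] [CompleteSpace H]
variable {N M : VonNeumannAlgebra H} {Ω : H}

namespace UAff

section Continuity

variable {hN : IsTracialGNS N Ω} {ι : Type*} {l : Filter ι}

theorem tendsto_iff {f : ι → UAff hN} {a : UAff hN} :
    Tendsto f l (𝓝 a) ↔ ∀ ε > 0, ∀ δ > 0, ∀ᶠ i in l, f i - a ∈ ball hN ε δ := by
  rw [← tendsto_sub_nhds_zero_iff, nhds_zero_hasBasis.tendsto_right_iff]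
  exact ⟨fun h ε hε δ hδ => h (ε, δ) ⟨hε, hδ⟩, fun h r hr => h r.1 hr.1 r.2 hr.2⟩

instance : ContinuousConstSMul N.toStarSubalgebra (UAff hN) where
  continuous_const_smul S := by
    refine continuous_iff_continuousAt.2 fun a => tendsto_iff.2 fun ε hε δ hδ => ?_
    have hC : 0 < ‖(S : H →L[ℂ] H)‖ + 1 := by positivity
    filter_upwards [tendsto_iff.1 tendsto_id _ (div_pos hε hC) δ hδ] with b hb
    rw [← smul_sub]
    have h := smul_mem_ball hC (S := S) (by linarith) hb
    rwa [mul_div_cancel₀ _ hC.ne'] at h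

theorem tendsto_of_mul {f : ι → N.toStarSubalgebra} {x : N.toStarSubalgebra}
    (h : Tendsto (fun i => of hN (f i)) l (𝓝 (of hN x))) (y : N.toStarSubalgebra) :
    Tendsto (fun i => of hN (f i * y)) l (𝓝 (of hN (x * y))) := by
  rw [tendsto_iff] at h ⊢
  intro ε hε δ hδ
  have hC : 0 < ‖(y : H →L[ℂ] H)‖ + 1 := by positivity
  filter_upwards [h _ (div_pos hε hC) δ hδ] with i hi
  rw [← of_sub] at hi ⊢
  rw [← sub_mul]
  have h := of_mul_mem_ball hC (T := y) (by linarith) hi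
  rwa [mul_div_cancel₀ _ hC.ne'] at h

theorem tendsto_smul {f : ι → N.toStarSubalgebra} {x : N.toStarSubalgebra}
    (h : Tendsto (fun i => of hN (f i)) l (𝓝 (of hN x))) (c : UAff hN) :
    Tendsto (fun i => f i • c) l (𝓝 (x • c)) := by
  rw [tendsto_iff] at h ⊢
  intro ε hε δ hδ
  obtain ⟨C, hC, hc⟩ := exists_mem_ball c (half_pos hδ)
  filter_upwards [h _ (div_pos hε hC) _ (half_pos hδ)] with i hi
  rw [← of_sub] at hi
  rw [← sub_smul]
  have h := smul_mem_ball_of_mem hi hc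
  rwa [div_mul_cancel₀ _ hC.ne', add_halves] at h

theorem tendsto_of_tensLeft {hM : IsTracialGNS M Ω} {f : ι → M.toStarSubalgebra}
    {x : M.toStarSubalgebra} (h : Tendsto (fun i => of hM (f i)) l (𝓝 (of hM x))) :
    Tendsto (fun i => of hM.sq (tensLeft (f i))) l (𝓝 (of hM.sq (tensLeft x))) := by
  rw [tendsto_iff] at h ⊢
  intro ε hε δ hδ
  filter_upwards [h ε hε δ hδ] with i hi
  rw [← of_sub] at hi ⊢
  rw [← tensLeft_sub]
  exact of_tensLeft_mem_ball hM hi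

theorem tendsto_of_tensRight {hM : IsTracialGNS M Ω} {f : ι → M.toStarSubalgebra}
    {x : M.toStarSubalgebra} (h : Tendsto (fun i => of hM (f i)) l (𝓝 (of hM x))) :
    Tendsto (fun i => of hM.sq (tensRight (f i))) l (𝓝 (of hM.sq (tensRight x))) := by
  rw [tendsto_iff] at h ⊢
  intro ε hε δ hδ
  filter_upwards [h ε hε δ hδ] with i hi
  rw [← of_sub] at hi ⊢
  rw [← tensRight_sub]
  exact of_tensRight_mem_ball hM hi

/-- The inclusion of `M` in the affiliated operators is continuous for the strong operator
topology and the measure topology. -/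
theorem continuous_of_strongTopology (hM : IsTracialGNS M Ω) :
    Continuous[strongTopology M.toStarSubalgebra, inferInstance] (of hM) := by
  let := strongTopology M.toStarSubalgebra
  have hΩ : Continuous fun x : M.toStarSubalgebra => (x : H →L[ℂ] H) Ω :=
    (continuous_apply Ω).comp continuous_induced_dom
  refine continuous_iff_continuousAt.2 fun x => tendsto_iff.2 fun ε hε δ hδ => ?_
  obtain ⟨r, hr, h⟩ := of_mem_ball_of_norm_lt hM hε hδ
  filter_upwards [hΩ.continuousAt (Metric.ball_mem_nhds _ hr)] with y hy
  rw [← of_sub]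
  refine h _ ?_
  rwa [Set.mem_preimage, mem_ball_iff_norm] at hy

theorem normTopology_le_strongTopology (A : StarSubalgebra ℂ (H →L[ℂ] H)) :
    normTopology A ≤ strongTopology A := by
  refine continuous_id_iff_le.1 ?_
  let := normTopology A
  refine continuous_induced_rng.2 (continuous_pi fun ξ => ?_)
  exact (ContinuousLinearMap.apply ℂ H ξ).continuous.comp continuous_induced_dom

end Continuity

/-- An affiliated operator coincides with some element of `N` on a subspace of small codimension, so
their difference is below every positive bound there. -/
theorem denseRange_of (hM : IsTracialGNS M Ω) : DenseRange (of hM) := by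
  intro a
  rw [mem_closure_iff]
  intro U hU ha
  obtain ⟨ε, hε, δ, hδ, h⟩ := isOpen_iff.1 hU a ha
  obtain ⟨K, hK, T, hT, hKT⟩ := Affiliated.exists_bounded a Ω hδ
  refine ⟨_, h (of hM ⟨T, hT⟩) ⟨K, hK, 0, by rwa [norm_zero], fun ξ hξ => ?_⟩, _, rfl⟩
  have h1 := (rel_of (hN := hM) ⟨T, hT⟩ ξ).sub (hKT ξ hξ)
  rwa [sub_self] at h1

end UAff

/-! ### Density in measure of weakly dense subalgebras -/

namespace IsWeaklyDenseCStar

variable {A : StarSubalgebra ℂ (H →L[ℂ] H)}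

/-- Weak and norm closures of the subspace `Aξ` coincide: a vector orthogonal to `Aξ` is orthogonal
to `xξ`. -/
theorem apply_mem_closure (hA : IsWeaklyDenseCStar M A) {x : H →L[ℂ] H} (hx : x ∈ M) (ξ : H) :
    x ξ ∈ closure {η | ∃ a ∈ A, a ξ = η} := by
  let W : Submodule ℂ H :=
    A.toSubalgebra.toSubmodule.map (ContinuousLinearMap.apply ℂ H ξ : (H →L[ℂ] H) →ₗ[ℂ] H)
  have hW : ∀ a ∈ A, a ξ ∈ W := fun a ha => ⟨a, ha, rfl⟩
  have h1 : x ξ ∈ Wᗮᗮ := by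
    rw [Submodule.mem_orthogonal]
    intro η hη
    have hc : Continuous fun T : H →WOT[ℂ] H => inner ℂ η (T ξ) :=
      ContinuousLinearMapWOT.continuous_inner_apply continuous_id ξ η
    refine closure_minimal ?_ (isClosed_eq hc continuous_const) (hA.dense x hx)
    rintro _ ⟨a, ha, rfl⟩
    exact Submodule.inner_left_of_mem_orthogonal (hW a ha) hη
  rw [Submodule.orthogonal_orthogonal_eq_closure] at h1
  exact h1

open UAff in
-- Only `aΩ` has to be close to `xΩ`, so no norm bound on the approximants is required.
theorem denseRange_of (hA : IsWeaklyDenseCStar M A) (hM : IsTracialGNS M Ω) :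
    DenseRange fun a : A => of hM (StarSubalgebra.inclusion hA.le a) := by
  refine Dense.of_closure ((UAff.denseRange_of hM).mono ?_)
  rintro _ ⟨x, rfl⟩
  rw [mem_closure_iff]
  intro U hU hx
  obtain ⟨ε, hε, δ, hδ, h⟩ := UAff.isOpen_iff.1 hU _ hx
  obtain ⟨r, hr, h'⟩ := of_mem_ball_of_norm_lt hM hε hδ
  obtain ⟨_, ⟨a, ha, rfl⟩, hax⟩ := Metric.mem_closure_iff.1 (hA.apply_mem_closure x.2 Ω) r hr
  refine ⟨_, h (of hM (StarSubalgebra.inclusion hA.le ⟨a, ha⟩)) ?_, ⟨a, ha⟩, rfl⟩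
  rw [← of_sub]
  refine h' _ ?_
  rwa [dist_comm, dist_eq_norm] at hax

end IsWeaklyDenseCStar

/-! ### Extension of derivations to all affiliated operators -/

section Extension

open UAff

variable {A : StarSubalgebra ℂ (H →L[ℂ] H)} {D : A → Affiliated (sq M)}

/-- A norm-measure continuous derivation on a C⋆-subalgebra that is dense in measure extends
continuously to all affiliated operators. -/
theorem IsDerivation.exists_extension (hM : IsTracialGNS M Ω) (hD : IsDerivation M A D)
    (hA : A ≤ M.toStarSubalgebra) (hAc : IsClosed (A : Set (H →L[ℂ] H)))
    (hc : NormMeasureContinuous M Ω A D)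
    (hd : DenseRange fun a : A => of hM (StarSubalgebra.inclusion hA a)) :
    ∃ E : UAff hM →+ UAff hM.sq, Continuous E ∧
      ∀ a : A, E (of hM (StarSubalgebra.inclusion hA a)) = D a := by
  let i : A →+ UAff hM := AddMonoidHom.mk' (fun a => of hM (StarSubalgebra.inclusion hA a))
    fun a b => by rw [_root_.map_add, of_add]
  have hi : DenseRange i := hd
  refine exists_continuous_addMonoidHom_extension hi (f := hD.toAddMonoidHom hM) ?_
  rw [nhds_zero_hasBasis.tendsto_right_iff]
  rintro ⟨ε, δ⟩ ⟨hε, hδ⟩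
  obtain ⟨ε', hε', δ', hδ', h⟩ := hD.exists_measure_continuity hM hA hAc hc hε hδ
  exact mem_of_superset (preimage_mem_comap (ball_mem_nhds hε' hδ')) h

/-- The restriction to `M` of a continuous extension of a derivation is a derivation. -/
theorem IsDerivation.of_extension (hM : IsTracialGNS M Ω) (hD : IsDerivation M A D)
    (hA : A ≤ M.toStarSubalgebra)
    (hd : DenseRange fun a : A => of hM (StarSubalgebra.inclusion hA a))
    {E : UAff hM →+ UAff hM.sq} (hE : Continuous E)
    (hED : ∀ a : A, E (of hM (StarSubalgebra.inclusion hA a)) = D a) :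
    IsDerivation M M.toStarSubalgebra fun x => (E (of hM x) : Affiliated (sq M)) := by
  let ι := StarSubalgebra.inclusion hA
  have hED' : ∀ a : A, E (of hM (ι a)) = hD.toAddMonoidHom hM a := hED
  have happrox : ∀ x : M.toStarSubalgebra, ∃ l : Filter A, l.NeBot ∧
      Tendsto (fun a => of hM (ι a)) l (𝓝 (of hM x)) := fun x =>
    ⟨comap (fun a => of hM (ι a)) (𝓝 (of hM x)),
      comap_neBot_iff_frequently.2 (mem_closure_iff_frequently.1 (hd (of hM x))), tendsto_comap⟩
  have hsmul : ∀ (c : ℂ) (y : UAff hM), E (algebraMap ℂ M.toStarSubalgebra c • y) =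
      algebraMap ℂ (sq M).toStarSubalgebra c • E y := by
    intro c y
    refine hd.induction_on y (isClosed_eq (by fun_prop) (by fun_prop)) fun a => ?_
    have h1 : algebraMap ℂ M.toStarSubalgebra c • of hM (ι a) = of hM (ι (c • a)) := by
      rw [← of_smul_eq, ← Algebra.smul_def, _root_.map_smul]
    rw [h1, hED', hD.toAddMonoidHom_smul, hED']
  -- The Leibniz rule is extended one variable at a time, since for that only separate continuity of
  -- the products is needed.
  have hleft : ∀ (x : M.toStarSubalgebra) (b : A), E (of hM (x * ι b)) =
      tensLeft x • E (of hM (ι b)) + tensRight (ι b) • E (of hM x) := by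
    intro x b
    obtain ⟨l, hl, h⟩ := happrox x
    have h1 := (hE.tendsto _).comp (tendsto_of_mul h (ι b))
    have h2 := (tendsto_smul (tendsto_of_tensLeft h) (E (of hM (ι b)))).add
      (((hE.tendsto _).comp h).const_smul (tensRight (ι b)))
    refine tendsto_nhds_unique h1 (h2.congr fun a => ?_)
    simp only [Function.comp_apply]
    rw [← map_mul, hED', hED', hED', hD.toAddMonoidHom_mul hM hA]
  have hmul : ∀ x y : M.toStarSubalgebra, E (of hM (x * y)) =
      tensLeft x • E (of hM y) + tensRight y • E (of hM x) := by
    intro x y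
    obtain ⟨l, hl, h⟩ := happrox y
    have h0 : Tendsto (fun a => of hM (x * ι a)) l (𝓝 (of hM (x * y))) := by
      simp only [of_smul_eq]
      exact h.const_smul x
    have h1 := (hE.tendsto _).comp h0
    have h2 := (((hE.tendsto _).comp h).const_smul (tensLeft x)).add
      (tendsto_smul (tendsto_of_tensRight h) (E (of hM x)))
    refine tendsto_nhds_unique h1 (h2.congr fun b => ?_)
    exact (hleft x b).symm
  refine ⟨fun x y => ?_, fun c x => ?_, fun x y => ?_⟩
  · rw [of_add, _root_.map_add]
    exact add_op _ _
  · rw [Algebra.smul_def, of_smul_eq, hsmul]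
    exact algebraMap_smul_op _ _
  · rw [hmul]
    refine (add_op _ _).trans ?_
    rw [smul_op, smul_op]
    rfl

theorem normMeasureContinuous_of_extension (hM : IsTracialGNS M Ω) {E : UAff hM →+ UAff hM.sq}
    (hE : Continuous E) :
    NormMeasureContinuous M Ω M.toStarSubalgebra fun x => (E (of hM x) : Affiliated (sq M)) :=
  continuous_le_dom (normTopology_le_strongTopology _)
    (@Continuous.comp _ (UAff hM) (UAff hM.sq) (strongTopology M.toStarSubalgebra) inferInstance
      inferInstance _ _ hE
      (continuous_of_strongTopology hM))

/-- A norm-measure continuous derivation on `M` extends continuously to all affiliated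
operators. -/
theorem IsDerivation.exists_extension_top (hM : IsTracialGNS M Ω)
    {D : M.toStarSubalgebra → Affiliated (sq M)} (hD : IsDerivation M M.toStarSubalgebra D)
    (hc : NormMeasureContinuous M Ω M.toStarSubalgebra D) :
    ∃ E : UAff hM →+ UAff hM.sq, Continuous E ∧ ∀ x, E (of hM x) = D x :=
  hD.exists_extension hM le_rfl (isClosed_coe M) hc (denseRange_of hM)

end Extension

end

end AffDer

end

/-! ### The three statements -/

open AffDer AffDer.UAff in
theorem theorem3p1 {H : Type*} [NormedAddCommGroup H] [InnerProductSpace ℂ H] [CompleteSpace H]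
    (M : VonNeumannAlgebra H) (Ω : H) (hM : AffDer.IsTracialGNS M Ω) :
    (∀ (A : StarSubalgebra ℂ (H →L[ℂ] H)) (hA : AffDer.IsWeaklyDenseCStar M A)
      (D : A → AffDer.Affiliated (AffDer.sq M)),
      AffDer.IsDerivation M A D → AffDer.NormMeasureContinuous M Ω A D →
      ∃! D' : M.toStarSubalgebra → AffDer.Affiliated (AffDer.sq M),
        AffDer.IsDerivation M M.toStarSubalgebra D' ∧
        AffDer.NormMeasureContinuous M Ω M.toStarSubalgebra D' ∧
        ∀ a : A, D' ⟨a, hA.le a.2⟩ = D a) ∧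
    (∀ D : M.toStarSubalgebra → AffDer.Affiliated (AffDer.sq M),
      AffDer.IsDerivation M M.toStarSubalgebra D →
      AffDer.NormMeasureContinuous M Ω M.toStarSubalgebra D →
      Continuous[AffDer.strongTopology M.toStarSubalgebra,
        AffDer.measureTopology (AffDer.sq M) (AffDer.tensVec Ω)] D) ∧
    (∀ D : M.toStarSubalgebra → AffDer.Affiliated (AffDer.sq M),
      AffDer.IsDerivation M M.toStarSubalgebra D →
      AffDer.NormMeasureContinuous M Ω M.toStarSubalgebra D →
      Continuous[AffDer.measureTopologyOn M Ω,
        AffDer.measureTopology (AffDer.sq M) (AffDer.tensVec Ω)] D ∧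
      ∃! E : AffDer.Affiliated M → AffDer.Affiliated (AffDer.sq M),
        Continuous[AffDer.measureTopology M Ω,
          AffDer.measureTopology (AffDer.sq M) (AffDer.tensVec Ω)] E ∧
        ∀ x : M.toStarSubalgebra, E (AffDer.ofMem M x x.2) = D x) := by
  refine ⟨fun A hA D hD hc => ?_, fun D hD hc => ?_, fun D hD hc => ?_⟩
  · have hd := hA.denseRange_of hM
    obtain ⟨E, hE, hED⟩ := hD.exists_extension hM hA.le hA.closed hc hd
    refine ⟨fun x => E (of hM x), ⟨hD.of_extension hM hA.le hd hE hED,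
      normMeasureContinuous_of_extension hM hE, hED⟩, ?_⟩
    rintro D' ⟨hD', hc', h'⟩
    -- A competing extension also extends continuously to all affiliated operators. The two
    -- extensions agree on the image of `A`, which is dense in measure, and the target is Hausdorff.
    obtain ⟨E', hE', hED'⟩ := hD'.exists_extension_top hM hc'
    have h : (E' : UAff hM → UAff hM.sq) = E :=
      hd.equalizer hE' hE (funext fun a => (hED' _).trans ((h' a).trans (hED a).symm))
    funext x
    exact (hED' x).symm.trans (congrFun h (of hM x))
  · obtain ⟨E, hE, hED⟩ := hD.exists_extension_top hM hc
    have h : D = fun x => (E (of hM x) : Affiliated (sq M)) := funext fun x => (hED x).symm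
    rw [h]
    exact @Continuous.comp _ (UAff hM) (UAff hM.sq) (strongTopology M.toStarSubalgebra) inferInstance
      inferInstance _ _ hE
      (continuous_of_strongTopology hM)
  · obtain ⟨E, hE, hED⟩ := hD.exists_extension_top hM hc
    have h : D = fun x => (E (of hM x) : Affiliated (sq M)) := funext fun x => (hED x).symm
    refine ⟨?_, E, ⟨hE, hED⟩, ?_⟩
    · rw [h]
      exact @Continuous.comp _ (UAff hM) (UAff hM.sq) (measureTopologyOn M Ω) inferInstance
        inferInstance _ _ hE continuous_induced_dom
    · rintro E' ⟨hE', hED'⟩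
      exact (denseRange_of hM).equalizer (β := UAff hM) (γ := UAff hM.sq) hE' hE
        (funext fun x => (hED' x).trans (hED x).symm)
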